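/- **Setting.** Let $n\ge 1$, $Y=[0,1]^n$, $Z=[-\tfrac12,\tfrac12)^n$. $L^2(\mathbb R^n)$ and $H^s(\mathbb R^n)$ are spaces of real-valued functions, and $\hat u(\eta)=\int u(x)e^{-2\pi i\eta\cdot x}\,dx$ is the ($L^2$) Fourier transform. Let $A:\mathbb R^n\to\mathbb R^{n\times n}$ be measurable, $Y$-periodic, bounded, symmetric and uniformly elliptic. For $\eta\in\mathbb R^n$ let $\lambda_0(\eta)$ be the smallest eigenvalue of $\mathcal L(\eta)=-(\nabla+2\pi i\eta)\cdot(A(\nabla+2\pi i\eta))$ on $H^1_\sharp(Y;\mathbb C)$, and for $\eta\in Z$ let $\Phi_0(\cdot;\eta)$ be a corresponding $Y$-periodic eigenfunction with $\|\Phi_0(\cdot;\eta)\|_{L^2(Y)}=1$, jointly measurable in $(x,\eta)$. For $\varepsilon>0$ put $\omega_0^\varepsilon(x;\eta)=\Phi_0(x/\varepsilon;\varepsilon\eta)e^{2\pi i\eta\cdot x}$ and $\mathcal A^\varepsilon(u)(x)=\int_{Z/\varepsilon}\hat u(\eta)\,\omega_0^\varepsilon(x;\eta)\,d\eta$. For a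 tensor $\mathbb T$ of order $k$ write $\mathbb T\cdot\eta^{\otimes k}=\sum\mathbb T_{i_1\dots i_k}\eta_{i_1}\cdots\eta_{i_k}$ and $\mathbb TD^k=\sum\mathbb T_{i_1\dots i_k}\partial_{i_1}\cdots\partial_{i_k}$; for $\mathbb T$ of order $2k$ write $\langle D^kw,D^kw\rangle_{\mathbb T}=\sum\mathbb T_{i_1\dots i_{2k}}\,\partial_{i_1}\cdots\partial_{i_k}w\;\partial_{i_{k+1}}\cdots\partial_{i_{2k}}w$. Let $\mathbb A_2^*$ (symmetric) and $\mathbb A_4^*$ be real tensors of orders $2$ and $4$ with $$\lambda_0(\eta)=(2\pi)^2\mathbb A_2^*\cdot\eta^{\otimes2}+(2\pi)^4\mathbb A_4^*\cdot\eta^{\otimes4}+O(|\eta|^6)\qquad(\eta\to0),$$ and let $\mathbb B_2^*,\mathbb B_4^*$ be symmetric, positive semidefinite tensors of orders $2$ and $4$ with $\mathbb A_4^*D^4=-\mathbb B_2^*D^2(\mathbb A_2^*D^2)+\mathbb B_4^*D^4$. (A tensor of order $4$ is symmetric if $\mathbb T_{ijkl}=\mathbb T_{klij}$, and positive semidefinite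 if $\sum\mathbb T_{ijkl}\xi_{ij}\xi_{kl}\ge0$ for symmetric matrices $\xi$.) Let $\mu_1,\mu_2\ge0$, $\kappa>0$, let $K\subset\mathbb R^n$ be compact with $K=-K$, let $f,y_{d,1},y_{d,2}\in L^2(\mathbb R^n)$ have Fourier transforms supported in $K$, and let $\varepsilon>0$ be such that $K\subset Z/\varepsilon$. Let $U^\varepsilon_{ad}\subset L^2(\mathbb R^n)$ be convex and closed, with $\mathcal A^\varepsilon(u_0)\in U^\varepsilon_{ad}$ for some $u_0\in L^2(\mathbb R^n)$, and such that for every $u\in U^\varepsilon_{ad}$ with lowest Bloch coefficient $\hat u_0^\varepsilon(\eta)=\int u(x)\overline{\omega_0^\varepsilon(x;\eta)}\,dx$ (an $L^2(Z/\varepsilon)$-limit of integrals over balls) the function $\int_K\hat u_0^\varepsilon(\eta)\,\omega_0^\varepsilon(\cdot;\eta)\,d\eta$ lies in $U^\varepsilon_{ad}$. Put $$U^*_{ad}=\Big\{u\in L^2(\mathbb R^n)\;\Big|\;u(x)=\int_K\hat v(\eta)e^{2\pi i\eta\cdot x}\,d\eta\ \text{for some}\ \hat v\in L^2(K;\mathbb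 C),\ \ \mathcal A^\varepsilon(u)\in U^\varepsilon_{ad}\Big\},$$ $$\hat U_{ad}=\Big\{\hat u\in L^2(K;\mathbb C)\;\Big|\;\int_K\hat u(\eta)e^{2\pi i\eta\cdot x}\,d\eta\in U^*_{ad}\Big\}.$$ **Fourier form.** With $Q=\varepsilon^2(2\pi)^2\mathbb B_2^*\cdot\eta^{\otimes2}$ and $R=(2\pi)^2(\mathbb A_2^*+\varepsilon^2\mathbb B_2^*)\cdot\eta^{\otimes2}+\varepsilon^2(2\pi)^4\mathbb B_4^*\cdot\eta^{\otimes4}$, minimize over $\hat u\in\hat U_{ad}$ $$\hat I_2^*(\hat u)=\frac{\mu_1}2\int_K\Big|\frac{1+Q}{1+R}(\hat f+\hat u)-\hat y_{d,1}\Big|^2\frac{1+R}{1+Q}\,d\eta+\frac{\mu_2}2\int_K\Big|\frac{1+Q}{1+R}(\hat f+\hat u)-\hat y_{d,2}\Big|^2d\eta+\frac\kappa2\int_K|\hat u|^2\,d\eta .$$ **Control problem.** Put $(\mathbb A_2^*\mathbb B_2^*)_{i_1i_2i_3i_4}=(\mathbb A_2^*)_{i_1i_3}(\mathbb B_2^*)_{i_2i_4}$,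 $(\mathbb B_2^*\mathbb B_2^*)_{i_1i_2i_3i_4}=(\mathbb B_2^*)_{i_1i_3}(\mathbb B_2^*)_{i_2i_4}$, $(\mathbb B_4^*\mathbb B_2^*)_{i_1\dots i_6}=(\mathbb B_4^*)_{i_1i_2i_4i_5}(\mathbb B_2^*)_{i_3i_6}$. Let $w_{d,1}$ be the solution of $-\varepsilon^2\mathbb B_2^*D^2w_{d,1}+w_{d,1}=y_{d,1}$. Minimize, with $v:=w-w_{d,1}$, $$I_2^*(u,y,w)=\frac{\mu_1}2\int_{\mathbb R^n}\Big(\langle Dv,Dv\rangle_{\mathbb A_2^*+2\varepsilon^2\mathbb B_2^*}+\varepsilon^2\langle D^2v,D^2v\rangle_{\mathbb B_4^*+\mathbb A_2^*\mathbb B_2^*+\varepsilon^2\mathbb B_2^*\mathbb B_2^*}+\varepsilon^4\langle D^3v,D^3v\rangle_{\mathbb B_4^*\mathbb B_2^*}+|v|^2\Big)dx$$ $$\qquad+\frac{\mu_2}2\int_{\mathbb R^n}|y-y_{d,2}|^2\,dx+\frac\kappa2\int_{\mathbb R^n}|u|^2\,dx$$ over $u\in U^*_{ad}$, $y\in H^1(\mathbb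 R^n)$, $w\in H^3(\mathbb R^n)$ satisfying, in the weak (distributional) sense, $$-(\mathbb A_2^*+\varepsilon^2\mathbb B_2^*)D^2y+\varepsilon^2\mathbb B_4^*D^4y+y=(\mathrm{Id}-\varepsilon^2\mathbb B_2^*D^2)(f+u),\qquad -\varepsilon^2\mathbb B_2^*D^2w+w=y .$$ **Proposition 4.4.** The function $w_{d,1}$ exists, is unique in $L^2(\mathbb R^n)$ and lies in $H^3(\mathbb R^n)$. The two problems are equivalent: 1. For every $u\in U^*_{ad}$ there are a unique state $y\in H^1(\mathbb R^n)$ and a unique $w$ (unique even in $L^2(\mathbb R^n)$, and belonging to $H^3(\mathbb R^n)$) satisfying the two equations, and $I_2^*(u,y,w)=\hat I_2^*(\hat u|_K)$. 2. For every $u\in U^*_{ad}$ the transform $\hat u$ vanishes outside $K$, and $u\mapsto\hat u|_K$ is a bijection from $U^*_{ad}$ onto $\hat U_{ad}$. 3. A feasible triple $(u,y,w)$ is optimal for the control problem if and only if $\hat u|_K$ minimizes $\hat I_2^*$ in $\hat U_{ad}$. In particular, $\hat I^*_2$ has a unique minimizer $\hat u^*_{2,\hat I}$ in $\hat U_{ad}$,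 the control problem has a unique optimal triple $(u^*_{2,I},y,w)$, and $\hat u^*_{2,\hat I}$ (extended by zero outside $K$) is the Fourier transform of the optimal control $u^*_{2,I}$. -/

import Mathlib

open MeasureTheory Filter Topology
open scoped FourierTransform SchwartzMap LineDeriv ENNReal ContDiff

namespace BlochControl

noncomputable section

/-! ### Function spaces on `ℝⁿ` -/

/-- `ℝⁿ` with the Euclidean norm and Lebesgue measure. -/
abbrev Space (n : ℕ) : Type := EuclideanSpace ℝ (Fin n)

/-- The `i`-th standard basis vector of `ℝⁿ`. -/
abbrev basisVec {n : ℕ} (i : Fin n) : Space n := EuclideanSpace.single i (1 : ℝ)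

/-- The real space `L²(ℝⁿ)`. -/
abbrev L2R (n : ℕ) : Type := Lp ℝ 2 (volume : Measure (Space n))

/-- The complex space `L²(ℝⁿ; ℂ)`. -/
abbrev L2C (n : ℕ) : Type := Lp ℂ 2 (volume : Measure (Space n))

/-- The complex space `L²(K; ℂ)`. -/
abbrev L2On {n : ℕ} (K : Set (Space n)) : Type :=
  Lp ℂ 2 ((volume : Measure (Space n)).restrict K)

/-- The inclusion `L²(ℝⁿ) ⊆ L²(ℝⁿ; ℂ)`. -/
def toComplex {n : ℕ} (u : L2R n) : L2C n := Complex.ofRealCLM.compLp u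

/-- The distribution `φ ↦ ∫ u φ` of a function `u ∈ L²(ℝⁿ)`. -/
def toDist {n : ℕ} (u : L2R n) : 𝓢'(Space n, ℂ) := (toComplex u : 𝓢'(Space n, ℂ))

/-- `u` belongs to the Sobolev space `H^s(ℝⁿ)`. -/
def MemH {n : ℕ} (s : ℝ) (u : L2R n) : Prop := TemperedDistribution.MemSobolev s 2 (toDist u)

/-- The `L²` Fourier transform of `u`, with the convention
`û(η) = ∫ u(x) exp(-2π i x · η) dx`. -/
def fourierHat {n : ℕ} (u : L2R n) : L2C n := 𝓕 (toComplex u)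

/-- The support of the Fourier transform of `u` lies in the closed set `K`. -/
def FourierSuppIn {n : ℕ} (K : Set (Space n)) (u : L2R n) : Prop :=
  ∀ᵐ η : Space n, η ∉ K → fourierHat u η = 0

/-- The restriction to `K` of the Fourier transform of `u`. -/
def fourierOn {n : ℕ} (K : Set (Space n)) (u : L2R n) : L2On K :=
  LpToLpRestrictCLM (Space n) ℂ ℂ volume 2 K (fourierHat u)

/-- The plane wave `exp(2π i η · x)`. -/
def planeWave {n : ℕ} (x η : Space n) : ℂ :=
  Complex.exp (2 * (Real.pi : ℂ) * Complex.I * ((inner ℝ η x : ℝ) : ℂ))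

/-- The function `x ↦ ∫_K û(η) exp(2π i η · x) dη`. -/
def fourierSynthesis {n : ℕ} (K : Set (Space n)) (uhat : L2On K) (x : Space n) : ℂ :=
  ∫ η in K, uhat η * planeWave x η

/-! ### Tensors and constant coefficient differential operators -/

/-- Real tensors of order `k` on `ℝⁿ`, as arrays of their entries. -/
abbrev Tensor (n k : ℕ) : Type := (Fin k → Fin n) → ℝ

/-- `T · η^{⊗ k}`. -/
def contract {n k : ℕ} (T : Tensor n k) (η : Space n) : ℝ :=
  ∑ i : Fin k → Fin n, T i * ∏ j : Fin k, η (i j)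

/-- The iterated partial derivative `∂_{i₁} ⋯ ∂_{i_k}` of a distribution. -/
def partialD {n k : ℕ} (i : Fin k → Fin n) (v : 𝓢'(Space n, ℂ)) : 𝓢'(Space n, ℂ) :=
  ∂^{fun j : Fin k => basisVec (i j)} v

/-- The differential operator `T D^k = ∑ T_{i₁ … i_k} ∂_{i₁} ⋯ ∂_{i_k}`. -/
def diffOp {n k : ℕ} (T : Tensor n k) (v : 𝓢'(Space n, ℂ)) : 𝓢'(Space n, ℂ) :=
  ∑ i : Fin k → Fin n, (T i : ℂ) • partialD i v

open Classical in
/-- The weak derivative `∂_{i₁} ⋯ ∂_{i_k} w` as an element of `L²(ℝⁿ)`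
(it exists for `w ∈ H^k(ℝⁿ)`; the value is `0` if there is no such derivative in `L²`). -/
def weakD {n k : ℕ} (i : Fin k → Fin n) (w : L2R n) : L2R n :=
  if h : ∃ g : L2R n, toDist g = partialD i (toDist w) then h.choose else 0

/-- `⟨D^k w(x), D^k w(x)⟩_T` for a tensor `T` of order `2k`: the first `k` indices belong to the
first factor, the last `k` indices to the second factor. -/
def tensorForm {n : ℕ} (k : ℕ) (T : Tensor n (k + k)) (w : L2R n) (x : Space n) : ℝ :=
  ∑ i : Fin k → Fin n, ∑ j : Fin k → Fin n, T (Fin.append i j) * weakD i w x * weakD j w x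

/-- Composition of two tensors of order two:
`(S T)_{i₁ i₂ i₃ i₄} = S_{i₁ i₃} T_{i₂ i₄}`. -/
def comp22 {n : ℕ} (S T : Tensor n 2) : Tensor n 4 :=
  fun i => S ![i 0, i 2] * T ![i 1, i 3]

/-- Composition of a tensor of order four with one of order two:
`(S T)_{i₁ … i₆} = S_{i₁ i₂ i₄ i₅} T_{i₃ i₆}`. -/
def comp42 {n : ℕ} (S : Tensor n 4) (T : Tensor n 2) : Tensor n 6 :=
  fun i => S ![i 0, i 1, i 3, i 4] * T ![i 2, i 5]

/-- Symmetry of a tensor of order two. -/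
def IsSymm2 {n : ℕ} (T : Tensor n 2) : Prop := ∀ i j, T ![i, j] = T ![j, i]

/-- Symmetric, positive semidefinite tensors of order two. -/
def IsPosSemidef2 {n : ℕ} (T : Tensor n 2) : Prop :=
  IsSymm2 T ∧ ∀ ξ : Space n, 0 ≤ contract T ξ

/-- Symmetric, positive semidefinite tensors of order four: `T_{ijkl} = T_{klij}`, and the
quadratic form of `T` is nonnegative on symmetric matrices. -/
def IsPosSemidef4 {n : ℕ} (T : Tensor n 4) : Prop :=
  (∀ i j k l, T ![i, j, k, l] = T ![k, l, i, j]) ∧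
  ∀ ξ : Matrix (Fin n) (Fin n) ℝ, ξ.IsSymm →
    0 ≤ ∑ i, ∑ j, ∑ k, ∑ l, T ![i, j, k, l] * ξ i j * ξ k l

/-! ### The Bloch eigenvalue problem -/

/-- The unit cube `Y = [0,1]ⁿ`. -/
def unitCell (n : ℕ) : Set (Space n) := {x | ∀ i, x i ∈ Set.Icc (0 : ℝ) 1}

/-- The cell `Z = [-1/2, 1/2)ⁿ` of Bloch frequencies. -/
def dualCell (n : ℕ) : Set (Space n) := {η | ∀ i, η i ∈ Set.Ico (-(1 / 2) : ℝ) (1 / 2)}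

/-- The rescaled cell `Z/ε`. -/
def scaledDualCell (n : ℕ) (ε : ℝ) : Set (Space n) := {η | ε • η ∈ dualCell n}

/-- `Y`-periodicity. -/
def IsPeriodic {n : ℕ} {X : Type*} (g : Space n → X) : Prop :=
  ∀ (x : Space n) (i : Fin n), g (x + basisVec i) = g x

/-- A symmetric, bounded, uniformly elliptic, `Y`-periodic coefficient matrix. -/
structure IsPeriodicCoefficient {n : ℕ} (A : Space n → Matrix (Fin n) (Fin n) ℝ) : Prop where
  measurable : ∀ i j, Measurable fun x => A x i j
  periodic : IsPeriodic A
  symm : ∀ᵐ x : Space n, (A x).IsSymm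
  bounded : ∃ C : ℝ, ∀ᵐ x : Space n, ∀ i j, |A x i j| ≤ C
  elliptic : ∃ α : ℝ, 0 < α ∧ ∀ᵐ x : Space n, ∀ ξ : Fin n → ℝ,
    α * ∑ i, ξ i ^ 2 ≤ ∑ i, ∑ j, A x i j * ξ i * ξ j

/-- `φ ∈ H¹_♯(Y; ℂ)` with weak gradient `G`: a periodic function whose weak partial derivatives
are the periodic functions `G i`, all of them square integrable on `Y`. -/
structure IsPeriodicH1 {n : ℕ} (φ : Space n → ℂ) (G : Fin n → Space n → ℂ) : Prop where
  periodic : IsPeriodic φ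
  periodic_grad : ∀ i, IsPeriodic (G i)
  memLp : MemLp φ 2 (volume.restrict (unitCell n))
  memLp_grad : ∀ i, MemLp (G i) 2 (volume.restrict (unitCell n))
  weak_grad : ∀ (i : Fin n) (ψ : Space n → ℝ), ContDiff ℝ ∞ ψ → HasCompactSupport ψ →
    ∫ x, φ x * ((fderiv ℝ ψ x (basisVec i) : ℝ) : ℂ) = -∫ x, G i x * ((ψ x : ℝ) : ℂ)

/-- The component `(∂_i + 2π i η_i) φ` of the shifted gradient, where `g = ∂_i φ`. -/
def shiftedPartial {n : ℕ} (η : Space n) (i : Fin n) (φ g : Space n → ℂ) (x : Space n) : ℂ :=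
  g x + 2 * (Real.pi : ℂ) * Complex.I * ((η i : ℝ) : ℂ) * φ x

/-- `φ` is an eigenfunction with eigenvalue `μ` of
`ℒ(η) = -(∇ + 2π i η) · (A (∇ + 2π i η))` on `Y`-periodic functions, in the weak sense. -/
def IsBlochEigenpair {n : ℕ} (A : Space n → Matrix (Fin n) (Fin n) ℝ) (η : Space n) (μ : ℝ)
    (φ : Space n → ℂ) : Prop :=
  ∃ G : Fin n → Space n → ℂ, IsPeriodicH1 φ G ∧
    (¬ ∀ᵐ x ∂(volume.restrict (unitCell n)), φ x = 0) ∧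
    ∀ (ψ : Space n → ℂ) (H : Fin n → Space n → ℂ), IsPeriodicH1 ψ H →
      ∫ x in unitCell n, ∑ i, ∑ j, ((A x i j : ℝ) : ℂ) * shiftedPartial η j φ (G j) x *
          (starRingEnd ℂ) (shiftedPartial η i ψ (H i) x)
        = (μ : ℂ) * ∫ x in unitCell n, φ x * (starRingEnd ℂ) (ψ x)

/-- The first Bloch eigenvalue `λ₀(η)`, the smallest eigenvalue of `ℒ(η)`. -/
def firstBlochEigenvalue {n : ℕ} (A : Space n → Matrix (Fin n) (Fin n) ℝ) (η : Space n) : ℝ :=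
  sInf {μ : ℝ | ∃ φ : Space n → ℂ, IsBlochEigenpair A η μ φ}

/-- `Φ(x, η) = Φ₀(x; η)` is a (measurable) choice of first Bloch waves: for every `η ∈ Z` the
function `Φ₀(·; η)` is an eigenfunction of `ℒ(η)` with eigenvalue `λ₀(η)`, normalized in
`L²(Y)`. -/
structure IsFirstBlochWave {n : ℕ} (A : Space n → Matrix (Fin n) (Fin n) ℝ)
    (Φ : Space n → Space n → ℂ) : Prop where
  measurable : Measurable (Function.uncurry Φ)
  eigen : ∀ η ∈ dualCell n,
    IsBlochEigenpair A η (firstBlochEigenvalue A η) (fun x => Φ x η)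
  normalized : ∀ η ∈ dualCell n, ∫ x in unitCell n, ‖Φ x η‖ ^ 2 = 1

/-- The tensors `𝔸₂*` (a symmetric matrix) and `𝔸₄*` of the Taylor expansion
`λ₀(η) = (2π)² 𝔸₂* · η^{⊗2} + (2π)⁴ 𝔸₄* · η^{⊗4} + O(|η|⁶)` at `η = 0`. -/
def IsTaylorTensors {n : ℕ} (A : Space n → Matrix (Fin n) (Fin n) ℝ) (A2 : Tensor n 2)
    (A4 : Tensor n 4) : Prop :=
  IsSymm2 A2 ∧
  (fun η : Space n => firstBlochEigenvalue A η -
      ((2 * Real.pi) ^ 2 * contract A2 η + (2 * Real.pi) ^ 4 * contract A4 η))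
    =O[𝓝 0] fun η : Space n => ‖η‖ ^ 6

/-- A decomposition `𝔸₄* D⁴ = -𝔹₂* D² (𝔸₂* D²) + 𝔹₄* D⁴` with symmetric, positive semidefinite
tensors `𝔹₂*`, `𝔹₄*`. -/
def IsDecomposition {n : ℕ} (A2 : Tensor n 2) (A4 : Tensor n 4) (B2 : Tensor n 2)
    (B4 : Tensor n 4) : Prop :=
  IsPosSemidef2 B2 ∧ IsPosSemidef4 B4 ∧
  ∀ v : 𝓢'(Space n, ℂ), diffOp A4 v = -diffOp B2 (diffOp A2 v) + diffOp B4 v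

/-! ### Adaption and admissible sets -/

/-- The rescaled quasi-periodic Bloch wave `ω₀^ε(x; η) = Φ₀(x/ε; εη) exp(2π i η · x)`. -/
def blochWave {n : ℕ} (Φ : Space n → Space n → ℂ) (ε : ℝ) (x η : Space n) : ℂ :=
  Φ (ε⁻¹ • x) (ε • η) * planeWave x η

/-- The adaption `𝒜^ε(u)(x) = ∫_{Z/ε} û(η) ω₀^ε(x; η) dη`. -/
def adaption {n : ℕ} (Φ : Space n → Space n → ℂ) (ε : ℝ) (u : L2R n) (x : Space n) : ℂ :=
  ∫ η in scaledDualCell n ε, fourierHat u η * blochWave Φ ε x η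

/-- `g` is the lowest Bloch coefficient `û₀^ε(η) = ∫ u(x) conj(ω₀^ε(x; η)) dx`, `η ∈ Z/ε`, of
`u ∈ L²(ℝⁿ)`; as for the Fourier transform, the integral over `ℝⁿ` is the limit in `L²(Z/ε)` of
the integrals over large balls. -/
def IsLowestBlochCoeff {n : ℕ} (Φ : Space n → Space n → ℂ) (ε : ℝ) (u : L2R n)
    (g : Space n → ℂ) : Prop :=
  MemLp g 2 (volume.restrict (scaledDualCell n ε)) ∧
  Tendsto (fun r : ℝ =>
      eLpNorm (fun η : Space n =>
        (∫ x in Metric.ball (0 : Space n) r,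
          ((u x : ℝ) : ℂ) * (starRingEnd ℂ) (blochWave Φ ε x η)) - g η)
        2 (volume.restrict (scaledDualCell n ε)))
    atTop (𝓝 0)

/-- The complex-valued function `F` is (almost everywhere) an element of the set
`U ⊆ L²(ℝⁿ)` of real-valued functions. -/
def FunMem {n : ℕ} (F : Space n → ℂ) (U : Set (L2R n)) : Prop :=
  ∃ v ∈ U, ∀ᵐ x : Space n, ((v x : ℝ) : ℂ) = F x

/-- The assumptions on the admissible set `U = U^ε_ad ⊆ L²(ℝⁿ)`: it is convex and closed, it
contains the adaption of some `u₀ ∈ L²(ℝⁿ)`, and with every `u` it contains the projection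
`u_K(x) = ∫_K û₀^ε(η) ω₀^ε(x; η) dη` to the lowest Bloch mode and to `η ∈ K`. -/
structure IsAdmissibleSet {n : ℕ} (Φ : Space n → Space n → ℂ) (ε : ℝ) (K : Set (Space n))
    (U : Set (L2R n)) : Prop where
  convex : Convex ℝ U
  closed : IsClosed U
  adaption_mem : ∃ u₀ : L2R n, FunMem (adaption Φ ε u₀) U
  projection_mem : ∀ u ∈ U, ∀ g : Space n → ℂ, IsLowestBlochCoeff Φ ε u g →
    FunMem (fun x => ∫ η in K, g η * blochWave Φ ε x η) U

/-- The effective admissible set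
`U*_ad = {u(x) = ∫_K û(η) exp(2π i η · x) dη | 𝒜^ε(u) ∈ U^ε_ad} ⊆ L²(ℝⁿ)`. -/
def effectiveSet {n : ℕ} (Φ : Space n → Space n → ℂ) (ε : ℝ) (K : Set (Space n))
    (U : Set (L2R n)) : Set (L2R n) :=
  {u | (∃ uhat : L2On K, ∀ᵐ x : Space n, ((u x : ℝ) : ℂ) = fourierSynthesis K uhat x) ∧
    FunMem (adaption Φ ε u) U}

/-- The set `Û_ad ⊆ L²(K; ℂ)` of those `û` for which
`u_F(x) = ∫_K û(η) exp(2π i η · x) dη` lies in `U*_ad`. -/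
def fourierEffectiveSet {n : ℕ} (Φ : Space n → Space n → ℂ) (ε : ℝ) (K : Set (Space n))
    (U : Set (L2R n)) : Set (L2On K) :=
  {uhat | FunMem (fourierSynthesis K uhat) (effectiveSet Φ ε K U)}

/-! ### The minimization problem in Fourier form -/

/-- `Q₂^ε(η) = ε² (2π)² 𝔹₂* · η^{⊗2}`. -/
def symbolQ {n : ℕ} (ε : ℝ) (B2 : Tensor n 2) (η : Space n) : ℝ :=
  ε ^ 2 * (2 * Real.pi) ^ 2 * contract B2 η

/-- `R₂^ε(η) = (2π)² (𝔸₂* + ε² 𝔹₂*) · η^{⊗2} + ε² (2π)⁴ 𝔹₄* · η^{⊗4}`. -/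
def symbolR {n : ℕ} (ε : ℝ) (A2 B2 : Tensor n 2) (B4 : Tensor n 4) (η : Space n) : ℝ :=
  (2 * Real.pi) ^ 2 * contract (A2 + ε ^ 2 • B2) η +
    ε ^ 2 * (2 * Real.pi) ^ 4 * contract B4 η

/-- The factor `(1 + Q₂^ε) / (1 + R₂^ε)`. -/
def symbolRatio {n : ℕ} (ε : ℝ) (A2 B2 : Tensor n 2) (B4 : Tensor n 4) (η : Space n) : ℝ :=
  (1 + symbolQ ε B2 η) / (1 + symbolR ε A2 B2 B4 η)

/-- The cost functional `Î₂*` on `L²(K; ℂ)`. -/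
def fourierCost {n : ℕ} (ε μ₁ μ₂ κ : ℝ) (A2 B2 : Tensor n 2) (B4 : Tensor n 4)
    (K : Set (Space n)) (f yd1 yd2 : L2R n) (uhat : L2On K) : ℝ :=
  μ₁ / 2 * (∫ η in K,
      ‖(symbolRatio ε A2 B2 B4 η : ℂ) * (fourierHat f η + uhat η) - fourierHat yd1 η‖ ^ 2 *
        ((1 + symbolR ε A2 B2 B4 η) / (1 + symbolQ ε B2 η)))
  + μ₂ / 2 * (∫ η in K,
      ‖(symbolRatio ε A2 B2 B4 η : ℂ) * (fourierHat f η + uhat η) - fourierHat yd2 η‖ ^ 2)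
  + κ / 2 * ∫ η in K, ‖uhat η‖ ^ 2

/-! ### The optimal control problem -/

/-- The regularized effective state equation
`-(𝔸₂* + ε² 𝔹₂*) D² y + ε² 𝔹₄* D⁴ y + y = (Id - ε² 𝔹₂* D²)(f + u)`,
in the sense of (tempered) distributions. -/
def StateEquation {n : ℕ} (ε : ℝ) (A2 B2 : Tensor n 2) (B4 : Tensor n 4) (f u y : L2R n) : Prop :=
  -diffOp (A2 + ε ^ 2 • B2) (toDist y) + ((ε ^ 2 : ℝ) : ℂ) • diffOp B4 (toDist y) + toDist y
    = toDist (f + u) - ((ε ^ 2 : ℝ) : ℂ) • diffOp B2 (toDist (f + u))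

/-- The auxiliary equation `-ε² 𝔹₂* D² w + w = y`, in the sense of (tempered) distributions. -/
def AuxEquation {n : ℕ} (ε : ℝ) (B2 : Tensor n 2) (y w : L2R n) : Prop :=
  -(((ε ^ 2 : ℝ) : ℂ) • diffOp B2 (toDist w)) + toDist w = toDist y

/-- The cost functional `I₂*(u, y, w)`, for `u, y ∈ L²(ℝⁿ)` and `w, w_{d,1} ∈ H³(ℝⁿ)`. -/
def controlCost {n : ℕ} (ε μ₁ μ₂ κ : ℝ) (A2 B2 : Tensor n 2) (B4 : Tensor n 4)
    (wd1 yd2 u y w : L2R n) : ℝ :=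
  μ₁ / 2 * (∫ x,
      (tensorForm 1 (A2 + (2 * ε ^ 2) • B2) (w - wd1) x
        + ε ^ 2 * tensorForm 2 (B4 + comp22 A2 B2 + ε ^ 2 • comp22 B2 B2) (w - wd1) x
        + ε ^ 4 * tensorForm 3 (comp42 B4 B2) (w - wd1) x
        + |w x - wd1 x| ^ 2))
  + μ₂ / 2 * (∫ x, |y x - yd2 x| ^ 2)
  + κ / 2 * ∫ x, |u x| ^ 2

/-- The feasible triples `(u, y, w)` of the optimal control problem with control set `Uad`: the
control `u` lies in `Uad`, the state `y ∈ H¹(ℝⁿ)` solves the state equation, and `w ∈ H³(ℝⁿ)`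
solves the auxiliary equation with right-hand side `y`. -/
def feasibleSet {n : ℕ} (ε : ℝ) (A2 B2 : Tensor n 2) (B4 : Tensor n 4) (f : L2R n)
    (Uad : Set (L2R n)) : Set (L2R n × L2R n × L2R n) :=
  {p | p.1 ∈ Uad ∧ (MemH 1 p.2.1 ∧ StateEquation ε A2 B2 B4 f p.1 p.2.1) ∧
    (MemH 3 p.2.2 ∧ AuxEquation ε B2 p.2.1 p.2.2)}

/-- `p = (u, y, w)` is an optimal triple of the optimal control problem: it is feasible and it
minimizes `I₂*` among all feasible triples. -/
def IsOptimalTriple {n : ℕ} (ε μ₁ μ₂ κ : ℝ) (A2 B2 : Tensor n 2) (B4 : Tensor n 4)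
    (f wd1 yd2 : L2R n) (Uad : Set (L2R n)) (p : L2R n × L2R n × L2R n) : Prop :=
  p ∈ feasibleSet ε A2 B2 B4 f Uad ∧
  IsMinOn (fun q : L2R n × L2R n × L2R n =>
      controlCost ε μ₁ μ₂ κ A2 B2 B4 wd1 yd2 q.1 q.2.1 q.2.2)
    (feasibleSet ε A2 B2 B4 f Uad) p

/-- `uhat` is a minimizer of `Î₂*` in the set `S ⊆ L²(K; ℂ)`. -/
def IsFourierMinimizer {n : ℕ} (ε μ₁ μ₂ κ : ℝ) (A2 B2 : Tensor n 2) (B4 : Tensor n 4)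
    (K : Set (Space n)) (f yd1 yd2 : L2R n) (S : Set (L2On K)) (uhat : L2On K) : Prop :=
  uhat ∈ S ∧ IsMinOn (fourierCost ε μ₁ μ₂ κ A2 B2 B4 K f yd1 yd2) S uhat

end

end BlochControl

open BlochControl

/-! ### Tempered distributions whose Fourier transform is a function. -/

namespace BlochControl

noncomputable section

variable {n : ℕ}

/-! In Fourier variables the whole problem becomes pointwise multiplication. If a tempered
distribution has a function `h` as its transform, then `T D^k` of it has transform `(2πi)^k
(T·η^{⊗k}) h` (`FourierRep.diffOp`), and equality of such distributions is a.e. equality of the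
functions (`FourierRep.eq_iff`). So the state equation reads `(1+R) ŷ = (1+Q)(f̂ + û)` and the
auxiliary equation `(1+Q) ŵ = ŷ`. Here `0 ≤ Q ≤ R`: the contractions of `B2` and `B4` are
nonnegative by assumption, that of `A2` because it is the leading Taylor term of the nonnegative
eigenvalue `λ₀` (`IsTaylorTensors.contract_nonneg`). Both equations are therefore solved by
division. The solutions have spectrum in `K`, hence lie in every `H^s`, and they are real because
the multipliers are real and even.

Equality of the costs is Plancherel: the quadratic form in `v = w - w_{d,1}` becomes `∫
(1+Q)(1+R)|v̂|²` (`symbol_product`, `integral_state_form`), while `(1+Q) v̂ = (1+Q)/(1+R) (f̂ + û) -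
ŷ_{d,1}`. Since a feasible triple is determined by its control, optimality of triples reduces to
minimizing `Î₂*(û|_K)` over the controls.

That minimization is uniquely solvable because the cost is a sum of squared norms of affine maps
plus `κ/2 ‖·‖²`, hence strongly convex (`existsUnique_isMinOn_of_midpoint`), and the set of controls
is closed, convex and nonempty. Closedness and convexity follow from continuity and linearity of the
adaption, which is restriction of `û` to `Z/ε` followed by the isometry `blochIsometry`. The
isometry comes from unfolding `ℝⁿ` into integer translates of the unit cell: translating by `k`
multiplies the integrand by `exp(2πi k·ζ)`, so Parseval in `ζ` and the normalization of `Φ₀` in `y`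
give the norm. For nonemptiness, the adjoint of the isometry recovers `û₀` as the lowest Bloch
coefficient of the adaption of `u₀`, and the projection property of `U` then admits the function
with transform `û₀` cut off to `K` (`nonempty_effectiveSet`). -/

/-- The Fourier transform of the tempered distribution `d` is the function `h`, in the sense that
`h` is integrable against all Schwartz functions and represents `𝓕 d`. -/
def FourierRep (d : 𝓢'(Space n, ℂ)) (h : Space n → ℂ) : Prop :=
  ∀ φ : 𝓢(Space n, ℂ), Integrable (fun η => φ η * h η) ∧ 𝓕 d φ = ∫ η, φ η * h η

namespace FourierRep

variable {d d' : 𝓢'(Space n, ℂ)} {h h' : Space n → ℂ}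

theorem of_L2 (f : L2C n) : FourierRep (f : 𝓢'(Space n, ℂ)) (𝓕 f : L2C n) := by
  intro φ
  have h1 : MemLp φ 2 (volume : Measure (Space n)) := φ.memLp 2 volume
  have h2 : MemLp (𝓕 f : L2C n) 2 (volume : Measure (Space n)) := Lp.memLp _
  refine ⟨h1.integrable_mul h2, ?_⟩
  rw [Lp.fourier_toTemperedDistribution_eq, Lp.toTemperedDistribution_apply]
  simp [smul_eq_mul]

theorem toDist (u : L2R n) : FourierRep (toDist u) (fourierHat u) := of_L2 _

theorem congr (hd : FourierRep d h) (hh : h =ᵐ[volume] h') : FourierRep d h' := by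
  intro φ
  have : (fun η => φ η * h η) =ᵐ[volume] fun η => φ η * h' η := by
    filter_upwards [hh] with η hη; rw [hη]
  exact ⟨(hd φ).1.congr this, (hd φ).2.trans (integral_congr_ae this)⟩

theorem congr_fun (hd : FourierRep d h) (hh : ∀ η, h η = h' η) : FourierRep d h' :=
  hd.congr (Eventually.of_forall hh)

theorem add (hd : FourierRep d h) (hd' : FourierRep d' h') :
    FourierRep (d + d') (fun η => h η + h' η) := by
  intro φ
  have e : (fun η => φ η * (h η + h' η)) = fun η => φ η * h η + φ η * h' η := by
    ext; ring
  rw [e]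
  refine ⟨(hd φ).1.add (hd' φ).1, ?_⟩
  rw [integral_add (hd φ).1 (hd' φ).1, ← (hd φ).2, ← (hd' φ).2, FourierTransform.fourier_add]
  rfl

theorem smul (hd : FourierRep d h) (c : ℂ) : FourierRep (c • d) (fun η => c * h η) := by
  intro φ
  have e : (fun η => φ η * (c * h η)) = fun η => c * (φ η * h η) := by
    ext; ring
  rw [e]
  refine ⟨(hd φ).1.const_mul c, ?_⟩
  rw [integral_const_mul, ← (hd φ).2, FourierTransform.fourier_smul]
  rfl

theorem neg (hd : FourierRep d h) : FourierRep (-d) (fun η => -h η) := by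
  have h1 := hd.smul (-1)
  rw [neg_one_smul ℂ d] at h1
  exact h1.congr_fun fun η => by ring

theorem sub (hd : FourierRep d h) (hd' : FourierRep d' h') :
    FourierRep (d - d') (fun η => h η - h' η) := by
  simpa [sub_eq_add_neg] using hd.add hd'.neg

theorem zero : FourierRep (0 : 𝓢'(Space n, ℂ)) (fun _ => 0) := by
  intro φ
  refine ⟨by simp, ?_⟩
  simp only [mul_zero, integral_zero]
  rfl

theorem sum {ι : Type*} (s : Finset ι) {d : ι → 𝓢'(Space n, ℂ)} {h : ι → Space n → ℂ}
    (hd : ∀ i ∈ s, FourierRep (d i) (h i)) :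
    FourierRep (∑ i ∈ s, d i) (fun η => ∑ i ∈ s, h i η) := by
  classical
  induction s using Finset.induction_on with
  | empty => simpa using zero
  | insert a s ha ih =>
    simp only [Finset.sum_insert ha]
    exact (hd a (Finset.mem_insert_self a s)).add
      (ih fun i hi => hd i (Finset.mem_insert_of_mem hi))

/-- Multiplication of a distribution acts by duality, so the multiplier moves onto the test
function, which stays Schwartz. This serves both derivatives and Bessel potentials. -/
theorem temperate_mul {g : Space n → ℂ} (hg : g.HasTemperateGrowth) (hd : FourierRep d h)
    (hd' : 𝓕 d' = TemperedDistribution.smulLeftCLM ℂ g (𝓕 d)) :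
    FourierRep d' (fun η => g η * h η) := by
  intro φ
  have e : (fun η => φ η * (g η * h η)) =
      fun η => (SchwartzMap.smulLeftCLM ℂ g φ) η * h η := by
    ext η
    rw [SchwartzMap.smulLeftCLM_apply_apply hg, smul_eq_mul]
    ring
  rw [e, hd', TemperedDistribution.smulLeftCLM_apply_apply]
  exact hd _

theorem lineDeriv (hd : FourierRep d h) (m : Space n) :
    FourierRep (∂_{m} d)
      (fun η => 2 * (Real.pi : ℂ) * Complex.I * ((inner ℝ η m : ℝ) : ℂ) * h η) := by
  have hg : (fun η : Space n => ((inner ℝ η m : ℝ) : ℂ)).HasTemperateGrowth := by fun_prop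
  have h1 : FourierRep
      (𝓕⁻ (TemperedDistribution.smulLeftCLM ℂ (fun η : Space n => ((inner ℝ η m : ℝ) : ℂ)) (𝓕 d)))
      (fun η => ((inner ℝ η m : ℝ) : ℂ) * h η) :=
    hd.temperate_mul hg (FourierTransform.fourier_fourierInv_eq _)
  have h2 := h1.smul (2 * (Real.pi : ℂ) * Complex.I)
  have e : ∂_{m} d = (2 * (Real.pi : ℂ) * Complex.I) •
      (𝓕⁻ (TemperedDistribution.smulLeftCLM ℂ
        (fun η : Space n => ((inner ℝ η m : ℝ) : ℂ)) (𝓕 d))) := by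
    rw [← FourierTransform.fourierInv_smul, ← TemperedDistribution.fourier_lineDerivOp_eq,
      FourierTransform.fourierInv_fourier_eq]
  rw [e]
  exact h2.congr_fun fun η => by ring

theorem partialD {k : ℕ} (i : Fin k → Fin n) (hd : FourierRep d h) :
    FourierRep (partialD i d)
      (fun η => (∏ j, 2 * (Real.pi : ℂ) * Complex.I * ((η (i j) : ℝ) : ℂ)) * h η) := by
  induction k with
  | zero => simpa [BlochControl.partialD] using hd
  | succ k ih =>
    have h1 := (ih (Fin.tail i)).lineDeriv (basisVec (i 0))
    have e : BlochControl.partialD i d =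
        ∂_{basisVec (i 0)} (BlochControl.partialD (Fin.tail i) d) := rfl
    rw [e]
    refine h1.congr_fun fun η => ?_
    rw [Fin.prod_univ_succ]
    simp only [basisVec, EuclideanSpace.inner_single_right, Fin.tail]
    simp
    ring

theorem diffOp {k : ℕ} (T : Tensor n k) (hd : FourierRep d h) :
    FourierRep (diffOp T d)
      (fun η => (2 * (Real.pi : ℂ) * Complex.I) ^ k * (contract T η : ℂ) * h η) := by
  have := sum Finset.univ (fun i _ => (hd.partialD i).smul (T i : ℂ))
  refine this.congr_fun fun η => ?_
  simp only [contract, Complex.ofReal_sum, Complex.ofReal_mul, Complex.ofReal_prod,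
    Finset.prod_mul_distrib, Finset.prod_const, Finset.card_univ, Fintype.card_fin,
    Finset.mul_sum, Finset.sum_mul]
  refine Finset.sum_congr rfl fun i _ => by ring

/-- Testing with a bump function that equals one on a ball shows that `h` is integrable on that
ball; this is what the integrability clause of `FourierRep` provides. -/
theorem locallyIntegrable (hd : FourierRep d h) : LocallyIntegrable h := by
  intro x
  let b : ContDiffBump x := ⟨1, 2, one_pos, one_lt_two⟩
  have hb₁ : HasCompactSupport (Complex.ofRealCLM ∘ b) := b.hasCompactSupport.comp_left rfl
  have hb₂ : ContDiff ℝ ∞ (Complex.ofRealCLM ∘ b) := by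
    exact Complex.ofRealCLM.contDiff.comp b.contDiff
  refine ⟨Metric.closedBall x 1, Metric.closedBall_mem_nhds x one_pos, ?_⟩
  refine ((hd (hb₁.toSchwartzMap hb₂)).1.integrableOn (s := Metric.closedBall x 1)).congr_fun
    (fun y hy => ?_) measurableSet_closedBall
  have : b y = 1 := b.one_of_mem_closedBall hy
  simp [this]

/-- The fundamental lemma of the calculus of variations, with compactly supported smooth functions
seen as Schwartz functions. -/
theorem ae_eq (hd : FourierRep d h) (hd' : FourierRep d h') : h =ᵐ[volume] h' := by
  refine ae_eq_of_integral_contDiff_smul_eq hd.locallyIntegrable hd'.locallyIntegrable ?_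
  intro g g_smooth g_cpt
  have hg₁ : HasCompactSupport (Complex.ofRealCLM ∘ g) := g_cpt.comp_left rfl
  have hg₂ : ContDiff ℝ ∞ (Complex.ofRealCLM ∘ g) := by fun_prop
  have := (hd (hg₁.toSchwartzMap hg₂)).2.symm.trans (hd' (hg₁.toSchwartzMap hg₂)).2
  simpa using this

theorem ext (hd : FourierRep d h) (hd' : FourierRep d' h') (hh : h =ᵐ[volume] h') : d = d' := by
  have : 𝓕 d = 𝓕 d' := by
    ext φ
    exact ((hd.congr hh) φ).2.trans (hd' φ).2.symm
  have e : 𝓕⁻ (𝓕 d) = 𝓕⁻ (𝓕 d') := congrArg _ this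
  rwa [FourierTransform.fourierInv_fourier_eq, FourierTransform.fourierInv_fourier_eq] at e

/-- The bridge from differential equations between distributions to pointwise algebraic identities.
-/
theorem eq_iff (hd : FourierRep d h) (hd' : FourierRep d' h') :
    d = d' ↔ h =ᵐ[volume] h' :=
  ⟨fun e => hd.ae_eq (e ▸ hd'), hd.ext hd'⟩

end FourierRep

/-! ### The state and auxiliary equations in Fourier variables. -/

theorem two_pi_I_sq : (2 * (Real.pi : ℂ) * Complex.I) ^ 2 = -(2 * (Real.pi : ℂ)) ^ 2 := by
  rw [mul_pow, Complex.I_sq]; ring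

theorem two_pi_I_pow_four : (2 * (Real.pi : ℂ) * Complex.I) ^ 4 = (2 * (Real.pi : ℂ)) ^ 4 := by
  rw [mul_pow, Complex.I_pow_four]; ring

theorem contract_add {k : ℕ} (S T : Tensor n k) (η : Space n) :
    contract (S + T) η = contract S η + contract T η := by
  simp [contract, add_mul, Finset.sum_add_distrib]

theorem contract_smul {k : ℕ} (c : ℝ) (T : Tensor n k) (η : Space n) :
    contract (c • T) η = c * contract T η := by
  simp [contract, mul_assoc, Finset.mul_sum]

theorem auxEquation_iff (ε : ℝ) (B2 : Tensor n 2) (y w : L2R n) :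
    AuxEquation ε B2 y w ↔
      ∀ᵐ η : Space n, ((1 + symbolQ ε B2 η : ℝ) : ℂ) * fourierHat w η = fourierHat y η := by
  have hw := FourierRep.toDist w
  have h1 := ((hw.diffOp B2).smul ((ε ^ 2 : ℝ) : ℂ)).neg.add hw
  rw [AuxEquation, h1.eq_iff (FourierRep.toDist y)]
  refine eventually_congr (Eventually.of_forall fun η => ?_)
  simp only [symbolQ, two_pi_I_sq]
  push_cast
  ring_nf

theorem fourierHat_add (u v : L2R n) :
    fourierHat (u + v) =ᵐ[volume] fun η => fourierHat u η + fourierHat v η := by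
  have : fourierHat (u + v) = fourierHat u + fourierHat v := by
    rw [fourierHat, fourierHat, fourierHat, ← FourierTransform.fourier_add]
    congr 1
    exact (Complex.ofRealCLM.compLpL 2 volume).map_add u v
  rw [this]
  exact Lp.coeFn_add _ _

theorem stateEquation_iff (ε : ℝ) (A2 B2 : Tensor n 2) (B4 : Tensor n 4) (f u y : L2R n) :
    StateEquation ε A2 B2 B4 f u y ↔
      ∀ᵐ η : Space n, ((1 + symbolR ε A2 B2 B4 η : ℝ) : ℂ) * fourierHat y η =
        ((1 + symbolQ ε B2 η : ℝ) : ℂ) * (fourierHat f η + fourierHat u η) := by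
  have hy := FourierRep.toDist y
  have hfu := (FourierRep.toDist (f + u)).congr (fourierHat_add f u)
  have h1 := ((hy.diffOp (A2 + ε ^ 2 • B2)).neg.add
    ((hy.diffOp B4).smul ((ε ^ 2 : ℝ) : ℂ))).add hy
  have h2 := hfu.sub ((hfu.diffOp B2).smul ((ε ^ 2 : ℝ) : ℂ))
  rw [StateEquation, h1.eq_iff h2]
  refine eventually_congr (Eventually.of_forall fun η => ?_)
  simp only [symbolQ, symbolR, two_pi_I_sq, two_pi_I_pow_four]
  push_cast
  ring_nf

/-! ### Real-valued functions, conjugate symmetry and multipliers on functions with compact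
spectrum. -/

theorem toComplex_coe (u : L2R n) : toComplex u =ᵐ[volume] fun x => ((u x : ℝ) : ℂ) :=
  ContinuousLinearMap.coeFn_compLp _ _

theorem toComplex_injective : Function.Injective (toComplex (n := n)) := by
  intro u v h
  apply Lp.ext
  filter_upwards [toComplex_coe u, toComplex_coe v] with x hu hv
  rw [h, hv] at hu
  exact_mod_cast hu.symm

theorem fourierHat_injective : Function.Injective (fourierHat (n := n)) := fun _ _ h =>
  toComplex_injective ((Lp.fourierTransformₗᵢ (Space n) ℂ).injective h)

theorem fourierHat_ae_injective {u v : L2R n} (h : fourierHat u =ᵐ[volume] fourierHat v) : u = v :=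
  fourierHat_injective (Lp.ext h)

/-- The Bessel multiplier `(1+|η|²)^{s/2}` is continuous, hence bounded on the compact spectrum. -/
theorem memH_of_fourierSuppIn {K : Set (Space n)} (hK : IsCompact K) (s : ℝ) {w : L2R n}
    (hw : FourierSuppIn K w) : MemH s w := by
  let m : Space n → ℂ := fun η => (((1 + ‖η‖ ^ 2) ^ (s / 2) : ℝ) : ℂ)
  have hm : Continuous m := by
    refine Complex.continuous_ofReal.comp (Continuous.rpow_const (by fun_prop) fun x => Or.inl ?_)
    positivity
  obtain ⟨C, hC⟩ := hK.exists_bound_of_continuousOn hm.continuousOn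
  have hL : MemLp (fun η => m η * fourierHat w η) 2 (volume : Measure (Space n)) := by
    refine (Lp.memLp (fourierHat w)).of_le_mul (c := C)
      (hm.aestronglyMeasurable.mul (Lp.aestronglyMeasurable _)) ?_
    filter_upwards [hw] with η hη
    by_cases h : η ∈ K
    · rw [norm_mul]; gcongr; exact hC η h
    · simp [hη h]
  refine ⟨𝓕⁻ hL.toLp, ?_⟩
  have h1 : FourierRep ((𝓕⁻ hL.toLp : L2C n) : 𝓢'(Space n, ℂ)) (fun η => m η * fourierHat w η) := by
    have := FourierRep.of_L2 (𝓕⁻ hL.toLp)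
    rw [FourierTransform.fourier_fourierInv_eq] at this
    exact this.congr hL.coeFn_toLp
  have h2 : FourierRep (TemperedDistribution.besselPotential (Space n) ℂ s (toDist w))
      (fun η => m η * fourierHat w η) :=
    (FourierRep.toDist w).temperate_mul (g := m) (by fun_prop)
      (TemperedDistribution.fourier_besselPotential_eq_smulLeftCLM_fourier_apply s _)
  exact h2.ext h1 EventuallyEq.rfl

/-- The `L²` transform is not an integral, so both sides are tested against a real function `g` and
the transform is moved onto the test function. There the integral formula shows that reflecting a
real `g` conjugates its transform, and `u` itself is real. -/
theorem fourierHat_neg_eq_conj (u : L2R n) :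
    ∀ᵐ η : Space n, fourierHat u (-η) = (starRingEnd ℂ) (fourierHat u η) := by
  have hmp := Measure.measurePreserving_neg (volume : Measure (Space n))
  have hloc : LocallyIntegrable (fourierHat u) := (FourierRep.toDist u).locallyIntegrable
  have hloc1 : LocallyIntegrable (fun η => fourierHat u (-η)) := by
    have := (Lp.memLp (fourierHat u)).comp_measurePreserving hmp
    exact this.locallyIntegrable (by norm_num)
  have hloc2 : LocallyIntegrable (fun η => (starRingEnd ℂ) (fourierHat u η)) := by
    have := (Lp.memLp (fourierHat u)).star
    exact this.locallyIntegrable (by norm_num)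
  refine ae_eq_of_integral_contDiff_smul_eq hloc1 hloc2 ?_
  intro g g_smooth g_cpt
  have g'_smooth : ContDiff ℝ ∞ (fun x => g (-x)) := by fun_prop
  have g'_cpt : HasCompactSupport (fun x => g (-x)) := by
    exact g_cpt.comp_homeomorph (Homeomorph.neg (Space n))
  have hg₁ : HasCompactSupport (Complex.ofRealCLM ∘ g) := g_cpt.comp_left rfl
  have hg₂ : ContDiff ℝ ∞ (Complex.ofRealCLM ∘ g) := by fun_prop
  have hg₁' : HasCompactSupport (Complex.ofRealCLM ∘ fun x => g (-x)) := g'_cpt.comp_left rfl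
  have hg₂' : ContDiff ℝ ∞ (Complex.ofRealCLM ∘ fun x => g (-x)) := by fun_prop
  set φ := hg₁.toSchwartzMap hg₂ with hφ
  set φ' := hg₁'.toSchwartzMap hg₂' with hφ'
  have hφe : ∀ x, φ x = (g x : ℂ) := fun x => by simp [hφ]
  have hφe' : ∀ x, φ' x = (g (-x) : ℂ) := fun x => by simp [hφ']
  have key : ∀ x, (𝓕 φ' : 𝓢(Space n, ℂ)) x = (starRingEnd ℂ) ((𝓕 φ : 𝓢(Space n, ℂ)) x) := by
    intro x
    rw [SchwartzMap.fourier_coe, SchwartzMap.fourier_coe, Real.fourier_eq', Real.fourier_eq',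
      ← integral_conj, ← integral_neg_eq_self]
    refine integral_congr_ae (Eventually.of_forall fun v => ?_)
    simp only [hφe, hφe', smul_eq_mul, map_mul, Complex.conj_ofReal, neg_neg, ← Complex.exp_conj]
    simp
  have e1 : ∫ η, g η • fourierHat u (-η) = ∫ x, φ' x * fourierHat u x := by
    rw [← integral_neg_eq_self]
    refine integral_congr_ae (Eventually.of_forall fun v => ?_)
    simp [hφe']
  have e2 : ∫ η, g η • (starRingEnd ℂ) (fourierHat u η) =
      (starRingEnd ℂ) (∫ x, φ x * fourierHat u x) := by
    rw [← integral_conj]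
    refine integral_congr_ae (Eventually.of_forall fun v => ?_)
    simp [hφe]
  rw [e1, e2, ← (FourierRep.toDist u φ).2, ← (FourierRep.toDist u φ').2,
    TemperedDistribution.fourier_apply, TemperedDistribution.fourier_apply, BlochControl.toDist,
    Lp.toTemperedDistribution_apply, Lp.toTemperedDistribution_apply, ← integral_conj]
  refine integral_congr_ae ?_
  filter_upwards [toComplex_coe u] with x hx
  simp [hx, key]

/-- Write the inverse transform as `a + ib` with `a`, `b` real. Conjugate symmetry of `â`, `b̂` and
of `h` forces `b̂ = 0`. -/
theorem exists_real_of_conj_symm (h : L2C n)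
    (hh : ∀ᵐ η : Space n, h (-η) = (starRingEnd ℂ) (h η)) :
    ∃ g : L2R n, fourierHat g = h := by
  set a : L2R n := Complex.reCLM.compLp (𝓕⁻ h : L2C n) with ha
  set b : L2R n := Complex.imCLM.compLp (𝓕⁻ h : L2C n) with hb
  have hab : (𝓕⁻ h : L2C n) = toComplex a + Complex.I • toComplex b := by
    apply Lp.ext
    filter_upwards [toComplex_coe a, toComplex_coe b, Lp.coeFn_add (toComplex a)
      (Complex.I • toComplex b), Lp.coeFn_smul Complex.I (toComplex b),
      ContinuousLinearMap.coeFn_compLp Complex.reCLM (𝓕⁻ h : L2C n),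
      ContinuousLinearMap.coeFn_compLp Complex.imCLM (𝓕⁻ h : L2C n)] with x h1 h2 h3 h4 h5 h6
    rw [h3, Pi.add_apply, h4, Pi.smul_apply, h1, h2, ha, hb, h5, h6]
    simp only [Complex.reCLM_apply, Complex.imCLM_apply, smul_eq_mul]
    rw [mul_comm, Complex.re_add_im]
  have hh' : h = fourierHat a + Complex.I • fourierHat b := by
    rw [fourierHat, fourierHat, ← FourierTransform.fourier_smul, ← FourierTransform.fourier_add,
      ← hab, FourierTransform.fourier_fourierInv_eq]
  have hae : h =ᵐ[volume] fun η => fourierHat a η + Complex.I * fourierHat b η := by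
    filter_upwards [Lp.coeFn_add (fourierHat a) (Complex.I • fourierHat b),
      Lp.coeFn_smul Complex.I (fourierHat b)] with x h1 h2
    rw [hh', h1, Pi.add_apply, h2, Pi.smul_apply, smul_eq_mul]
  have hmp := Measure.measurePreserving_neg (volume : Measure (Space n))
  have hb0 : fourierHat b =ᵐ[volume] (0 : Space n → ℂ) := by
    filter_upwards [hae, hmp.quasiMeasurePreserving.ae hae, hh, fourierHat_neg_eq_conj a,
      fourierHat_neg_eq_conj b] with η h1 h2 h3 h4 h5
    rw [h1, h2, h4, h5] at h3
    simp only [map_add, map_mul, Complex.conj_I] at h3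
    -- The terms in `â` cancel, and the remaining term equals its own negative.
    have h6 : Complex.I * (starRingEnd ℂ) (fourierHat b η) = 0 := by linear_combination h3 / 2
    simpa using h6
  refine ⟨a, Lp.ext ?_⟩
  filter_upwards [hae, hb0] with η h1 h2
  rw [h1, h2]; simp

/-- The source of all real functions constructed from `u` below: solutions of the two equations and
weak derivatives. Compactness of the spectrum keeps the product in `L²`, and the symmetry of `m`
keeps the result real. -/
theorem exists_multiplier {K : Set (Space n)} (hK : IsCompact K) {u : L2R n}
    (hu : FourierSuppIn K u) {m : Space n → ℂ} (hm : Continuous m)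
    (hconj : ∀ η, m (-η) = (starRingEnd ℂ) (m η)) :
    ∃ g : L2R n, ∀ᵐ η : Space n, fourierHat g η = m η * fourierHat u η := by
  obtain ⟨C, hC⟩ := hK.exists_bound_of_continuousOn hm.continuousOn
  have hL : MemLp (fun η => m η * fourierHat u η) 2 (volume : Measure (Space n)) := by
    refine (Lp.memLp (fourierHat u)).of_le_mul (c := C)
      (hm.aestronglyMeasurable.mul (Lp.aestronglyMeasurable _)) ?_
    filter_upwards [hu] with η hη
    by_cases h : η ∈ K
    · rw [norm_mul]; gcongr; exact hC η h
    · simp [hη h]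
  have hmp := Measure.measurePreserving_neg (volume : Measure (Space n))
  obtain ⟨g, hg⟩ := exists_real_of_conj_symm hL.toLp (by
    filter_upwards [hL.coeFn_toLp, hmp.quasiMeasurePreserving.ae hL.coeFn_toLp,
      fourierHat_neg_eq_conj u] with η h1 h2 h3
    rw [h1, h2, h3, map_mul, hconj])
  exact ⟨g, hg ▸ hL.coeFn_toLp⟩

theorem FourierSuppIn.of_mul {K : Set (Space n)} {u g : L2R n} (hu : FourierSuppIn K u)
    {m : Space n → ℂ} (h : ∀ᵐ η : Space n, fourierHat g η = m η * fourierHat u η) :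
    FourierSuppIn K g := by
  filter_upwards [hu, h] with η h1 h2 h3
  rw [h2, h1 h3, mul_zero]

end

end BlochControl

namespace BlochControl

noncomputable section

variable {n : ℕ}

/-! ### Contractions of tensors -/

theorem sum_fin_succ_fun {k : ℕ} (F : (Fin (k + 1) → Fin n) → ℝ) :
    ∑ i, F i = ∑ a, ∑ i : Fin k → Fin n, F (Matrix.vecCons a i) := by
  rw [← (Fin.consEquiv fun _ : Fin (k + 1) => Fin n).sum_comp, Fintype.sum_prod_type]
  rfl

theorem sum_fin_zero_fun (F : (Fin 0 → Fin n) → ℝ) : ∑ i, F i = F ![] := by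
  rw [Fintype.sum_unique]
  congr 1

theorem contract_two (T : Tensor n 2) (η : Space n) :
    contract T η = ∑ i, ∑ j, T ![i, j] * (η i * η j) := by
  simp only [contract, sum_fin_succ_fun, sum_fin_zero_fun, Fin.prod_univ_two]
  rfl

theorem contract_four (T : Tensor n 4) (η : Space n) :
    contract T η = ∑ i, ∑ j, ∑ k, ∑ l, T ![i, j, k, l] * (η i * η j * η k * η l) := by
  simp only [contract, sum_fin_succ_fun, sum_fin_zero_fun, Fin.prod_univ_four]
  rfl

theorem contract_six (T : Tensor n 6) (η : Space n) :
    contract T η = ∑ i, ∑ j, ∑ k, ∑ l, ∑ p, ∑ q, T ![i, j, k, l, p, q] *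
      (η i * η j * η k * η l * η p * η q) := by
  simp only [contract, sum_fin_succ_fun, sum_fin_zero_fun, Fin.prod_univ_six]
  rfl

/-- The index order of `comp22` puts one index of each factor in each half, as the quadratic form on
`D²v` requires. Contraction with `η^{⊗4}` does not see this order, so the symbol is just the
product. -/
theorem contract_comp22 (S T : Tensor n 2) (η : Space n) :
    contract (comp22 S T) η = contract S η * contract T η := by
  rw [contract_four, contract_two, contract_two]
  simp only [comp22, Matrix.cons_val]
  simp only [Finset.sum_mul]
  simp only [Finset.mul_sum]
  refine Finset.sum_congr rfl fun i _ => ?_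
  rw [Finset.sum_comm]
  refine Finset.sum_congr rfl fun j _ => Finset.sum_congr rfl fun k _ =>
    Finset.sum_congr rfl fun l _ => by ring

theorem contract_comp42 (S : Tensor n 4) (T : Tensor n 2) (η : Space n) :
    contract (comp42 S T) η = contract S η * contract T η := by
  rw [contract_six, contract_four, contract_two]
  simp only [comp42, Matrix.cons_val]
  simp only [Finset.sum_mul]
  simp only [Finset.mul_sum]
  refine Finset.sum_congr rfl fun i _ => Finset.sum_congr rfl fun j _ => ?_
  rw [Finset.sum_comm]
  refine Finset.sum_congr rfl fun k _ => ?_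
  rw [Finset.sum_comm]
  refine Finset.sum_congr rfl fun l _ => Finset.sum_congr rfl fun p _ =>
    Finset.sum_congr rfl fun q _ => by ring

theorem contract_append {k : ℕ} (T : Tensor n (k + k)) (η : Space n) :
    contract T η = ∑ i : Fin k → Fin n, ∑ j : Fin k → Fin n,
      T (Fin.append i j) * ((∏ a, η (i a)) * ∏ a, η (j a)) := by
  rw [contract, ← (Fin.appendEquiv k k).sum_comp, Fintype.sum_prod_type]
  refine Finset.sum_congr rfl fun i _ => Finset.sum_congr rfl fun j _ => ?_
  simp only [Fin.prod_univ_add, Fin.appendEquiv, Equiv.coe_fn_mk, Fin.append_left,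
    Fin.append_right]

theorem contract_smul_arg {k : ℕ} (T : Tensor n k) (t : ℝ) (η : Space n) :
    contract T (t • η) = t ^ k * contract T η := by
  simp only [contract, PiLp.smul_apply, smul_eq_mul, Finset.prod_mul_distrib, Finset.prod_const,
    Finset.card_univ, Fintype.card_fin, Finset.mul_sum]
  exact Finset.sum_congr rfl fun i _ => by ring

theorem contract_neg_arg_of_even {k : ℕ} (hk : Even k) (T : Tensor n k) (η : Space n) :
    contract T (-η) = contract T η := by
  rw [← neg_one_smul ℝ η, contract_smul_arg, hk.neg_one_pow, one_mul]

theorem continuous_contract {k : ℕ} (T : Tensor n k) : Continuous (contract T) := by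
  unfold contract
  fun_prop

/-- Positivity is applied to the symmetric rank-one matrix with entries `η i * η j`. -/
theorem IsPosSemidef4.contract_nonneg {T : Tensor n 4} (hT : IsPosSemidef4 T) (η : Space n) :
    0 ≤ contract T η := by
  have := hT.2 (Matrix.of fun i j => η i * η j) (by ext i j; simp [mul_comm])
  rw [contract_four]
  simpa [mul_assoc] using this

/-! ### Positivity of the homogenized tensor -/

/-- Testing the eigenvalue equation with `φ` itself gives energy `= μ ‖φ‖²`. The energy has
nonnegative real part by ellipticity, and `‖φ‖² > 0`. -/
theorem IsBlochEigenpair.nonneg {A : Space n → Matrix (Fin n) (Fin n) ℝ}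
    (hA : IsPeriodicCoefficient A) {η : Space n} {μ : ℝ} {φ : Space n → ℂ}
    (h : IsBlochEigenpair A η μ φ) : 0 ≤ μ := by
  obtain ⟨G, hG, hne, htest⟩ := h
  have key := htest φ G hG
  obtain ⟨α, hα, hell⟩ := hA.elliptic
  set F : Space n → ℂ := fun x => ∑ i, ∑ j, ((A x i j : ℝ) : ℂ) * shiftedPartial η j φ (G j) x *
          (starRingEnd ℂ) (shiftedPartial η i φ (G i) x) with hF
  have hre : 0 ≤ (∫ x in unitCell n, F x).re := by
    by_cases hint : Integrable F (volume.restrict (unitCell n))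
    · have e := Complex.reCLM.integral_comp_comm hint
      simp only [Complex.reCLM_apply] at e
      rw [← e]
      refine integral_nonneg_of_ae ?_
      filter_upwards [ae_restrict_of_ae hell] with x hx
      have h1 := hx fun i => (shiftedPartial η i φ (G i) x).re
      have h2 := hx fun i => (shiftedPartial η i φ (G i) x).im
      -- Ellipticity is stated for real vectors; the real part of the Hermitian form is the sum of
      -- the forms of the real and imaginary parts.
      have h3 : (F x).re =
          ∑ i, ∑ j, A x i j * (shiftedPartial η i φ (G i) x).re *
            (shiftedPartial η j φ (G j) x).re +
          ∑ i, ∑ j, A x i j * (shiftedPartial η i φ (G i) x).im *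
            (shiftedPartial η j φ (G j) x).im := by
        simp only [hF, Complex.re_sum, ← Finset.sum_add_distrib]
        refine Finset.sum_congr rfl fun i _ => Finset.sum_congr rfl fun j _ => ?_
        simp
        ring
      rw [Pi.zero_apply, h3]
      have h4 : 0 ≤ α * ∑ i, (shiftedPartial η i φ (G i) x).re ^ 2 := by positivity
      have h5 : 0 ≤ α * ∑ i, (shiftedPartial η i φ (G i) x).im ^ 2 := by positivity
      linarith
    -- Without integrability the Bochner integral is zero by convention, which is enough here.
    · rw [integral_undef hint]; simp
  have hφ : ∫ x in unitCell n, φ x * (starRingEnd ℂ) (φ x) =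
      ((∫ x in unitCell n, ‖φ x‖ ^ 2 : ℝ) : ℂ) := by
    rw [← integral_complex_ofReal]
    refine integral_congr_ae (Eventually.of_forall fun x => ?_)
    simp [Complex.mul_conj, Complex.normSq_eq_norm_sq]
  rw [key, hφ, ← Complex.ofReal_mul, Complex.ofReal_re] at hre
  have hpos : 0 < ∫ x in unitCell n, ‖φ x‖ ^ 2 := by
    refine lt_of_le_of_ne (integral_nonneg fun x => by positivity) fun h0 => hne ?_
    have hi : Integrable (fun x => ‖φ x‖ ^ 2) (volume.restrict (unitCell n)) :=
      hG.memLp.integrable_norm_pow (by norm_num)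
    have := (integral_eq_zero_iff_of_nonneg (fun x => by positivity) hi).1 h0.symm
    filter_upwards [this] with x hx
    simpa using hx
  exact nonneg_of_mul_nonneg_left hre hpos

theorem firstBlochEigenvalue_nonneg {A : Space n → Matrix (Fin n) (Fin n) ℝ}
    (hA : IsPeriodicCoefficient A) (η : Space n) : 0 ≤ firstBlochEigenvalue A η :=
  Real.sInf_nonneg fun _ ⟨_, h⟩ => h.nonneg hA

/-- Insert `tξ` into the expansion of `λ₀ ≥ 0`, divide by `t²` and let `t` decrease to zero: only
the quadratic term survives. -/
theorem IsTaylorTensors.contract_nonneg {A : Space n → Matrix (Fin n) (Fin n) ℝ}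
    (hA : IsPeriodicCoefficient A) {A2 : Tensor n 2} {A4 : Tensor n 4}
    (h : IsTaylorTensors A A2 A4) (ξ : Space n) : 0 ≤ contract A2 ξ := by
  obtain ⟨C, hC⟩ := h.2.bound
  have hlim : Tendsto (fun t : ℝ => t • ξ) (𝓝[>] 0) (𝓝 0) := by
    have : Tendsto (fun t : ℝ => t • ξ) (𝓝 0) (𝓝 ((0 : ℝ) • ξ)) :=
      (continuous_id.smul continuous_const).tendsto 0
    rw [zero_smul] at this
    exact this.mono_left nhdsWithin_le_nhds
  have hev : ∀ᶠ t : ℝ in 𝓝[>] 0, 0 ≤ (2 * Real.pi) ^ 2 * contract A2 ξ +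
      t ^ 2 * ((2 * Real.pi) ^ 4 * contract A4 ξ) + C * t ^ 4 * ‖ξ‖ ^ 6 := by
    filter_upwards [hlim.eventually hC, self_mem_nhdsWithin] with t ht htpos
    have htpos : 0 < t := htpos
    have h0 := firstBlochEigenvalue_nonneg hA (t • ξ)
    rw [contract_smul_arg, contract_smul_arg, Real.norm_eq_abs, norm_pow, norm_norm, norm_smul,
      Real.norm_eq_abs, abs_of_pos htpos] at ht
    have h1 := (abs_le.1 ht).2
    have h2 : 0 ≤ t ^ 2 * ((2 * Real.pi) ^ 2 * contract A2 ξ +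
      t ^ 2 * ((2 * Real.pi) ^ 4 * contract A4 ξ) + C * t ^ 4 * ‖ξ‖ ^ 6) := by
      nlinarith
    exact nonneg_of_mul_nonneg_right h2 (by positivity)
  have hT : Tendsto (fun t : ℝ => (2 * Real.pi) ^ 2 * contract A2 ξ +
      t ^ 2 * ((2 * Real.pi) ^ 4 * contract A4 ξ) + C * t ^ 4 * ‖ξ‖ ^ 6) (𝓝[>] 0)
      (𝓝 ((2 * Real.pi) ^ 2 * contract A2 ξ)) := by
    have : Continuous (fun t : ℝ => (2 * Real.pi) ^ 2 * contract A2 ξ +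
      t ^ 2 * ((2 * Real.pi) ^ 4 * contract A4 ξ) + C * t ^ 4 * ‖ξ‖ ^ 6) := by fun_prop
    have h := (this.tendsto 0).mono_left (nhdsWithin_le_nhds (s := Set.Ioi 0))
    simpa using h
  have := ge_of_tendsto hT hev
  exact nonneg_of_mul_nonneg_right this (by positivity)

/-! ### Symbols -/

theorem symbolQ_nonneg {ε : ℝ} {B2 : Tensor n 2} (hB2 : ∀ ξ, 0 ≤ contract B2 ξ) (η : Space n) :
    0 ≤ symbolQ ε B2 η := by
  have := hB2 η
  unfold symbolQ
  positivity

theorem symbolQ_le_symbolR {ε : ℝ} {A2 B2 : Tensor n 2} {B4 : Tensor n 4}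
    (hA2 : ∀ ξ, 0 ≤ contract A2 ξ) (hB4 : ∀ ξ, 0 ≤ contract B4 ξ) (η : Space n) :
    symbolQ ε B2 η ≤ symbolR ε A2 B2 B4 η := by
  have h1 : 0 ≤ (2 * Real.pi) ^ 2 * contract A2 η := mul_nonneg (by positivity) (hA2 η)
  have h2 : 0 ≤ ε ^ 2 * (2 * Real.pi) ^ 4 * contract B4 η := mul_nonneg (by positivity) (hB4 η)
  rw [symbolQ, symbolR, contract_add, contract_smul]
  linarith

theorem continuous_symbolQ (ε : ℝ) (B2 : Tensor n 2) : Continuous (symbolQ ε B2) := by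
  have := continuous_contract B2
  unfold symbolQ
  fun_prop

theorem continuous_symbolR (ε : ℝ) (A2 B2 : Tensor n 2) (B4 : Tensor n 4) :
    Continuous (symbolR ε A2 B2 B4) := by
  have := continuous_contract (A2 + ε ^ 2 • B2)
  have := continuous_contract B4
  unfold symbolR
  fun_prop

theorem symbolQ_neg (ε : ℝ) (B2 : Tensor n 2) (η : Space n) :
    symbolQ ε B2 (-η) = symbolQ ε B2 η := by
  rw [symbolQ, symbolQ, contract_neg_arg_of_even (by decide)]

theorem symbolR_neg (ε : ℝ) (A2 B2 : Tensor n 2) (B4 : Tensor n 4) (η : Space n) :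
    symbolR ε A2 B2 B4 (-η) = symbolR ε A2 B2 B4 η := by
  rw [symbolR, symbolR, contract_neg_arg_of_even (by decide), contract_neg_arg_of_even (by decide)]

/-- The reason for the tensors in `I₂*`: expanding `1 + Q + R + QR` by order in `η`, the quadratic
terms give `A2 + 2ε²B2`, the quartic ones `B4 + A2 B2 + ε² B2 B2`, and the sextic one `B4 B2`. -/
theorem symbol_product (ε : ℝ) (A2 B2 : Tensor n 2) (B4 : Tensor n 4) (η : Space n) :
    (2 * Real.pi) ^ 2 * contract (A2 + (2 * ε ^ 2) • B2) η +
      ε ^ 2 * ((2 * Real.pi) ^ 4 * contract (B4 + comp22 A2 B2 + ε ^ 2 • comp22 B2 B2) η) +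
      ε ^ 4 * ((2 * Real.pi) ^ 6 * contract (comp42 B4 B2) η) + 1 =
    (1 + symbolQ ε B2 η) * (1 + symbolR ε A2 B2 B4 η) := by
  simp only [symbolQ, symbolR, contract_add, contract_smul, contract_comp22, contract_comp42]
  ring

/-! ### Weak derivatives and quadratic forms -/

/-- On a compact spectrum the symbol of a derivative is bounded, and it is conjugate symmetric since
it is a product of purely imaginary odd factors. So the derivative exists in the real `L²`, and the
default value in `weakD` does not occur. -/
theorem fourierHat_weakD {K : Set (Space n)} (hK : IsCompact K) {w : L2R n}
    (hw : FourierSuppIn K w) {k : ℕ} (i : Fin k → Fin n) :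
    ∀ᵐ η : Space n, fourierHat (weakD i w) η =
      (∏ j, 2 * (Real.pi : ℂ) * Complex.I * ((η (i j) : ℝ) : ℂ)) * fourierHat w η := by
  have hex : ∃ g : L2R n, toDist g = partialD i (toDist w) := by
    obtain ⟨g, hg⟩ := exists_multiplier hK hw
      (m := fun η => ∏ j, 2 * (Real.pi : ℂ) * Complex.I * ((η (i j) : ℝ) : ℂ))
      (by fun_prop) (fun η => by
        simp only [map_prod, map_mul, Complex.conj_I, Complex.conj_ofReal, map_ofNat,
          PiLp.neg_apply, Complex.ofReal_neg]
        exact Finset.prod_congr rfl fun j _ => by ring)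
    exact ⟨g, (FourierRep.toDist g).ext ((FourierRep.toDist w).partialD i) hg⟩
  have hspec : toDist (weakD i w) = partialD i (toDist w) := by
    rw [weakD, dif_pos hex]
    exact hex.choose_spec
  exact ((FourierRep.toDist _).eq_iff ((FourierRep.toDist w).partialD i)).1 hspec

theorem integrable_mul_L2R (a b : L2R n) : Integrable fun x => a x * b x :=
  (Lp.memLp a).integrable_mul (Lp.memLp b)

theorem integrable_conj_mul_fourierHat (a b : L2R n) :
    Integrable fun η => (starRingEnd ℂ) (fourierHat a η) * fourierHat b η :=
  (Lp.memLp (fourierHat a)).star.integrable_mul (Lp.memLp (fourierHat b))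

theorem integral_mul_eq_fourierHat (a b : L2R n) :
    ((∫ x, a x * b x : ℝ) : ℂ) = ∫ η, (starRingEnd ℂ) (fourierHat a η) * fourierHat b η := by
  have h := Lp.inner_fourier_eq (toComplex a) (toComplex b)
  rw [L2.inner_def, L2.inner_def] at h
  simp only [RCLike.inner_apply'] at h
  rw [fourierHat, fourierHat, h, ← integral_complex_ofReal]
  refine integral_congr_ae ?_
  filter_upwards [toComplex_coe a, toComplex_coe b] with x h1 h2
  simp [h1, h2]

theorem integral_sq_eq_fourierHat (a : L2R n) :
    ∫ x, |a x| ^ 2 = ∫ η, ‖fourierHat a η‖ ^ 2 := by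
  have h := integral_mul_eq_fourierHat a a
  have e : ∀ η, (starRingEnd ℂ) (fourierHat a η) * fourierHat a η =
      ((‖fourierHat a η‖ ^ 2 : ℝ) : ℂ) := fun η => by
    rw [mul_comm, Complex.mul_conj, Complex.normSq_eq_norm_sq]
  simp only [e] at h
  rw [integral_complex_ofReal] at h
  have h' := Complex.ofReal_injective h
  simp only [sq_abs]
  simpa only [pow_two] using h'

/-- One of the two factors is conjugated, so each pair contributes `|2πi|² = (2π)²`. Hence the
quadratic forms of all orders have a positive sign, unlike the symbols of the operators. -/
theorem conj_prod_mul_prod {k : ℕ} (i j : Fin k → Fin n) (η : Space n) :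
    (starRingEnd ℂ) (∏ a, 2 * (Real.pi : ℂ) * Complex.I * ((η (i a) : ℝ) : ℂ)) *
      (∏ a, 2 * (Real.pi : ℂ) * Complex.I * ((η (j a) : ℝ) : ℂ)) =
    (((2 * Real.pi) ^ (2 * k) * ((∏ a, η (i a)) * ∏ a, η (j a)) : ℝ) : ℂ) := by
  have h : (starRingEnd ℂ (2 * (Real.pi : ℂ) * Complex.I)) * (2 * (Real.pi : ℂ) * Complex.I) =
      (2 * (Real.pi : ℂ)) ^ 2 := by
    simp only [map_mul, Complex.conj_I, Complex.conj_ofReal, map_ofNat]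
    linear_combination (-4 * (Real.pi : ℂ) ^ 2) * Complex.I_sq
  simp only [Finset.prod_mul_distrib (f := fun _ => 2 * (Real.pi : ℂ) * Complex.I),
    Finset.prod_const, Finset.card_univ, Fintype.card_fin, map_mul, map_pow, map_prod,
    Complex.conj_ofReal] at h ⊢
  push_cast
  rw [pow_mul, ← h]
  ring

/-- Plancherel for each pair of weak derivatives, followed by summation. Each product is integrable,
being a product of two `L²` functions. -/
theorem integral_tensorForm {K : Set (Space n)} (hK : IsCompact K) {w : L2R n}
    (hw : FourierSuppIn K w) (k : ℕ) (T : Tensor n (k + k)) :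
    Integrable (tensorForm k T w) ∧
    Integrable (fun η => (2 * Real.pi) ^ (2 * k) * contract T η * ‖fourierHat w η‖ ^ 2) ∧
    ∫ x, tensorForm k T w x =
      ∫ η, (2 * Real.pi) ^ (2 * k) * contract T η * ‖fourierHat w η‖ ^ 2 := by
  have hi : ∀ i j : Fin k → Fin n,
      Integrable fun x => T (Fin.append i j) * weakD i w x * weakD j w x := fun i j => by
    simpa only [mul_assoc] using (integrable_mul_L2R (weakD i w) (weakD j w)).const_mul _
  have hI : Integrable (tensorForm k T w) :=
    integrable_finsetSum _ fun i _ => integrable_finsetSum _ fun j _ => hi i j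
  have hF : ∀ i j : Fin k → Fin n, Integrable fun η => (T (Fin.append i j) : ℂ) *
      ((starRingEnd ℂ) (fourierHat (weakD i w) η) * fourierHat (weakD j w) η) := fun i j =>
    (integrable_conj_mul_fourierHat _ _).const_mul _
  have hae : (fun η => ∑ i : Fin k → Fin n, ∑ j : Fin k → Fin n, (T (Fin.append i j) : ℂ) *
      ((starRingEnd ℂ) (fourierHat (weakD i w) η) * fourierHat (weakD j w) η)) =ᵐ[volume]
      fun η => (((2 * Real.pi) ^ (2 * k) * contract T η * ‖fourierHat w η‖ ^ 2 : ℝ) : ℂ) := by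
    have : ∀ᵐ η : Space n, ∀ i : Fin k → Fin n, fourierHat (weakD i w) η =
      (∏ j, 2 * (Real.pi : ℂ) * Complex.I * ((η (i j) : ℝ) : ℂ)) * fourierHat w η :=
      ae_all_iff.2 fun i => fourierHat_weakD hK hw i
    filter_upwards [this] with η hη
    rw [contract_append]
    simp only [hη, Finset.mul_sum, Finset.sum_mul, Complex.ofReal_sum]
    refine Finset.sum_congr rfl fun i _ => Finset.sum_congr rfl fun j _ => ?_
    have h1 := conj_prod_mul_prod i j η
    have h2 : (starRingEnd ℂ) (fourierHat w η) * fourierHat w η =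
        ((‖fourierHat w η‖ ^ 2 : ℝ) : ℂ) := by
      rw [mul_comm, Complex.mul_conj, Complex.normSq_eq_norm_sq]
    rw [map_mul]
    set P := (starRingEnd ℂ) (∏ a, 2 * (Real.pi : ℂ) * Complex.I * ((η (i a) : ℝ) : ℂ))
    set P' := (∏ a, 2 * (Real.pi : ℂ) * Complex.I * ((η (j a) : ℝ) : ℂ))
    push_cast at h1 h2 ⊢
    linear_combination (T (Fin.append i j) : ℂ) * (starRingEnd ℂ) (fourierHat w η) *
      fourierHat w η * h1 + (T (Fin.append i j) : ℂ) * (2 * (Real.pi : ℂ)) ^ (2 * k) *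
      ((∏ a, (η (i a) : ℂ)) * ∏ a, (η (j a) : ℂ)) * h2
  have hFI := (integrable_finsetSum Finset.univ fun i (_ : i ∈ Finset.univ) =>
    integrable_finsetSum Finset.univ fun j (_ : j ∈ Finset.univ) => hF i j).congr hae
  have hFI' : Integrable
      (fun η => (2 * Real.pi) ^ (2 * k) * contract T η * ‖fourierHat w η‖ ^ 2) := by
    simpa only [RCLike.ofReal_re] using! hFI.re
  refine ⟨hI, hFI', Complex.ofReal_injective ?_⟩
  rw [← integral_complex_ofReal (f := fun η =>
    (2 * Real.pi) ^ (2 * k) * contract T η * ‖fourierHat w η‖ ^ 2)]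
  refine Eq.trans ?_ (integral_congr_ae hae)
  rw [integral_finsetSum _ fun i _ => integrable_finsetSum _ fun j _ => hF i j]
  simp only [tensorForm]
  rw [integral_finsetSum _ fun i _ => integrable_finsetSum _ fun j _ => hi i j, Complex.ofReal_sum]
  refine Finset.sum_congr rfl fun i _ => ?_
  rw [integral_finsetSum _ fun j _ => hF i j, integral_finsetSum _ fun j _ => hi i j,
    Complex.ofReal_sum]
  refine Finset.sum_congr rfl fun j _ => ?_
  rw [integral_const_mul, ← integral_mul_eq_fourierHat, ← Complex.ofReal_mul, ← integral_const_mul]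
  simp only [mul_assoc]

theorem fourierHat_sub (u v : L2R n) :
    fourierHat (u - v) =ᵐ[volume] fun η => fourierHat u η - fourierHat v η := by
  have h := fourierHat_add (u - v) v
  rw [sub_add_cancel] at h
  filter_upwards [h] with η hη
  rw [hη]; ring

theorem FourierSuppIn.sub {K : Set (Space n)} {u v : L2R n} (hu : FourierSuppIn K u)
    (hv : FourierSuppIn K v) : FourierSuppIn K (u - v) := by
  filter_upwards [hu, hv, fourierHat_sub u v] with η h1 h2 h3 h4
  rw [h3, h1 h4, h2 h4, sub_zero]

theorem integrable_fun_add {a b : Space n → ℝ} (ha : Integrable a) (hb : Integrable b) :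
    Integrable fun x => a x + b x := ha.add hb

theorem integral_state_form {K : Set (Space n)} (hK : IsCompact K) {v : L2R n}
    (hv : FourierSuppIn K v) (ε : ℝ) (A2 B2 : Tensor n 2) (B4 : Tensor n 4) :
    ∫ x, (tensorForm 1 (A2 + (2 * ε ^ 2) • B2) v x
        + ε ^ 2 * tensorForm 2 (B4 + comp22 A2 B2 + ε ^ 2 • comp22 B2 B2) v x
        + ε ^ 4 * tensorForm 3 (comp42 B4 B2) v x + |v x| ^ 2) =
      ∫ η, (1 + symbolQ ε B2 η) * (1 + symbolR ε A2 B2 B4 η) * ‖fourierHat v η‖ ^ 2 := by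
  obtain ⟨a1, b1, c1⟩ := integral_tensorForm hK hv 1 (A2 + (2 * ε ^ 2) • B2)
  obtain ⟨a2, b2, c2⟩ := integral_tensorForm hK hv 2 (B4 + comp22 A2 B2 + ε ^ 2 • comp22 B2 B2)
  obtain ⟨a3, b3, c3⟩ := integral_tensorForm hK hv 3 (comp42 B4 B2)
  have a4 : Integrable fun x => |v x| ^ 2 := (Lp.memLp v).integrable_norm_pow (by norm_num)
  have b4 : Integrable fun η => ‖fourierHat v η‖ ^ 2 :=
    (Lp.memLp (fourierHat v)).integrable_norm_pow (by norm_num)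
  have a2' := a2.const_mul (ε ^ 2)
  have a3' := a3.const_mul (ε ^ 4)
  have b2' := b2.const_mul (ε ^ 2)
  have b3' := b3.const_mul (ε ^ 4)
  have a12 := (integrable_fun_add a1 a2')
  have b12 := (integrable_fun_add b1 b2')
  have a123 := (integrable_fun_add a12 a3')
  have b123 := (integrable_fun_add b12 b3')
  rw [integral_add a123 a4, integral_add a12 a3', integral_add a1 a2',
    integral_const_mul, integral_const_mul, c1, c2, c3, integral_sq_eq_fourierHat,
    ← integral_const_mul, ← integral_const_mul, ← integral_add b1 b2',
    ← integral_add b12 b3', ← integral_add b123 b4]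
  refine integral_congr_ae (Eventually.of_forall fun η => ?_)
  simp only
  rw [← symbol_product]
  norm_num
  ring

/-! ### Equality of the two costs. -/

theorem fourierOn_coe (K : Set (Space n)) (u : L2R n) :
    fourierOn K u =ᵐ[volume.restrict K] fourierHat u :=
  LpToLpRestrictCLM_coeFn ℂ K _

theorem integral_norm_sq_sub {K : Set (Space n)} {a b : L2R n}
    (ha : FourierSuppIn K a) (hb : FourierSuppIn K b) :
    ∫ x, |a x - b x| ^ 2 = ∫ η in K, ‖fourierHat a η - fourierHat b η‖ ^ 2 := by
  rw [setIntegral_eq_integral_of_ae_compl_eq_zero]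
  · have e : ∫ η, ‖fourierHat a η - fourierHat b η‖ ^ 2 = ∫ η, ‖fourierHat (a - b) η‖ ^ 2 := by
      refine integral_congr_ae ?_
      filter_upwards [fourierHat_sub a b] with η hη
      rw [hη]
    rw [e, ← integral_sq_eq_fourierHat]
    refine integral_congr_ae ?_
    filter_upwards [Lp.coeFn_sub a b] with x hx
    rw [hx]; rfl
  · filter_upwards [ha, hb] with η h1 h2 h3
    simp [h1 h3, h2 h3]

/-- The two cost functionals agree on controls, states and auxiliary functions whose Fourier
transforms are supported in `K`. -/
theorem controlCost_eq_fourierCost {K : Set (Space n)} (hK : IsCompact K)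
    {A2 B2 : Tensor n 2} {B4 : Tensor n 4} (hA2 : ∀ ξ, 0 ≤ contract A2 ξ)
    (hB2 : ∀ ξ, 0 ≤ contract B2 ξ) (hB4 : ∀ ξ, 0 ≤ contract B4 ξ) (ε μ₁ μ₂ κ : ℝ)
    {f yd1 yd2 wd1 u y w : L2R n} (hyd2 : FourierSuppIn K yd2) (hwd1 : FourierSuppIn K wd1)
    (hu : FourierSuppIn K u) (hy : FourierSuppIn K y) (hw : FourierSuppIn K w)
    (hstate : StateEquation ε A2 B2 B4 f u y) (haux : AuxEquation ε B2 y w)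
    (haux1 : AuxEquation ε B2 yd1 wd1) :
    controlCost ε μ₁ μ₂ κ A2 B2 B4 wd1 yd2 u y w =
      fourierCost ε μ₁ μ₂ κ A2 B2 B4 K f yd1 yd2 (fourierOn K u) := by
  rw [stateEquation_iff] at hstate
  rw [auxEquation_iff] at haux haux1
  have hQ : ∀ η, 0 < 1 + symbolQ ε B2 η := fun η => by
    have := symbolQ_nonneg (ε := ε) hB2 η; linarith
  have hR : ∀ η, 0 < 1 + symbolR ε A2 B2 B4 η := fun η => by
    have := hQ η
    have := symbolQ_le_symbolR (ε := ε) (B2 := B2) hA2 hB4 η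
    linarith
  have hrat : ∀ᵐ η ∂(volume.restrict K), fourierHat y η =
      (symbolRatio ε A2 B2 B4 η : ℂ) * (fourierHat f η + fourierOn K u η) := by
    filter_upwards [fourierOn_coe K u, ae_restrict_of_ae hstate] with η h1 h2
    have h3 : ((1 + symbolR ε A2 B2 B4 η : ℝ) : ℂ) ≠ 0 := by exact_mod_cast (hR η).ne'
    rw [h1, symbolRatio, Complex.ofReal_div]
    field_simp
    linear_combination h2
  have hv := hw.sub hwd1
  unfold controlCost fourierCost
  congr 1
  · congr 1
    · congr 1
      have e1 : ∫ x, (tensorForm 1 (A2 + (2 * ε ^ 2) • B2) (w - wd1) x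
        + ε ^ 2 * tensorForm 2 (B4 + comp22 A2 B2 + ε ^ 2 • comp22 B2 B2) (w - wd1) x
        + ε ^ 4 * tensorForm 3 (comp42 B4 B2) (w - wd1) x + |w x - wd1 x| ^ 2) =
          ∫ x, (tensorForm 1 (A2 + (2 * ε ^ 2) • B2) (w - wd1) x
        + ε ^ 2 * tensorForm 2 (B4 + comp22 A2 B2 + ε ^ 2 • comp22 B2 B2) (w - wd1) x
        + ε ^ 4 * tensorForm 3 (comp42 B4 B2) (w - wd1) x + |(w - wd1) x| ^ 2) := by
        refine integral_congr_ae ?_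
        filter_upwards [Lp.coeFn_sub w wd1] with x hx
        rw [hx]; rfl
      rw [e1, integral_state_form hK hv, ← setIntegral_eq_integral_of_ae_compl_eq_zero (s := K)]
      · refine integral_congr_ae ?_
        filter_upwards [hrat, ae_restrict_of_ae haux, ae_restrict_of_ae haux1,
          ae_restrict_of_ae (fourierHat_sub w wd1)] with η h1 h2 h3 h4
        -- The misfit in `Î₂*` is `(1+Q) v̂`; its square times the weight `(1+R)/(1+Q)` is
        -- `(1+Q)(1+R)|v̂|²`, the integrand just obtained from the quadratic form.
        have h5 : ((1 + symbolQ ε B2 η : ℝ) : ℂ) * fourierHat (w - wd1) η =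
            (symbolRatio ε A2 B2 B4 η : ℂ) * (fourierHat f η + fourierOn K u η) -
              fourierHat yd1 η := by
          rw [h4, mul_sub, h2, h3, h1]
        rw [← h5, norm_mul, Complex.norm_real, Real.norm_eq_abs, abs_of_pos (hQ η)]
        have := (hQ η).ne'
        field_simp
      · filter_upwards [hv] with η h1 h2
        simp [h1 h2]
    · congr 1
      rw [integral_norm_sq_sub hy hyd2]
      refine integral_congr_ae ?_
      filter_upwards [hrat] with η h1
      rw [h1]
  · congr 1
    rw [integral_sq_eq_fourierHat, ← setIntegral_eq_integral_of_ae_compl_eq_zero (s := K)]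
    · refine integral_congr_ae ?_
      filter_upwards [fourierOn_coe K u] with η h1
      rw [h1]
    · filter_upwards [hu] with η h1 h2
      simp [h1 h2]

end

end BlochControl

/-! ### Fourier synthesis from `K` and the bijection between the two sets of controls. -/

namespace BlochControl

noncomputable section

variable {n : ℕ}

theorem fourierInv_eq_planeWave (G : Space n → ℂ) (x : Space n) :
    𝓕⁻ G x = ∫ η, G η * planeWave x η := by
  rw [Real.fourierInv_eq']
  refine integral_congr_ae (Eventually.of_forall fun η => ?_)
  simp only [planeWave, smul_eq_mul]
  rw [mul_comm]
  congr 2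
  push_cast
  ring

theorem continuous_fourierInv {G : Space n → ℂ} (hG : Integrable G) : Continuous (𝓕⁻ G) :=
  VectorFourier.fourierIntegral_continuous Real.continuous_fourierChar
    (continuous_inner (𝕜 := ℝ) (E := Space n)).neg hG

theorem integral_fourierInv_mul {G φ : Space n → ℂ} (hφ : Integrable φ) (hG : Integrable G) :
    ∫ x, 𝓕⁻ φ x * G x = ∫ x, φ x * 𝓕⁻ G x := by
  have h := VectorFourier.integral_fourierIntegral_smul_eq_flip (μ := volume) (ν := volume)
    (L := -innerₗ (Space n)) Real.continuous_fourierChar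
    (continuous_inner (𝕜 := ℝ) (E := Space n)).neg hφ hG
  have e : (-innerₗ (Space n)).flip = -innerₗ (Space n) := by
    ext x y
    simp [real_inner_comm]
  rw [e] at h
  exact h

/-- On `L¹ ∩ L²` the inverse Fourier transform of `L²` is given by the Fourier integral. -/
theorem fourierInv_toLp_ae_eq {G : Space n → ℂ} (hG1 : Integrable G)
    (hG2 : MemLp G 2 (volume : Measure (Space n))) :
    (𝓕⁻ (hG2.toLp G) : L2C n) =ᵐ[volume] 𝓕⁻ G := by
  refine ae_eq_of_integral_contDiff_smul_eq ((Lp.memLp _).locallyIntegrable (by norm_num))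
    (continuous_fourierInv hG1).locallyIntegrable ?_
  intro g g_smooth g_cpt
  have hg₁ : HasCompactSupport (Complex.ofRealCLM ∘ g) := g_cpt.comp_left rfl
  have hg₂ : ContDiff ℝ ∞ (Complex.ofRealCLM ∘ g) := by fun_prop
  set φ := hg₁.toSchwartzMap hg₂ with hφ
  have hφe : ∀ x, φ x = (g x : ℂ) := fun x => by simp [hφ]
  -- The distributional inverse transform falls on the Schwartz function; `integral_fourierInv_mul`
  -- then moves it back onto `G`, where it is the Fourier integral.
  have h1 := congrArg (fun d : 𝓢'(Space n, ℂ) => d φ)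
    (Lp.fourierInv_toTemperedDistribution_eq (hG2.toLp G))
  simp only [TemperedDistribution.fourierInv_apply, Lp.toTemperedDistribution_apply,
    smul_eq_mul, hφe] at h1
  simp only [Complex.real_smul]
  rw [← h1]
  have h2 : ∫ x, (𝓕⁻ φ : 𝓢(Space n, ℂ)) x * (hG2.toLp G) x = ∫ x, 𝓕⁻ (φ : Space n → ℂ) x * G x := by
    refine integral_congr_ae ?_
    filter_upwards [hG2.coeFn_toLp] with x hx
    rw [hx, SchwartzMap.fourierInv_coe]
  rw [h2, integral_fourierInv_mul φ.integrable hG1]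
  simp only [hφe]

variable {K : Set (Space n)}

theorem memLp_indicator (hK : IsCompact K) (uhat : L2On K) :
    MemLp (K.indicator uhat) 2 (volume : Measure (Space n)) :=
  (memLp_indicator_iff_restrict hK.measurableSet).2 (Lp.memLp uhat)

/-- `K` has finite measure, so `L²(K) ⊆ L¹(K)` and the synthesis integral is a classical Fourier
integral. -/
theorem integrable_indicator (hK : IsCompact K) (uhat : L2On K) :
    Integrable (K.indicator uhat) (volume : Measure (Space n)) := by
  have : IsFiniteMeasure ((volume : Measure (Space n)).restrict K) :=
    ⟨by simpa using hK.measure_lt_top⟩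
  exact (integrable_indicator_iff hK.measurableSet).2 ((Lp.memLp uhat).integrable (by norm_num))

theorem fourierSynthesis_eq_fourierInv (hK : IsCompact K) (uhat : L2On K) (x : Space n) :
    fourierSynthesis K uhat x = 𝓕⁻ (K.indicator uhat) x := by
  rw [fourierInv_eq_planeWave, fourierSynthesis, ← integral_indicator hK.measurableSet]
  refine integral_congr_ae (Eventually.of_forall fun η => ?_)
  simp only [Set.indicator_mul_left]

/-- Fourier inversion: the synthesis is the `L²` inverse transform of `û` extended by zero. This
replaces both descriptions of controls by conditions on `fourierHat u`. -/
theorem ae_eq_fourierSynthesis_iff (hK : IsCompact K) (u : L2R n) (uhat : L2On K) :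
    (∀ᵐ x : Space n, ((u x : ℝ) : ℂ) = fourierSynthesis K uhat x) ↔
      fourierHat u =ᵐ[volume] K.indicator uhat := by
  have h2 := memLp_indicator hK uhat
  have hS : (𝓕⁻ (h2.toLp _) : L2C n) =ᵐ[volume] fourierSynthesis K uhat := by
    filter_upwards [fourierInv_toLp_ae_eq (integrable_indicator hK uhat) h2] with x hx
    rw [hx, fourierSynthesis_eq_fourierInv hK]
  have h3 : (∀ᵐ x : Space n, ((u x : ℝ) : ℂ) = fourierSynthesis K uhat x) ↔
      toComplex u = 𝓕⁻ (h2.toLp _) := by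
    rw [Lp.ext_iff]
    constructor
    · intro h
      filter_upwards [h, hS, toComplex_coe u] with x h1 h2 h3
      rw [h3, h1, h2]
    · intro h
      filter_upwards [h, hS, toComplex_coe u] with x h1 h2 h3
      rw [← h3, h1, h2]
  have h4 : fourierHat u =ᵐ[volume] K.indicator uhat ↔ fourierHat u = h2.toLp _ := by
    rw [Lp.ext_iff]
    exact ⟨fun h => h.trans h2.coeFn_toLp.symm, fun h => h.trans h2.coeFn_toLp⟩
  rw [h3, h4]
  constructor
  · intro h
    rw [fourierHat, h, FourierTransform.fourier_fourierInv_eq]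
  · intro h
    rw [← h, fourierHat, FourierTransform.fourierInv_fourier_eq]

theorem fourierOn_eq_of_ae_eq (hK : IsCompact K) {u : L2R n} {uhat : L2On K}
    (h : fourierHat u =ᵐ[volume] K.indicator uhat) : fourierOn K u = uhat := by
  apply Lp.ext
  filter_upwards [fourierOn_coe K u, ae_restrict_of_ae h, ae_restrict_mem hK.measurableSet]
    with η h1 h2 h3
  rw [h1, h2, Set.indicator_of_mem h3]

theorem fourierSuppIn_of_ae_eq {u : L2R n} {uhat : L2On K}
    (h : fourierHat u =ᵐ[volume] K.indicator uhat) : FourierSuppIn K u := by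
  filter_upwards [h] with η h1 h2
  rw [h1, Set.indicator_of_notMem h2]

theorem FourierSuppIn.ae_eq_indicator (hK : IsCompact K) {u : L2R n} (h : FourierSuppIn K u) :
    fourierHat u =ᵐ[volume] K.indicator (fourierOn K u) := by
  have := (ae_restrict_iff' hK.measurableSet).1 (fourierOn_coe K u)
  filter_upwards [h, this] with η h1 h2
  by_cases hη : η ∈ K
  · rw [Set.indicator_of_mem hη, h2 hη]
  · rw [Set.indicator_of_notMem hη, h1 hη]

theorem mem_effectiveSet_iff (hK : IsCompact K) {Φ : Space n → Space n → ℂ} {ε : ℝ}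
    {U : Set (L2R n)} {u : L2R n} :
    u ∈ effectiveSet Φ ε K U ↔ FourierSuppIn K u ∧ FunMem (adaption Φ ε u) U := by
  simp only [effectiveSet, Set.mem_ofPred_eq, ae_eq_fourierSynthesis_iff hK]
  refine and_congr_left fun _ => ⟨fun ⟨uhat, h⟩ => fourierSuppIn_of_ae_eq h, fun h =>
    ⟨fourierOn K u, h.ae_eq_indicator hK⟩⟩

theorem mem_fourierEffectiveSet_iff (hK : IsCompact K) {Φ : Space n → Space n → ℂ} {ε : ℝ}
    {U : Set (L2R n)} {uhat : L2On K} :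
    uhat ∈ fourierEffectiveSet Φ ε K U ↔
      ∃ u ∈ effectiveSet Φ ε K U, fourierHat u =ᵐ[volume] K.indicator uhat := by
  simp only [fourierEffectiveSet, Set.mem_ofPred_eq, FunMem, ae_eq_fourierSynthesis_iff hK]

theorem bijOn_fourierOn (hK : IsCompact K) (Φ : Space n → Space n → ℂ) (ε : ℝ)
    (U : Set (L2R n)) :
    Set.BijOn (fourierOn K) (effectiveSet Φ ε K U) (fourierEffectiveSet Φ ε K U) := by
  refine ⟨fun u hu => ?_, fun u hu v hv huv => ?_, fun uhat h => ?_⟩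
  · exact (mem_fourierEffectiveSet_iff hK).2
      ⟨u, hu, ((mem_effectiveSet_iff hK).1 hu).1.ae_eq_indicator hK⟩
  · have h1 := ((mem_effectiveSet_iff hK).1 hu).1.ae_eq_indicator hK
    have h2 := ((mem_effectiveSet_iff hK).1 hv).1.ae_eq_indicator hK
    rw [huv] at h1
    exact fourierHat_ae_injective (h1.trans h2.symm)
  · obtain ⟨u, hu, h⟩ := (mem_fourierEffectiveSet_iff hK).1 h
    exact ⟨u, hu, fourierOn_eq_of_ae_eq hK h⟩

end

end BlochControl

namespace BlochControl

noncomputable section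

variable {n : ℕ}

/-! ### Parseval's identity on the dual cell -/

theorem eLpNorm_two_sq {α E : Type*} [MeasurableSpace α] [NormedAddCommGroup E] (f : α → E)
    (μ : Measure α) : eLpNorm f 2 μ ^ 2 = ∫⁻ x, ‖f x‖ₑ ^ 2 ∂μ := by
  have h := eLpNorm_nnreal_pow_eq_lintegral (f := f) (μ := μ) (p := 2) (by norm_num)
  have e : (((2 : NNReal) : ℝ)) = ((2 : ℕ) : ℝ) := by norm_num
  simp only [e, ENNReal.rpow_natCast] at h
  exact h

theorem ofReal_integral_norm_sq {α E : Type*} [MeasurableSpace α] [NormedAddCommGroup E]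
    {f : α → E} {μ : Measure α} (hf : MemLp f 2 μ) :
    ENNReal.ofReal (∫ x, ‖f x‖ ^ 2 ∂μ) = ∫⁻ x, ‖f x‖ₑ ^ 2 ∂μ := by
  rw [ofReal_integral_eq_lintegral_ofReal (hf.integrable_norm_pow (by norm_num))
    (Eventually.of_forall fun x => by positivity)]
  refine lintegral_congr fun x => ?_
  rw [ENNReal.ofReal_pow (norm_nonneg _), ofReal_norm]

section Torus

attribute [local instance] instMeasureSpaceUnitAddCircle

theorem measurableSet_dualCell : MeasurableSet (dualCell n) := by
  have : dualCell n = ⋂ i : Fin n, {η : Space n | η i ∈ Set.Ico (-(1 / 2) : ℝ) (1 / 2)} := by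
    ext; simp [dualCell]
  rw [this]
  refine MeasurableSet.iInter fun i => ?_
  exact measurableSet_Ico.preimage (by fun_prop)

/-- The half-open cube `(-1/2, 1/2]ⁿ` in `Fin n → ℝ`. -/
def halfOpenCube (n : ℕ) : Set (Fin n → ℝ) :=
  {x | ∀ i, x i ∈ Set.Ioc (-(1 / 2) : ℝ) (-(1 / 2) + 1)}

/-- The torus is parametrized by cubes open on the left, while `Z` is open on the right; both agree
a.e. with the closed cube. -/
theorem preimage_dualCell_ae_eq :
    ((WithLp.toLp 2 : (Fin n → ℝ) → Space n) ⁻¹' dualCell n) =ᵐ[volume] halfOpenCube n := by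
  have e1 : ((WithLp.toLp 2 : (Fin n → ℝ) → Space n) ⁻¹' dualCell n) =
      Set.univ.pi fun _ => Set.Ico (-(1 / 2) : ℝ) (1 / 2) := by
    ext x; simp [dualCell]
  have e2 : halfOpenCube n = Set.univ.pi fun _ => Set.Ioc (-(1 / 2) : ℝ) (1 / 2) := by
    ext x
    simp only [halfOpenCube, Set.mem_ofPred_eq, Set.mem_univ_pi]
    norm_num
  rw [e1, e2]
  exact (Measure.univ_pi_Ico_ae_eq_Icc (μ := fun _ => volume)).trans
    (Measure.univ_pi_Ioc_ae_eq_Icc (μ := fun _ => volume)).symm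

theorem setIntegral_dualCell {E : Type*} [NormedAddCommGroup E] [NormedSpace ℝ E]
    (f : Space n → E) :
    ∫ ζ in dualCell n, f ζ = ∫ x in halfOpenCube n, f (WithLp.toLp 2 x) := by
  rw [← (PiLp.volume_preserving_toLp (Fin n)).setIntegral_preimage_emb
    (MeasurableEquiv.toLp 2 (Fin n → ℝ)).measurableEmbedding f (dualCell n)]
  exact setIntegral_congr_set preimage_dualCell_ae_eq

theorem setLIntegral_dualCell (f : Space n → ℝ≥0∞) :
    ∫⁻ ζ in dualCell n, f ζ = ∫⁻ x in halfOpenCube n, f (WithLp.toLp 2 x) := by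
  rw [← (PiLp.volume_preserving_toLp (Fin n)).setLIntegral_comp_preimage_emb
    (MeasurableEquiv.toLp 2 (Fin n → ℝ)).measurableEmbedding f (dualCell n)]
  exact setLIntegral_congr preimage_dualCell_ae_eq

/-- The integer point with coordinates `k`. -/
def intPoint (k : Fin n → ℤ) : Space n := WithLp.toLp 2 fun i => (k i : ℝ)

theorem intPoint_apply (k : Fin n → ℤ) (i : Fin n) : intPoint k i = (k i : ℝ) := rfl

theorem planeWave_intPoint_eq_mFourier (k : Fin n → ℤ) (x : Fin n → ℝ) :
    planeWave (intPoint k) (WithLp.toLp 2 x) =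
      UnitAddTorus.mFourier k (fun i => (x i : UnitAddCircle)) := by
  simp only [planeWave, UnitAddTorus.mFourier, ContinuousMap.coe_mk, fourier_coe_apply,
    ← Complex.exp_sum, PiLp.inner_apply, intPoint_apply]
  congr 1
  simp only [RCLike.inner_apply, conj_trivial, Complex.ofReal_sum, Finset.mul_sum]
  refine Finset.sum_congr rfl fun i _ => ?_
  push_cast
  ring

/-- **Parseval's identity** on the cell `Z`. -/
theorem tsum_enorm_sq_fourierCoeff {F : Space n → ℂ} (hF : Measurable F)
    (hF2 : ∫⁻ ζ in dualCell n, ‖F ζ‖ₑ ^ 2 ≠ ⊤) :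
    ∑' k : Fin n → ℤ, ‖∫ ζ in dualCell n, F ζ * planeWave (intPoint k) ζ‖ₑ ^ 2 =
      ∫⁻ ζ in dualCell n, ‖F ζ‖ₑ ^ 2 := by
  let a : Fin n → ℝ := fun _ => -(1 / 2)
  let f : UnitAddTorus (Fin n) → ℂ := fun z =>
    F (WithLp.toLp 2 (UnitAddTorus.measurableEquivPiIoc a z).1)
  have hval : ∀ x ∈ halfOpenCube n, f (fun i => (x i : UnitAddCircle)) = F (WithLp.toLp 2 x) := by
    intro x hx
    have : UnitAddTorus.measurableEquivPiIoc a (fun i => (x i : UnitAddCircle)) = ⟨x, hx⟩ :=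
      (UnitAddTorus.measurableEquivPiIoc a).apply_symm_apply ⟨x, hx⟩
    simp only [f, this]
  have hmeas : MeasurableSet (halfOpenCube n) :=
    MeasurableSet.univ_pi' fun _ => measurableSet_Ioc
  have hfm : Measurable f :=
    hF.comp ((MeasurableEquiv.toLp 2 (Fin n → ℝ)).measurable.comp
      (measurable_subtype_coe.comp (UnitAddTorus.measurableEquivPiIoc a).measurable))
  have hfl : ∫⁻ z, ‖f z‖ₑ ^ 2 = ∫⁻ ζ in dualCell n, ‖F ζ‖ₑ ^ 2 := by
    rw [UnitAddTorus.lintegral_preimage _ a, setLIntegral_dualCell]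
    refine setLIntegral_congr_fun hmeas fun x hx => ?_
    simp only [hval x hx]
  have hf2 : MemLp f 2 volume := by
    refine ⟨hfm.aestronglyMeasurable, ?_⟩
    have h := hF2.lt_top
    rw [← hfl, ← eLpNorm_two_sq, ENNReal.pow_lt_top_iff] at h
    simpa using h
  -- Fourier coefficients on the torus carry the conjugate character, so the plane wave with `+k`
  -- gives the coefficient of index `-k`; the sum is reindexed accordingly below.
  have hcoeff : ∀ k : Fin n → ℤ, UnitAddTorus.mFourierCoeff (hf2.toLp f) (-k) =
      ∫ ζ in dualCell n, F ζ * planeWave (intPoint k) ζ := by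
    intro k
    have e1 : UnitAddTorus.mFourierCoeff (hf2.toLp f) (-k) = UnitAddTorus.mFourierCoeff f (-k) := by
      refine integral_congr_ae ?_
      filter_upwards [hf2.coeFn_toLp] with z hz
      rw [hz]
    rw [e1, UnitAddTorus.mFourierCoeff_eq_integral _ _ a, setIntegral_dualCell]
    refine setIntegral_congr_fun hmeas fun x hx => ?_
    simp only [hval x hx, neg_neg, planeWave_intPoint_eq_mFourier, smul_eq_mul, mul_comm]
  have hsum := UnitAddTorus.hasSum_sq_mFourierCoeff (hf2.toLp f)
  have hsum' := (Equiv.neg (Fin n → ℤ)).hasSum_iff.2 hsum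
  simp only [Function.comp_def, Equiv.neg_apply, hcoeff] at hsum'
  have e2 : ∫ z, ‖(hf2.toLp f) z‖ ^ 2 = ∫ z, ‖f z‖ ^ 2 := by
    refine integral_congr_ae ?_
    filter_upwards [hf2.coeFn_toLp] with z hz
    rw [hz]
  rw [e2] at hsum'
  have h3 := ENNReal.ofReal_tsum_of_nonneg (fun k => by positivity) hsum'.summable
  rw [hsum'.tsum_eq, ofReal_integral_norm_sq hf2, hfl] at h3
  rw [h3]
  refine tsum_congr fun k => ?_
  rw [ENNReal.ofReal_pow (norm_nonneg _), ofReal_norm]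

end Torus

/-! ### Unfolding integrals over `ℝⁿ` -/

/-- The half-open unit cell `[0,1)ⁿ`, translated by the integer point `k`. -/
def latticeCell (k : Fin n → ℤ) : Set (Space n) := {x | (fun i => ⌊x i⌋) = k}

theorem measurableSet_latticeCell (k : Fin n → ℤ) : MeasurableSet (latticeCell k) := by
  have : latticeCell k = ⋂ i, {x : Space n | ⌊x i⌋ = k i} := by
    ext x; simp [latticeCell, funext_iff]
  rw [this]
  refine MeasurableSet.iInter fun i => ?_
  exact (measurableSet_singleton (k i)).preimage
    (Int.measurable_floor.comp (by fun_prop : Measurable fun x : Space n => x i))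

theorem iUnion_latticeCell : ⋃ k : Fin n → ℤ, latticeCell k = Set.univ := by
  ext x; simp [latticeCell]

theorem pairwise_disjoint_latticeCell :
    Pairwise (Function.onFun Disjoint (latticeCell (n := n))) := by
  intro k l hkl
  refine Set.disjoint_left.2 fun x hx hx' => hkl ?_
  simp only [latticeCell, Set.mem_ofPred_eq] at hx hx'
  exact hx.symm.trans hx'

theorem preimage_add_latticeCell (k : Fin n → ℤ) :
    (fun x : Space n => x + intPoint k) ⁻¹' latticeCell k = latticeCell 0 := by
  ext x
  simp [latticeCell, funext_iff, intPoint_apply]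

theorem setLIntegral_latticeCell (k : Fin n → ℤ) (g : Space n → ℝ≥0∞) :
    ∫⁻ x in latticeCell k, g x = ∫⁻ y in latticeCell 0, g (y + intPoint k) := by
  rw [← (measurePreserving_add_right volume (intPoint k)).setLIntegral_comp_preimage_emb
    (MeasurableEquiv.addRight (intPoint k)).measurableEmbedding g (latticeCell k),
    preimage_add_latticeCell]

theorem lintegral_eq_tsum_latticeCell (g : Space n → ℝ≥0∞) :
    ∫⁻ x, g x = ∑' k : Fin n → ℤ, ∫⁻ y in latticeCell 0, g (y + intPoint k) := by
  rw [← setLIntegral_univ, ← iUnion_latticeCell, lintegral_iUnion measurableSet_latticeCell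
    pairwise_disjoint_latticeCell]
  exact tsum_congr fun k => setLIntegral_latticeCell k g

theorem latticeCell_zero_ae_eq : latticeCell (n := n) 0 =ᵐ[volume] unitCell n := by
  have hmp := PiLp.volume_preserving_toLp (Fin n)
  have e1 : (WithLp.toLp 2 : (Fin n → ℝ) → Space n) ⁻¹' latticeCell (n := n) 0 =
      Set.univ.pi fun _ => Set.Ico (0 : ℝ) 1 := by
    ext x; simp [latticeCell, funext_iff, Int.floor_eq_zero_iff]
  have e2 : (WithLp.toLp 2 : (Fin n → ℝ) → Space n) ⁻¹' unitCell n =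
      Set.Icc (fun _ => 0) (fun _ => 1) := by
    ext x; simp [unitCell, Pi.le_def, forall_and]
  have h3 : (WithLp.toLp 2 : (Fin n → ℝ) → Space n) ⁻¹' latticeCell (n := n) 0 =ᵐ[volume]
      (WithLp.toLp 2 : (Fin n → ℝ) → Space n) ⁻¹' unitCell n := by
    rw [e1, e2]
    exact Measure.univ_pi_Ico_ae_eq_Icc (μ := fun _ => volume)
  have h4 := (EuclideanSpace.volume_preserving_symm_measurableEquiv_toLp
    (Fin n)).quasiMeasurePreserving.preimage_ae_eq h3
  exact h4

theorem periodic_intPoint {X : Type*} {g : Space n → X} (hg : IsPeriodic g) (k : Fin n → ℤ)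
    (x : Space n) : g (x + intPoint k) = g x := by
  have hnat : ∀ (i : Fin n) (m : ℕ) (x : Space n), g (x + (m : ℝ) • basisVec i) = g x := by
    intro i m
    induction m with
    | zero => intro x; simp
    | succ m ih =>
      intro x
      rw [Nat.cast_succ, add_smul, one_smul, ← add_assoc, hg, ih]
  have hint : ∀ (i : Fin n) (m : ℤ) (x : Space n), g (x + (m : ℝ) • basisVec i) = g x := by
    intro i m x
    obtain ⟨m, rfl | rfl⟩ := m.eq_nat_or_neg
    · exact_mod_cast hnat i m x
    -- A negative multiple is undone by the natural multiple already treated.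
    · rw [← hnat i m (x + _), add_assoc, ← add_smul]
      simp
  have hsum : ∀ (s : Finset (Fin n)) (x : Space n),
      g (x + ∑ i ∈ s, (k i : ℝ) • basisVec i) = g x := by
    intro s
    induction s using Finset.induction_on with
    | empty => intro x; simp
    | insert a s ha ih => intro x; rw [Finset.sum_insert ha, ← add_assoc, ih, hint]
  have e : intPoint k = ∑ i, (k i : ℝ) • basisVec i := by
    ext j
    simp [intPoint_apply, basisVec, Pi.single_apply]
  rw [e, hsum]

theorem exists_finset_ball_subset (r : ℝ) :
    ∃ s : Finset (Fin n → ℤ), Metric.ball (0 : Space n) r ⊆ ⋃ k ∈ s, latticeCell k := by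
  refine ⟨Fintype.piFinset fun _ => Finset.Icc (-⌈r⌉ - 1) ⌈r⌉, fun x hx => ?_⟩
  simp only [Set.mem_iUnion, latticeCell, Set.mem_ofPred_eq, exists_prop, exists_eq_right',
    Fintype.mem_piFinset, Finset.mem_Icc]
  intro i
  have h1 : |x i| ≤ r := by
    have := PiLp.norm_apply_le x i
    rw [Real.norm_eq_abs] at this
    exact this.trans (mem_ball_zero_iff.1 hx).le
  have h2 := abs_le.1 h1
  have h3 := Int.le_ceil r
  constructor
  · rw [Int.le_floor]
    push_cast
    linarith
  · exact Int.floor_le_ceil _ |>.trans (Int.ceil_le_ceil h2.2)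

/-- Integrals of periodic functions over balls are finite if the integral over the unit cell is. -/
theorem setLIntegral_ball_ne_top {g : Space n → ℝ≥0∞}
    (hper : ∀ (k : Fin n → ℤ) (x : Space n), g (x + intPoint k) = g x)
    (hg : ∫⁻ y in latticeCell 0, g y ≠ ⊤) (r : ℝ) :
    ∫⁻ x in Metric.ball (0 : Space n) r, g x ≠ ⊤ := by
  obtain ⟨s, hs⟩ := exists_finset_ball_subset (n := n) r
  refine ne_top_of_le_ne_top ?_ (lintegral_mono_set hs)
  rw [lintegral_biUnion_finset (fun k _ l _ hkl => pairwise_disjoint_latticeCell hkl)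
    fun k _ => measurableSet_latticeCell k]
  refine ENNReal.sum_ne_top.2 fun k _ => ?_
  rw [setLIntegral_latticeCell]
  simpa only [hper] using hg

end

end BlochControl

namespace BlochControl

noncomputable section

variable {n : ℕ}

/-! ### The Bloch wave transform at unit scale -/

theorem continuous_planeWave : Continuous (Function.uncurry (planeWave (n := n))) := by
  unfold Function.uncurry planeWave
  fun_prop

theorem norm_planeWave (x η : Space n) : ‖planeWave x η‖ = 1 := by
  have : planeWave x η = Complex.exp (((2 * Real.pi * inner ℝ η x : ℝ) : ℂ) * Complex.I) := by
    rw [planeWave]; congr 1; push_cast; ring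
  rw [this, Complex.norm_exp_ofReal_mul_I]

theorem enorm_planeWave (x η : Space n) : ‖planeWave x η‖ₑ = 1 := by
  rw [← ofReal_norm, norm_planeWave, ENNReal.ofReal_one]

theorem planeWave_add (x y η : Space n) :
    planeWave (x + y) η = planeWave x η * planeWave y η := by
  simp only [planeWave, ← Complex.exp_add, inner_add_right]
  congr 1
  push_cast
  ring

theorem planeWave_smul_left (c : ℝ) (x η : Space n) :
    planeWave (c • x) η = planeWave x (c • η) := by
  simp only [planeWave, inner_smul_left, inner_smul_right, conj_trivial]

/-- `∫_Z h(ζ) Φ(y, ζ) exp(2π i ζ · y) dζ`. -/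
def cellTransform (Φ : Space n → Space n → ℂ) (h : Space n → ℂ) (y : Space n) : ℂ :=
  ∫ ζ in dualCell n, h ζ * (Φ y ζ * planeWave y ζ)

/-- `∫_Z |h(ζ)|² |Φ(y, ζ)|² dζ`. -/
def cellDensity (Φ : Space n → Space n → ℂ) (h : Space n → ℂ) (y : Space n) : ℝ≥0∞ :=
  ∫⁻ ζ in dualCell n, ‖h ζ‖ₑ ^ 2 * ‖Φ y ζ‖ₑ ^ 2

variable {A : Space n → Matrix (Fin n) (Fin n) ℝ} {Φ : Space n → Space n → ℂ}

theorem IsFirstBlochWave.add_intPoint (hΦ : IsFirstBlochWave A Φ) {ζ : Space n}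
    (hζ : ζ ∈ dualCell n) (k : Fin n → ℤ) (y : Space n) : Φ (y + intPoint k) ζ = Φ y ζ := by
  obtain ⟨G, hG, -⟩ := hΦ.eigen ζ hζ
  exact periodic_intPoint hG.periodic k y

theorem IsFirstBlochWave.lintegral_latticeCell (hΦ : IsFirstBlochWave A Φ) {ζ : Space n}
    (hζ : ζ ∈ dualCell n) : ∫⁻ y in latticeCell 0, ‖Φ y ζ‖ₑ ^ 2 = 1 := by
  obtain ⟨G, hG, -⟩ := hΦ.eigen ζ hζ
  rw [setLIntegral_congr latticeCell_zero_ae_eq, ← ofReal_integral_norm_sq hG.memLp,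
    hΦ.normalized ζ hζ, ENNReal.ofReal_one]

theorem measurable_cellDensity (hΦ : Measurable (Function.uncurry Φ)) {h : Space n → ℂ}
    (hh : Measurable h) : Measurable (cellDensity Φ h) := by
  have : Measurable fun p : Space n × Space n => ‖h p.2‖ₑ ^ 2 * ‖Φ p.1 p.2‖ₑ ^ 2 :=
    ((hh.comp measurable_snd).enorm.pow_const 2).mul (hΦ.enorm.pow_const 2)
  exact this.lintegral_prod_right'

theorem cellDensity_add_intPoint (hΦ : IsFirstBlochWave A Φ) (h : Space n → ℂ)
    (k : Fin n → ℤ) (y : Space n) : cellDensity Φ h (y + intPoint k) = cellDensity Φ h y := by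
  refine setLIntegral_congr_fun measurableSet_dualCell fun ζ hζ => ?_
  simp only [hΦ.add_intPoint hζ]

/-- Tonelli, then the normalization of `Φ₀(·; ζ)` on the unit cell for each `ζ`. -/
theorem lintegral_cellDensity (hΦ : IsFirstBlochWave A Φ) {h : Space n → ℂ} (hh : Measurable h) :
    ∫⁻ y in latticeCell 0, cellDensity Φ h y = ∫⁻ ζ in dualCell n, ‖h ζ‖ₑ ^ 2 := by
  have hm : Measurable fun p : Space n × Space n => ‖h p.2‖ₑ ^ 2 * ‖Φ p.1 p.2‖ₑ ^ 2 :=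
    ((hh.comp measurable_snd).enorm.pow_const 2).mul (hΦ.measurable.enorm.pow_const 2)
  unfold cellDensity
  rw [lintegral_lintegral_swap hm.aemeasurable]
  refine setLIntegral_congr_fun measurableSet_dualCell fun ζ hζ => ?_
  have : Measurable fun y => ‖Φ y ζ‖ₑ ^ 2 :=
    (hΦ.measurable.comp (measurable_id.prodMk measurable_const)).enorm.pow_const 2
  rw [lintegral_const_mul _ this, hΦ.lintegral_latticeCell hζ, mul_one]

theorem stronglyMeasurable_integral_bloch (hΦ : Measurable (Function.uncurry Φ)) {h : Space n → ℂ}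
    (hh : Measurable h) (ν : Measure (Space n)) [SFinite ν] :
    StronglyMeasurable fun y => ∫ ζ, h ζ * (Φ y ζ * planeWave y ζ) ∂ν := by
  have hm : Measurable fun p : Space n × Space n => h p.2 * (Φ p.1 p.2 * planeWave p.1 p.2) :=
    (hh.comp measurable_snd).mul (hΦ.mul continuous_planeWave.measurable)
  exact hm.stronglyMeasurable.integral_prod_right'

/-- The Bloch wave transform is an isometry. -/
theorem lintegral_cellTransform (hΦ : IsFirstBlochWave A Φ) {h : Space n → ℂ} (hh : Measurable h)
    (hfin : ∫⁻ ζ in dualCell n, ‖h ζ‖ₑ ^ 2 ≠ ⊤) :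
    ∫⁻ y, ‖cellTransform Φ h y‖ₑ ^ 2 = ∫⁻ ζ in dualCell n, ‖h ζ‖ₑ ^ 2 := by
  have hT : Measurable (cellTransform Φ h) :=
    (stronglyMeasurable_integral_bloch hΦ.measurable hh _).measurable
  have hT' : ∀ k : Fin n → ℤ, Measurable fun y => ‖cellTransform Φ h (y + intPoint k)‖ₑ ^ 2 :=
    fun k => (hT.comp (measurable_add_const _)).enorm.pow_const 2
  -- Parseval needs square integrability in `ζ`, which holds only for almost every `y`.
  have hd : ∀ᵐ y ∂volume.restrict (latticeCell 0), cellDensity Φ h y < ⊤ := by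
    refine ae_lt_top (measurable_cellDensity hΦ.measurable hh) ?_
    rwa [lintegral_cellDensity hΦ hh]
  -- For fixed `y`, periodicity of `Φ₀` turns the values at `y + k` into the Fourier coefficients in
  -- `ζ` of one function on `Z`, namely `h(ζ) Φ(y, ζ) exp(2πi ζ·y)`.
  have key : ∀ y, cellDensity Φ h y < ⊤ →
      ∑' k : Fin n → ℤ, ‖cellTransform Φ h (y + intPoint k)‖ₑ ^ 2 = cellDensity Φ h y := by
    intro y hy
    have e : ∀ ζ, ‖h ζ * (Φ y ζ * planeWave y ζ)‖ₑ ^ 2 = ‖h ζ‖ₑ ^ 2 * ‖Φ y ζ‖ₑ ^ 2 := fun ζ => by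
      rw [enorm_mul, enorm_mul, enorm_planeWave, mul_one, mul_pow]
    have hΦy : Measurable (Φ y) := hΦ.measurable.of_uncurry_left
    have hpy : Measurable (planeWave y) := continuous_planeWave.measurable.of_uncurry_left
    have e' : ∫⁻ ζ in dualCell n, ‖h ζ * (Φ y ζ * planeWave y ζ)‖ₑ ^ 2 = cellDensity Φ h y :=
      lintegral_congr e
    have hF : Measurable fun ζ => h ζ * (Φ y ζ * planeWave y ζ) := hh.mul (hΦy.mul hpy)
    have hP := tsum_enorm_sq_fourierCoeff hF (by rw [e']; exact hy.ne)
    rw [← e', ← hP]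
    refine tsum_congr fun k => ?_
    have e2 : cellTransform Φ h (y + intPoint k) =
        ∫ ζ in dualCell n, h ζ * (Φ y ζ * planeWave y ζ) * planeWave (intPoint k) ζ := by
      refine setIntegral_congr_fun measurableSet_dualCell fun ζ hζ => ?_
      simp only [hΦ.add_intPoint hζ, planeWave_add]
      ring
    rw [e2]
  calc ∫⁻ y, ‖cellTransform Φ h y‖ₑ ^ 2
      = ∑' k : Fin n → ℤ, ∫⁻ y in latticeCell 0, ‖cellTransform Φ h (y + intPoint k)‖ₑ ^ 2 :=
        lintegral_eq_tsum_latticeCell fun y => ‖cellTransform Φ h y‖ₑ ^ 2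
    _ = ∫⁻ y in latticeCell 0, ∑' k : Fin n → ℤ, ‖cellTransform Φ h (y + intPoint k)‖ₑ ^ 2 :=
        (lintegral_tsum fun k => (hT' k).aemeasurable).symm
    _ = ∫⁻ y in latticeCell 0, cellDensity Φ h y :=
        lintegral_congr_ae (hd.mono key)
    _ = ∫⁻ ζ in dualCell n, ‖h ζ‖ₑ ^ 2 := lintegral_cellDensity hΦ hh

/-! ### The Bloch wave transform at scale `ε` -/

theorem measurableSet_scaledDualCell (ε : ℝ) : MeasurableSet (scaledDualCell n ε) :=
  measurableSet_dualCell.preimage (measurable_const_smul ε)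

open scoped Pointwise in
theorem smul_scaledDualCell {ε : ℝ} (hε : 0 < ε) : ε • scaledDualCell n ε = dualCell n := by
  ext x
  rw [Set.mem_smul_set_iff_inv_smul_mem₀ hε.ne']
  simp only [scaledDualCell, Set.mem_ofPred_eq, smul_inv_smul₀ hε.ne']

theorem lintegral_smul_arg {r : ℝ} (hr : r ≠ 0) (f : Space n → ℝ≥0∞) :
    ∫⁻ x, f (r • x) = ENNReal.ofReal |(r ^ Module.finrank ℝ (Space n))⁻¹| * ∫⁻ x, f x := by
  rw [← smul_eq_mul, ← lintegral_smul_measure, ← Measure.map_addHaar_smul volume hr]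
  exact (lintegral_map_equiv f (Homeomorph.smulOfNeZero r hr).toMeasurableEquiv).symm

theorem setLIntegral_scaledDualCell {ε : ℝ} (hε : 0 < ε) (f : Space n → ℝ≥0∞) :
    ∫⁻ η in scaledDualCell n ε, f (ε • η) =
      ENNReal.ofReal |(ε ^ Module.finrank ℝ (Space n))⁻¹| * ∫⁻ ζ in dualCell n, f ζ := by
  rw [← lintegral_indicator measurableSet_dualCell, ← lintegral_smul_arg hε.ne',
    ← lintegral_indicator (measurableSet_scaledDualCell ε)]
  rfl

/-- `∫_{Z/ε} h(η) ω₀^ε(x; η) dη`. -/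
def blochSynthesis (Φ : Space n → Space n → ℂ) (ε : ℝ) (h : Space n → ℂ) (x : Space n) : ℂ :=
  ∫ η in scaledDualCell n ε, h η * blochWave Φ ε x η

theorem measurable_blochWave (hΦ : Measurable (Function.uncurry Φ)) (ε : ℝ) :
    Measurable fun p : Space n × Space n => blochWave Φ ε p.1 p.2 := by
  have h1 : Measurable fun p : Space n × Space n => (ε⁻¹ • p.1, ε • p.2) := by fun_prop
  exact (hΦ.comp h1).mul continuous_planeWave.measurable

theorem stronglyMeasurable_blochSynthesis (hΦ : Measurable (Function.uncurry Φ)) (ε : ℝ)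
    {h : Space n → ℂ} (hh : Measurable h) : StronglyMeasurable (blochSynthesis Φ ε h) := by
  have hm : Measurable fun p : Space n × Space n => h p.2 * blochWave Φ ε p.1 p.2 :=
    (hh.comp measurable_snd).mul (measurable_blochWave hΦ ε)
  exact hm.stronglyMeasurable.integral_prod_right'

open scoped Pointwise in
-- Substituting `x = εy`, `ζ = εη` reduces the scale `ε` to the scale one.
theorem blochSynthesis_smul {ε : ℝ} (hε : 0 < ε) (h : Space n → ℂ) (y : Space n) :
    blochSynthesis Φ ε h (ε • y) = |(ε ^ Module.finrank ℝ (Space n))⁻¹| •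
      cellTransform Φ (fun ζ => h (ε⁻¹ • ζ)) y := by
  rw [cellTransform, ← smul_scaledDualCell hε, ← Measure.setIntegral_comp_smul _ _ _ hε.ne',
    blochSynthesis]
  refine integral_congr_ae (Eventually.of_forall fun η => ?_)
  simp only [blochWave, inv_smul_smul₀ hε.ne', planeWave_smul_left]

theorem lintegral_blochSynthesis (hΦ : IsFirstBlochWave A Φ) {ε : ℝ} (hε : 0 < ε)
    {h : Space n → ℂ} (hh : Measurable h)
    (hfin : ∫⁻ η in scaledDualCell n ε, ‖h η‖ₑ ^ 2 ≠ ⊤) :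
    ∫⁻ x, ‖blochSynthesis Φ ε h x‖ₑ ^ 2 = ∫⁻ η in scaledDualCell n ε, ‖h η‖ₑ ^ 2 := by
  set c : ℝ := |(ε ^ Module.finrank ℝ (Space n))⁻¹| with hc
  have hcpos : 0 < c := by positivity
  have hc0 : ENNReal.ofReal c ≠ 0 := by simpa using hcpos
  have hct : ENNReal.ofReal c ≠ ⊤ := ENNReal.ofReal_ne_top
  set h' : Space n → ℂ := fun ζ => h (ε⁻¹ • ζ) with hh'
  have hm' : Measurable h' := hh.comp (measurable_const_smul _)
  have e1 : ∫⁻ η in scaledDualCell n ε, ‖h η‖ₑ ^ 2 =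
      ENNReal.ofReal c * ∫⁻ ζ in dualCell n, ‖h' ζ‖ₑ ^ 2 := by
    rw [← setLIntegral_scaledDualCell hε]
    simp only [hh', inv_smul_smul₀ hε.ne']
  have hfin' : ∫⁻ ζ in dualCell n, ‖h' ζ‖ₑ ^ 2 ≠ ⊤ := by
    intro htop
    rw [e1, htop, ENNReal.mul_top hc0] at hfin
    exact hfin rfl
  have e2 := lintegral_smul_arg hε.ne' fun x => ‖blochSynthesis Φ ε h x‖ₑ ^ 2
  have e3 : ∀ y, ‖blochSynthesis Φ ε h (ε • y)‖ₑ ^ 2 =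
      ENNReal.ofReal c ^ 2 * ‖cellTransform Φ h' y‖ₑ ^ 2 := fun y => by
    rw [blochSynthesis_smul hε, enorm_smul, mul_pow, ← hc, Real.enorm_eq_ofReal hcpos.le]
  simp only [e3] at e2
  -- With `c` the Jacobian `ε⁻ⁿ`, the synthesis contributes `c²`, while rescaling each of the two
  -- integrals contributes one `c`; one factor is left on each side and cancels.
  rw [lintegral_const_mul' _ _ (ENNReal.pow_ne_top hct), lintegral_cellTransform hΦ hm' hfin',
    pow_two, mul_assoc, ← e1] at e2
  exact ((ENNReal.mul_right_inj hc0 hct).1 e2).symm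

/-- The inner integral is a rescaled periodic function of `x`, so it is integrable on every ball as
soon as it is on one cell. This justifies pointwise linearity of the synthesis and the use of Fubini
for the coefficient. -/
theorem lintegral_ball_blochWave_ne_top (hΦ : IsFirstBlochWave A Φ) {ε : ℝ} (hε : 0 < ε)
    {h : Space n → ℂ} (hh : Measurable h)
    (hfin : ∫⁻ η in scaledDualCell n ε, ‖h η‖ₑ ^ 2 ≠ ⊤) (r : ℝ) :
    ∫⁻ x in Metric.ball (0 : Space n) r,
      ∫⁻ η in scaledDualCell n ε, ‖h η * blochWave Φ ε x η‖ₑ ^ 2 ≠ ⊤ := by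
  set c : ℝ := |(ε ^ Module.finrank ℝ (Space n))⁻¹| with hc
  have hcpos : 0 < c := by positivity
  have hc0 : ENNReal.ofReal c ≠ 0 := by simpa using hcpos
  have hct : ENNReal.ofReal c ≠ ⊤ := ENNReal.ofReal_ne_top
  set h' : Space n → ℂ := fun ζ => h (ε⁻¹ • ζ) with hh'
  have hm' : Measurable h' := hh.comp (measurable_const_smul _)
  have e1 : ∫⁻ η in scaledDualCell n ε, ‖h η‖ₑ ^ 2 =
      ENNReal.ofReal c * ∫⁻ ζ in dualCell n, ‖h' ζ‖ₑ ^ 2 := by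
    rw [← setLIntegral_scaledDualCell hε]
    simp only [hh', inv_smul_smul₀ hε.ne']
  have hfin' : ∫⁻ ζ in dualCell n, ‖h' ζ‖ₑ ^ 2 ≠ ⊤ := by
    intro htop
    rw [e1, htop, ENNReal.mul_top hc0] at hfin
    exact hfin rfl
  have e2 : ∀ x, ∫⁻ η in scaledDualCell n ε, ‖h η * blochWave Φ ε x η‖ₑ ^ 2 =
      ENNReal.ofReal c * cellDensity Φ h' (ε⁻¹ • x) := fun x => by
    rw [cellDensity, ← setLIntegral_scaledDualCell hε]
    refine lintegral_congr fun η => ?_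
    simp only [hh', inv_smul_smul₀ hε.ne', blochWave, enorm_mul, enorm_planeWave, mul_one, mul_pow]
  simp only [e2]
  rw [lintegral_const_mul' _ _ hct]
  refine ENNReal.mul_ne_top hct ?_
  have e3 := lintegral_smul_arg (inv_ne_zero hε.ne')
    ((Metric.ball (0 : Space n) (ε⁻¹ * r)).indicator (cellDensity Φ h'))
  have e4 : ∫⁻ x in Metric.ball (0 : Space n) r, cellDensity Φ h' (ε⁻¹ • x) =
      ∫⁻ x, (Metric.ball (0 : Space n) (ε⁻¹ * r)).indicator (cellDensity Φ h') (ε⁻¹ • x) := by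
    rw [← lintegral_indicator measurableSet_ball]
    refine lintegral_congr fun x => ?_
    have : ε⁻¹ • x ∈ Metric.ball (0 : Space n) (ε⁻¹ * r) ↔ x ∈ Metric.ball (0 : Space n) r := by
      rw [mem_ball_zero_iff, mem_ball_zero_iff, norm_smul, Real.norm_eq_abs,
        abs_of_pos (inv_pos.2 hε), mul_lt_mul_iff_right₀ (inv_pos.2 hε)]
    by_cases hx : x ∈ Metric.ball (0 : Space n) r
    · rw [Set.indicator_of_mem hx, Set.indicator_of_mem (this.2 hx)]
    · rw [Set.indicator_of_notMem hx, Set.indicator_of_notMem (fun h => hx (this.1 h))]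
  rw [e4, e3, lintegral_indicator measurableSet_ball]
  refine ENNReal.mul_ne_top ENNReal.ofReal_ne_top
    (setLIntegral_ball_ne_top (cellDensity_add_intPoint hΦ h') ?_ _)
  rwa [lintegral_cellDensity hΦ hm']

end

end BlochControl

namespace BlochControl

noncomputable section

variable {n : ℕ} {A : Space n → Matrix (Fin n) (Fin n) ℝ} {Φ : Space n → Space n → ℂ} {ε : ℝ}

/-! ### The Bloch wave transform as an isometry of `L²` -/

theorem volume_dualCell_lt_top : volume (dualCell n) < ⊤ := by
  have h := setLIntegral_dualCell (n := n) fun _ => 1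
  simp only [lintegral_const, one_mul, Measure.restrict_apply_univ] at h
  rw [h]
  refine lt_of_le_of_lt (measure_mono (t := Set.Icc (fun _ => -(1 / 2)) (fun _ => -(1 / 2) + 1))
    fun x hx => ?_) isCompact_Icc.measure_lt_top
  exact ⟨fun i => (hx i).1.le, fun i => (hx i).2⟩

theorem isFiniteMeasure_scaledDualCell (hε : 0 < ε) :
    IsFiniteMeasure ((volume : Measure (Space n)).restrict (scaledDualCell n ε)) := by
  refine ⟨?_⟩
  have h := setLIntegral_scaledDualCell (n := n) hε fun _ => 1
  simp only [lintegral_const, one_mul, Measure.restrict_apply_univ] at h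
  rw [Measure.restrict_apply_univ, h]
  exact ENNReal.mul_lt_top ENNReal.ofReal_lt_top volume_dualCell_lt_top

theorem lintegral_Lp_ne_top {α : Type*} [MeasurableSpace α] {μ : Measure α} (h : Lp ℂ 2 μ) :
    ∫⁻ x, ‖h x‖ₑ ^ 2 ∂μ ≠ ⊤ := by
  rw [← eLpNorm_two_sq]
  exact ENNReal.pow_ne_top (Lp.eLpNorm_ne_top h)

/-- For a.e. `x` in each ball the integrand is in `L²(Z/ε)`, and `Z/ε` has finite measure.
Additivity of the synthesis rests on this. -/
theorem ae_integrable_blochWave (hΦ : IsFirstBlochWave A Φ) (hε : 0 < ε) {h : Space n → ℂ}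
    (hh : Measurable h) (hfin : ∫⁻ η in scaledDualCell n ε, ‖h η‖ₑ ^ 2 ≠ ⊤) :
    ∀ᵐ x : Space n, Integrable (fun η => h η * blochWave Φ ε x η)
      (volume.restrict (scaledDualCell n ε)) := by
  have := isFiniteMeasure_scaledDualCell (n := n) hε
  have hω := measurable_blochWave hΦ.measurable ε
  have hm : Measurable fun p : Space n × Space n => ‖h p.2 * blochWave Φ ε p.1 p.2‖ₑ ^ 2 :=
    ((hh.comp measurable_snd).mul hω).enorm.pow_const 2
  have h1 : ∀ N : ℕ, ∀ᵐ x ∂(volume.restrict (Metric.ball (0 : Space n) N)),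
      ∫⁻ η in scaledDualCell n ε, ‖h η * blochWave Φ ε x η‖ₑ ^ 2 < ⊤ := fun N =>
    ae_lt_top hm.lintegral_prod_right' (lintegral_ball_blochWave_ne_top hΦ hε hh hfin N)
  rw [← ae_restrict_iUnion_iff, Metric.iUnion_ball_nat, Measure.restrict_univ] at h1
  filter_upwards [h1] with x hx
  have hωx : Measurable (blochWave Φ ε x) := hω.of_uncurry_left
  have h2 : MemLp (fun η => h η * blochWave Φ ε x η) 2
      (volume.restrict (scaledDualCell n ε)) := by
    refine ⟨(hh.mul hωx).aestronglyMeasurable, ?_⟩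
    rw [← eLpNorm_two_sq, ENNReal.pow_lt_top_iff] at hx
    simpa using hx
  exact h2.integrable (by norm_num)

theorem blochSynthesis_congr {h h' : Space n → ℂ}
    (hh : h =ᵐ[volume.restrict (scaledDualCell n ε)] h') :
    blochSynthesis Φ ε h = blochSynthesis Φ ε h' := by
  funext x
  refine integral_congr_ae ?_
  filter_upwards [hh] with η hη
  rw [hη]

/-- The space `L²(Z/ε; ℂ)`. -/
abbrev L2Dual (n : ℕ) (ε : ℝ) : Type :=
  Lp ℂ 2 ((volume : Measure (Space n)).restrict (scaledDualCell n ε))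

theorem eLpNorm_blochSynthesis (hΦ : IsFirstBlochWave A Φ) (hε : 0 < ε) (h : L2Dual n ε) :
    eLpNorm (blochSynthesis Φ ε h) 2 volume =
      eLpNorm h 2 (volume.restrict (scaledDualCell n ε)) := by
  have hm : Measurable h := (Lp.stronglyMeasurable h).measurable
  refine (ENNReal.pow_right_strictMono two_ne_zero).injective ?_
  simp only [eLpNorm_two_sq]
  exact lintegral_blochSynthesis hΦ hε hm (lintegral_Lp_ne_top h)

theorem memLp_blochSynthesis (hΦ : IsFirstBlochWave A Φ) (hε : 0 < ε) (h : L2Dual n ε) :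
    MemLp (blochSynthesis Φ ε h) 2 (volume : Measure (Space n)) :=
  ⟨(stronglyMeasurable_blochSynthesis hΦ.measurable ε
    (Lp.stronglyMeasurable h).measurable).aestronglyMeasurable, by
    rw [eLpNorm_blochSynthesis hΦ hε]; exact Lp.eLpNorm_lt_top h⟩

/-- The isometry `h ↦ ∫_{Z/ε} h(η) ω₀^ε(·; η) dη` from `L²(Z/ε; ℂ)` to `L²(ℝⁿ; ℂ)`. -/
def blochIsometry (hΦ : IsFirstBlochWave A Φ) (hε : 0 < ε) : L2Dual n ε →ₗᵢ[ℂ] L2C n where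
  toFun h := (memLp_blochSynthesis hΦ hε h).toLp
  map_add' h k := by
    apply Lp.ext
    have hI : ∀ h : L2Dual n ε, _ := fun h => ae_integrable_blochWave hΦ hε
      (Lp.stronglyMeasurable h).measurable (lintegral_Lp_ne_top h)
    filter_upwards [(memLp_blochSynthesis hΦ hε h).coeFn_toLp,
      (memLp_blochSynthesis hΦ hε k).coeFn_toLp, (memLp_blochSynthesis hΦ hε (h + k)).coeFn_toLp,
      Lp.coeFn_add (memLp_blochSynthesis hΦ hε h).toLp (memLp_blochSynthesis hΦ hε k).toLp,
      hI h, hI k] with x h1 h2 h3 h4 h5 h6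
    rw [h3, h4, Pi.add_apply, h1, h2, blochSynthesis_congr (Lp.coeFn_add h k)]
    simp only [blochSynthesis, Pi.add_apply, add_mul]
    exact integral_add h5 h6
  map_smul' c h := by
    apply Lp.ext
    filter_upwards [(memLp_blochSynthesis hΦ hε h).coeFn_toLp,
      (memLp_blochSynthesis hΦ hε (c • h)).coeFn_toLp,
      Lp.coeFn_smul c (memLp_blochSynthesis hΦ hε h).toLp] with x h1 h2 h3
    rw [h2, RingHom.id_apply, h3, Pi.smul_apply, h1, blochSynthesis_congr (Lp.coeFn_smul c h)]
    simp only [blochSynthesis, Pi.smul_apply, smul_eq_mul, mul_assoc]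
    exact integral_const_mul _ _
  norm_map' h := by
    simp only [LinearMap.coe_mk, AddHom.coe_mk]
    rw [Lp.norm_toLp, Lp.norm_def, eLpNorm_blochSynthesis hΦ hε]

theorem blochIsometry_coe (hΦ : IsFirstBlochWave A Φ) (hε : 0 < ε) (h : L2Dual n ε) :
    blochIsometry hΦ hε h =ᵐ[volume] blochSynthesis Φ ε h :=
  (memLp_blochSynthesis hΦ hε h).coeFn_toLp

/-- The restriction of the Fourier transform of `u` to `Z/ε`. -/
def fourierDual (ε : ℝ) (u : L2R n) : L2Dual n ε :=
  LpToLpRestrictCLM (Space n) ℂ ℂ volume 2 (scaledDualCell n ε) (fourierHat u)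

theorem fourierDual_coe (ε : ℝ) (u : L2R n) :
    fourierDual ε u =ᵐ[volume.restrict (scaledDualCell n ε)] fourierHat u :=
  LpToLpRestrictCLM_coeFn ℂ _ _

theorem blochIsometry_fourierDual (hΦ : IsFirstBlochWave A Φ) (hε : 0 < ε) (u : L2R n) :
    blochIsometry hΦ hε (fourierDual ε u) =ᵐ[volume] adaption Φ ε u := by
  have h := blochIsometry_coe hΦ hε (fourierDual ε u)
  rwa [blochSynthesis_congr (fourierDual_coe ε u)] at h

/-! ### The lowest Bloch coefficient -/

theorem memLp_ball_indicator (v : L2C n) (r : ℝ) :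
    MemLp ((Metric.ball (0 : Space n) r).indicator v) 2 (volume : Measure (Space n)) :=
  (Lp.memLp v).indicator measurableSet_ball

/-- Dominated convergence for the tail of `|v|²` outside the ball. -/
theorem tendsto_ball_indicator (v : L2C n) :
    Tendsto (fun r => (memLp_ball_indicator v r).toLp) atTop (𝓝 v) := by
  rw [Lp.tendsto_Lp_iff_tendsto_eLpNorm']
  have hvm : Measurable v := (Lp.stronglyMeasurable v).measurable
  have h1 : Tendsto (fun r : ℝ => ∫⁻ x, ((Metric.ball (0 : Space n) r)ᶜ).indicator
      (fun x => ‖v x‖ₑ ^ 2) x) atTop (𝓝 (∫⁻ _ : Space n, 0)) := by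
    refine tendsto_lintegral_filter_of_dominated_convergence (fun x => ‖v x‖ₑ ^ 2)
      (Eventually.of_forall fun r => (hvm.enorm.pow_const 2).indicator measurableSet_ball.compl)
      (Eventually.of_forall fun r => Eventually.of_forall fun x =>
        Set.indicator_le_self _ _ _) (lintegral_Lp_ne_top v) (Eventually.of_forall fun x => ?_)
    refine tendsto_const_nhds.congr' ?_
    filter_upwards [eventually_gt_atTop ‖x‖] with r hr
    rw [Set.indicator_of_notMem]
    simpa using hr
  simp only [lintegral_zero] at h1
  have h2 : ∀ r : ℝ, eLpNorm (⇑(memLp_ball_indicator v r).toLp - ⇑v) 2 volume =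
      (∫⁻ x, ((Metric.ball (0 : Space n) r)ᶜ).indicator (fun x => ‖v x‖ₑ ^ 2) x) ^ (1 / 2 : ℝ) := by
    intro r
    have e : ∫⁻ x, ‖(⇑(memLp_ball_indicator v r).toLp - ⇑v) x‖ₑ ^ 2 =
        ∫⁻ x, ((Metric.ball (0 : Space n) r)ᶜ).indicator (fun x => ‖v x‖ₑ ^ 2) x := by
      refine lintegral_congr_ae ?_
      filter_upwards [(memLp_ball_indicator v r).coeFn_toLp] with x hx
      rw [Pi.sub_apply, hx]
      by_cases hxr : x ∈ Metric.ball (0 : Space n) r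
      · rw [Set.indicator_of_mem hxr, Set.indicator_of_notMem (by simpa using hxr)]
        simp
      · rw [Set.indicator_of_notMem hxr, Set.indicator_of_mem (by simpa using hxr)]
        simp
    rw [← e, ← eLpNorm_two_sq, ← ENNReal.rpow_natCast, ← ENNReal.rpow_mul]
    norm_num
  simp only [h2]
  have h3 := (ENNReal.continuous_rpow_const (y := (1 / 2 : ℝ))).tendsto 0
  rw [ENNReal.zero_rpow_of_pos (by norm_num)] at h3
  exact h3.comp h1

/-- A product of two functions that are square integrable on ball times `Z/ε`: `v` because `Z/ε` has
finite measure, and the Bloch wave by the local bound taken with `h = 1`. -/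
theorem integrable_prod_blochWave (hΦ : IsFirstBlochWave A Φ) (hε : 0 < ε) (v : L2C n) (r : ℝ) :
    Integrable (Function.uncurry fun x η => v x * (starRingEnd ℂ) (blochWave Φ ε x η))
      ((volume.restrict (Metric.ball (0 : Space n) r)).prod
        (volume.restrict (scaledDualCell n ε))) := by
  have := isFiniteMeasure_scaledDualCell (n := n) hε
  have hω := measurable_blochWave hΦ.measurable ε
  have h1 : MemLp (fun p : Space n × Space n => v p.1) 2
      ((volume.restrict (Metric.ball (0 : Space n) r)).prod
        (volume.restrict (scaledDualCell n ε))) :=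
    ((Lp.memLp v).restrict _).comp_fst _
  have h2 : MemLp (fun p : Space n × Space n => blochWave Φ ε p.1 p.2) 2
      ((volume.restrict (Metric.ball (0 : Space n) r)).prod
        (volume.restrict (scaledDualCell n ε))) := by
    refine ⟨hω.aestronglyMeasurable, ?_⟩
    have h3 := lintegral_ball_blochWave_ne_top hΦ hε (h := fun _ => 1) measurable_const
      (by simpa using (measure_lt_top (volume.restrict (scaledDualCell n ε)) Set.univ).ne) r
    simp only [one_mul] at h3
    have h4 : ∫⁻ p, ‖blochWave Φ ε p.1 p.2‖ₑ ^ 2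
        ∂((volume.restrict (Metric.ball (0 : Space n) r)).prod
        (volume.restrict (scaledDualCell n ε))) < ⊤ := by
      rw [lintegral_prod _ (hω.enorm.pow_const 2).aemeasurable]
      exact h3.lt_top
    rw [← eLpNorm_two_sq, ENNReal.pow_lt_top_iff] at h4
    simpa using h4
  exact h1.integrable_mul h2.star

/-- The adjoint of the Bloch isometry is given by the integrals against the Bloch waves. -/
theorem integral_ball_blochWave_ae_eq (hΦ : IsFirstBlochWave A Φ) (hε : 0 < ε) (v : L2C n)
    (r : ℝ) :
    (fun η => ∫ x in Metric.ball (0 : Space n) r, v x * (starRingEnd ℂ) (blochWave Φ ε x η))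
      =ᵐ[volume.restrict (scaledDualCell n ε)]
      (blochIsometry hΦ hε).toContinuousLinearMap.adjoint (memLp_ball_indicator v r).toLp := by
  have := isFiniteMeasure_scaledDualCell (n := n) hε
  set σ := (volume : Measure (Space n)).restrict (scaledDualCell n ε) with hσ
  set L := (blochIsometry hΦ hε).toContinuousLinearMap with hL
  set w : L2C n := (memLp_ball_indicator v r).toLp with hw
  have hint := integrable_prod_blochWave hΦ hε v r
  -- Both functions are compared through their integrals over sets `s`. For the adjoint this is a
  -- pairing with the synthesis of the indicator of `s`, and Fubini exchanges the two integrals.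
  refine Integrable.ae_eq_of_forall_setIntegral_eq _ _ hint.integral_prod_right
    ((Lp.memLp _).integrable (by norm_num)) fun s hs hσs => ?_
  have hsyn : blochSynthesis Φ ε (indicatorConstLp 2 hs hσs.ne (1 : ℂ)) =
      fun x => ∫ η in s, blochWave Φ ε x η ∂σ := by
    rw [blochSynthesis_congr indicatorConstLp_coeFn]
    funext x
    rw [blochSynthesis, ← integral_indicator hs]
    refine integral_congr_ae (Eventually.of_forall fun η => ?_)
    by_cases h : η ∈ s <;> simp [h]
  have h1 : ∫ η in s, (L.adjoint w) η ∂σ =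
      ∫ x in Metric.ball (0 : Space n) r, ∫ η in s,
        v x * (starRingEnd ℂ) (blochWave Φ ε x η) ∂σ := by
    rw [← L2.inner_indicatorConstLp_one hs hσs.ne, ContinuousLinearMap.adjoint_inner_right,
      L2.inner_def, ← integral_indicator measurableSet_ball]
    refine integral_congr_ae ?_
    filter_upwards [blochIsometry_coe hΦ hε (indicatorConstLp 2 hs hσs.ne (1 : ℂ)),
      (memLp_ball_indicator v r).coeFn_toLp] with x h2 h3
    have h4 : (L (indicatorConstLp 2 hs hσs.ne (1 : ℂ))) x = ∫ η in s, blochWave Φ ε x η ∂σ := by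
      rw [hsyn] at h2
      exact h2
    rw [h4, hw, h3]
    by_cases hx : x ∈ Metric.ball (0 : Space n) r
    · rw [Set.indicator_of_mem hx, Set.indicator_of_mem hx, RCLike.inner_apply',
        integral_const_mul, integral_conj, mul_comm]
    · rw [Set.indicator_of_notMem hx, Set.indicator_of_notMem hx, inner_zero_right]
  rw [h1]
  refine (integral_integral_swap ?_).symm
  have e : (volume.restrict (Metric.ball (0 : Space n) r)).prod (σ.restrict s) =
      ((volume.restrict (Metric.ball (0 : Space n) r)).prod σ).restrict (Set.univ ×ˢ s) := by
    rw [← Measure.prod_restrict, Measure.restrict_univ]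
  rw [e]
  exact hint.restrict

/-- The lowest Bloch coefficient of the adaption of `u` is the Fourier transform of `u`. -/
theorem isLowestBlochCoeff_of_adaption (hΦ : IsFirstBlochWave A Φ) (hε : 0 < ε) {u v : L2R n}
    (hv : ∀ᵐ x : Space n, ((v x : ℝ) : ℂ) = adaption Φ ε u x) :
    IsLowestBlochCoeff Φ ε v (fourierHat u) := by
  refine ⟨(Lp.memLp (fourierHat u)).restrict _, ?_⟩
  set L := (blochIsometry hΦ hε).toContinuousLinearMap with hL
  have hvL : toComplex v = L (fourierDual ε u) := by
    apply Lp.ext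
    filter_upwards [hv, toComplex_coe v, blochIsometry_fourierDual hΦ hε u] with x h1 h2 h3
    rw [h2, h1, ← h3]
    rfl
  -- Continuity of the adjoint passes from truncations to `v`; since `L` is an isometry, its adjoint
  -- applied to `L û` returns `û`.
  have h1 := ((L.adjoint.continuous.tendsto _).comp (tendsto_ball_indicator (toComplex v)))
  have h2 : L.adjoint (toComplex v) = fourierDual ε u := by
    rw [hvL]
    refine ext_inner_left ℂ fun h => ?_
    rw [ContinuousLinearMap.adjoint_inner_right]
    exact (blochIsometry hΦ hε).inner_map_map _ _
  rw [h2, Lp.tendsto_Lp_iff_tendsto_eLpNorm'] at h1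
  refine h1.congr fun r => eLpNorm_congr_ae ?_
  filter_upwards [integral_ball_blochWave_ae_eq hΦ hε (toComplex v) r, fourierDual_coe ε u]
    with η h3 h4
  have h5 : ∫ x in Metric.ball (0 : Space n) r,
      ((v x : ℝ) : ℂ) * (starRingEnd ℂ) (blochWave Φ ε x η) =
      ∫ x in Metric.ball (0 : Space n) r,
        toComplex v x * (starRingEnd ℂ) (blochWave Φ ε x η) := by
    refine integral_congr_ae ?_
    filter_upwards [ae_restrict_of_ae (toComplex_coe v)] with x hx
    rw [hx]
  rw [h5, h3, Pi.sub_apply, h4]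
  rfl

end

end BlochControl

namespace BlochControl

noncomputable section

variable {n : ℕ}

/-! ### Minimization of strongly convex functionals -/

/-- The midpoint of two almost-minimizers cannot fall below the infimum, so the gain `c‖a - b‖²` is
bounded by their excess. Minimizing sequences are therefore Cauchy, and two minimizers coincide. -/
theorem existsUnique_isMinOn_of_midpoint {E : Type*} [NormedAddCommGroup E] [NormedSpace ℝ E]
    [CompleteSpace E] {S : Set E} (hconv : Convex ℝ S) (hclosed : IsClosed S) (hne : S.Nonempty)
    {J : E → ℝ} (hJ : Continuous J) (h0 : ∀ u, 0 ≤ J u) {c : ℝ} (hc : 0 < c)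
    (hmid : ∀ a ∈ S, ∀ b ∈ S,
      J ((1 / 2 : ℝ) • (a + b)) ≤ (J a + J b) / 2 - c * ‖a - b‖ ^ 2) :
    ∃! u, u ∈ S ∧ IsMinOn J S u := by
  set m := sInf (J '' S) with hm
  have hbdd : BddBelow (J '' S) := ⟨0, by rintro _ ⟨u, -, rfl⟩; exact h0 u⟩
  have hle : ∀ u ∈ S, m ≤ J u := fun u hu => csInf_le hbdd ⟨u, hu, rfl⟩
  have hmem : ∀ a ∈ S, ∀ b ∈ S, (1 / 2 : ℝ) • (a + b) ∈ S := fun a ha b hb => by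
    rw [smul_add]
    exact hconv ha hb (by norm_num) (by norm_num) (by norm_num)
  have hdist : ∀ a ∈ S, ∀ b ∈ S, c * ‖a - b‖ ^ 2 ≤ (J a + J b) / 2 - m := fun a ha b hb => by
    have h1 := hmid a ha b hb
    have h2 := hle _ (hmem a ha b hb)
    linarith
  have hseq : ∀ k : ℕ, ∃ u ∈ S, J u < m + 1 / ((k : ℝ) + 1) := fun k => by
    have hpos : (0 : ℝ) < 1 / ((k : ℝ) + 1) := by positivity
    obtain ⟨_, ⟨u, hu, rfl⟩, h⟩ := exists_lt_of_csInf_lt (hne.image J) (lt_add_of_pos_right m hpos)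
    exact ⟨u, hu, h⟩
  choose u huS huJ using hseq
  have htend : Tendsto (fun k : ℕ => 1 / ((k : ℝ) + 1)) atTop (𝓝 0) :=
    tendsto_one_div_add_atTop_nhds_zero_nat
  have hcauchy : CauchySeq u := by
    refine cauchySeq_of_le_tendsto_0 (fun N : ℕ => √(c⁻¹ * (1 / ((N : ℝ) + 1)))) ?_ ?_
    · intro k l N hk hl
      rw [dist_eq_norm]
      refine Real.le_sqrt_of_sq_le ?_
      have h1 := hdist _ (huS k) _ (huS l)
      have hkN : 1 / ((k : ℝ) + 1) ≤ 1 / ((N : ℝ) + 1) := Nat.one_div_le_one_div hk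
      have hlN : 1 / ((l : ℝ) + 1) ≤ 1 / ((N : ℝ) + 1) := Nat.one_div_le_one_div hl
      have h2 : c * ‖u k - u l‖ ^ 2 ≤ 1 / ((N : ℝ) + 1) := by
        linarith [huJ k, huJ l]
      rw [← div_eq_inv_mul, le_div_iff₀ hc]
      linarith
    · have h := ((htend.const_mul c⁻¹).sqrt)
      simpa using h
  obtain ⟨v, hv⟩ := cauchySeq_tendsto_of_complete hcauchy
  have hvS : v ∈ S := hclosed.mem_of_tendsto hv (Eventually.of_forall huS)
  have hvJ : J v ≤ m := by
    have h1 : Tendsto (fun k : ℕ => m + 1 / ((k : ℝ) + 1)) atTop (𝓝 (m + 0)) := htend.const_add m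
    rw [add_zero] at h1
    exact le_of_tendsto_of_tendsto' ((hJ.tendsto v).comp hv) h1 fun k => (huJ k).le
  refine ⟨v, ⟨hvS, fun w hw => hvJ.trans (hle w hw)⟩, fun w ⟨hwS, hwmin⟩ => ?_⟩
  have h1 := hdist w hwS v hvS
  have h2 : J w ≤ J v := hwmin hvS
  have h3 : ‖w - v‖ ^ 2 ≤ 0 := by
    by_contra! h
    have := mul_pos hc h
    linarith
  have h4 : ‖w - v‖ = 0 := by
    have := sq_nonneg ‖w - v‖
    exact pow_eq_zero_iff (two_ne_zero) |>.1 (le_antisymm h3 this)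
  exact sub_eq_zero.1 (norm_eq_zero.1 h4)

theorem norm_half_smul_add_sq {E : Type*} [NormedAddCommGroup E] [InnerProductSpace ℂ E] (x y : E) :
    ‖(1 / 2 : ℂ) • (x + y)‖ ^ 2 = (‖x‖ ^ 2 + ‖y‖ ^ 2) / 2 - ‖x - y‖ ^ 2 / 4 := by
  have h := parallelogram_law_with_norm ℂ x y
  rw [norm_smul, mul_pow]
  norm_num
  linarith

/-! ### The Fourier cost functional -/

variable {K : Set (Space n)}

theorem norm_sq_eq_integral {α : Type*} [MeasurableSpace α] {μ : Measure α} (g : Lp ℂ 2 μ) :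
    ‖g‖ ^ 2 = ∫ x, ‖g x‖ ^ 2 ∂μ := by
  have h := ofReal_integral_norm_sq (Lp.memLp g)
  rw [← eLpNorm_two_sq] at h
  rw [Lp.norm_def, ← ENNReal.toReal_pow, ← h, ENNReal.toReal_ofReal]
  exact integral_nonneg fun x => by positivity

theorem exists_mulCLM (hK : IsCompact K) {m : Space n → ℝ} (hm : Continuous m) :
    ∃ M : L2On K →L[ℂ] L2On K, ∀ g : L2On K,
      M g =ᵐ[volume.restrict K] fun η => (m η : ℂ) * g η := by
  obtain ⟨C, hC⟩ := hK.exists_bound_of_continuousOn hm.continuousOn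
  have hb : ∀ g : L2On K, ∀ᵐ η ∂(volume.restrict K), ‖(m η : ℂ) * g η‖ ≤ C * ‖g η‖ := fun g => by
    filter_upwards [ae_restrict_mem hK.measurableSet] with η hη
    rw [norm_mul, Complex.norm_real]
    gcongr
    exact hC η hη
  have hL : ∀ g : L2On K, MemLp (fun η => (m η : ℂ) * g η) 2 (volume.restrict K) := fun g =>
    (Lp.memLp g).of_le_mul
      ((Complex.continuous_ofReal.comp hm).aestronglyMeasurable.mul (Lp.aestronglyMeasurable g))
      (hb g)
  let M : L2On K →ₗ[ℂ] L2On K :=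
    { toFun := fun g => (hL g).toLp
      map_add' := fun g h => by
        apply Lp.ext
        filter_upwards [(hL g).coeFn_toLp, (hL h).coeFn_toLp, (hL (g + h)).coeFn_toLp,
          Lp.coeFn_add (hL g).toLp (hL h).toLp, Lp.coeFn_add g h] with η h1 h2 h3 h4 h5
        rw [h3, h4, Pi.add_apply, h1, h2, h5, Pi.add_apply]
        ring
      map_smul' := fun c g => by
        apply Lp.ext
        filter_upwards [(hL g).coeFn_toLp, (hL (c • g)).coeFn_toLp,
          Lp.coeFn_smul c (hL g).toLp, Lp.coeFn_smul c g] with η h1 h2 h3 h4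
        rw [h2, RingHom.id_apply, h3, Pi.smul_apply, h1, h4, Pi.smul_apply, smul_eq_mul,
          smul_eq_mul]
        ring }
  refine ⟨M.mkContinuous C fun g => ?_, fun g => (hL g).coeFn_toLp⟩
  refine Lp.norm_le_mul_norm_of_ae_le_mul ?_
  filter_upwards [(hL g).coeFn_toLp, hb g] with η h1 h2
  exact (congrArg norm h1).trans_le h2

theorem one_add_symbolQ_pos {ε : ℝ} {B2 : Tensor n 2} (hB2 : ∀ ξ, 0 ≤ contract B2 ξ)
    (η : Space n) : 0 < 1 + symbolQ ε B2 η := by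
  have := symbolQ_nonneg (ε := ε) hB2 η
  linarith

theorem one_add_symbolR_pos {ε : ℝ} {A2 B2 : Tensor n 2} {B4 : Tensor n 4}
    (hA2 : ∀ ξ, 0 ≤ contract A2 ξ) (hB2 : ∀ ξ, 0 ≤ contract B2 ξ) (hB4 : ∀ ξ, 0 ≤ contract B4 ξ)
    (η : Space n) : 0 < 1 + symbolR ε A2 B2 B4 η := by
  have := one_add_symbolQ_pos (ε := ε) hB2 η
  have := symbolQ_le_symbolR (ε := ε) (B2 := B2) hA2 hB4 η
  linarith

theorem continuous_symbolRatio {ε : ℝ} {A2 B2 : Tensor n 2} {B4 : Tensor n 4}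
    (hA2 : ∀ ξ, 0 ≤ contract A2 ξ) (hB2 : ∀ ξ, 0 ≤ contract B2 ξ) (hB4 : ∀ ξ, 0 ≤ contract B4 ξ) :
    Continuous (symbolRatio ε A2 B2 B4) :=
  (continuous_const.add (continuous_symbolQ ε B2)).div
    (continuous_const.add (continuous_symbolR ε A2 B2 B4))
    fun η => (one_add_symbolR_pos hA2 hB2 hB4 η).ne'

/-- The Fourier cost functional is a sum of squares of norms of affine maps. -/
theorem fourierCost_eq_norm_sq (hK : IsCompact K) {A2 B2 : Tensor n 2} {B4 : Tensor n 4}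
    (hA2 : ∀ ξ, 0 ≤ contract A2 ξ) (hB2 : ∀ ξ, 0 ≤ contract B2 ξ) (hB4 : ∀ ξ, 0 ≤ contract B4 ξ)
    (ε μ₁ μ₂ κ : ℝ) (f yd1 yd2 : L2R n) :
    ∃ (M₁ M₂ : L2On K →L[ℂ] L2On K) (c₁ c₂ : L2On K), ∀ g : L2On K,
      fourierCost ε μ₁ μ₂ κ A2 B2 B4 K f yd1 yd2 g =
        μ₁ / 2 * ‖M₁ g + c₁‖ ^ 2 + μ₂ / 2 * ‖M₂ g + c₂‖ ^ 2 + κ / 2 * ‖g‖ ^ 2 := by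
  have hρ := continuous_symbolRatio (ε := ε) hA2 hB2 hB4
  have hQ := one_add_symbolQ_pos (ε := ε) hB2
  have hR := one_add_symbolR_pos (ε := ε) hA2 hB2 hB4
  -- The square root of the weight `(1+R)/(1+Q)` is absorbed into the operator, which turns the
  -- weighted integral into an unweighted `L²` norm.
  have hs : Continuous fun η => √((1 + symbolR ε A2 B2 B4 η) / (1 + symbolQ ε B2 η)) :=
    ((continuous_const.add (continuous_symbolR ε A2 B2 B4)).div
      (continuous_const.add (continuous_symbolQ ε B2)) fun η => (hQ η).ne').sqrt
  obtain ⟨M₂, hM₂⟩ := exists_mulCLM hK hρ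
  obtain ⟨N, hN⟩ := exists_mulCLM hK hs
  have hM₂' : ∀ (g : L2On K) (y : L2R n), M₂ g + (M₂ (fourierOn K f) - fourierOn K y)
      =ᵐ[volume.restrict K] fun η =>
        (symbolRatio ε A2 B2 B4 η : ℂ) * (fourierHat f η + g η) - fourierHat y η := by
    intro g y
    filter_upwards [Lp.coeFn_add (M₂ g) (M₂ (fourierOn K f) - fourierOn K y),
      Lp.coeFn_sub (M₂ (fourierOn K f)) (fourierOn K y), hM₂ g, hM₂ (fourierOn K f),
      fourierOn_coe K f, fourierOn_coe K y] with η h1 h2 h3 h4 h5 h6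
    rw [h1, Pi.add_apply, h2, Pi.sub_apply, h3, h4, h5, h6]
    ring
  refine ⟨N ∘L M₂, M₂, N (M₂ (fourierOn K f) - fourierOn K yd1),
    M₂ (fourierOn K f) - fourierOn K yd2, fun g => ?_⟩
  unfold fourierCost
  have e₁ : ‖(N ∘L M₂) g + N (M₂ (fourierOn K f) - fourierOn K yd1)‖ ^ 2 = ∫ η in K,
      ‖(symbolRatio ε A2 B2 B4 η : ℂ) * (fourierHat f η + g η) - fourierHat yd1 η‖ ^ 2 *
        ((1 + symbolR ε A2 B2 B4 η) / (1 + symbolQ ε B2 η)) := by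
    rw [ContinuousLinearMap.comp_apply, ← map_add, norm_sq_eq_integral]
    refine integral_congr_ae ?_
    filter_upwards [hN (M₂ g + (M₂ (fourierOn K f) - fourierOn K yd1)), hM₂' g yd1] with η h1 h2
    rw [h1, h2, norm_mul, Complex.norm_real, Real.norm_eq_abs, abs_of_nonneg (Real.sqrt_nonneg _),
      mul_pow, Real.sq_sqrt (div_pos (hR η) (hQ η)).le, mul_comm]
  have e₂ : ‖M₂ g + (M₂ (fourierOn K f) - fourierOn K yd2)‖ ^ 2 = ∫ η in K,
      ‖(symbolRatio ε A2 B2 B4 η : ℂ) * (fourierHat f η + g η) - fourierHat yd2 η‖ ^ 2 := by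
    rw [norm_sq_eq_integral]
    refine integral_congr_ae ?_
    filter_upwards [hM₂' g yd2] with η h2
    rw [h2]
  rw [e₁, e₂, norm_sq_eq_integral]

/-! ### The effective admissible set -/

/-- The inclusion `L²(ℝⁿ) ⊆ L²(ℝⁿ; ℂ)` as a continuous linear map. -/
def toComplexCLM : L2R n →L[ℝ] L2C n := Complex.ofRealCLM.compLpL 2 volume

/-- The Fourier transform of real functions as a continuous linear map. -/
def fourierHatCLM : L2R n →L[ℝ] L2C n :=
  ((Lp.fourierTransformₗᵢ (Space n) ℂ).toContinuousLinearEquiv.toContinuousLinearMap.restrictScalars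
    ℝ) ∘L toComplexCLM

/-- The restriction of the Fourier transform to `K` as a continuous linear map. -/
def fourierOnCLM (K : Set (Space n)) : L2R n →L[ℝ] L2On K :=
  ((LpToLpRestrictCLM (Space n) ℂ ℂ volume 2 K).restrictScalars ℝ) ∘L fourierHatCLM

theorem fourierOnCLM_apply (K : Set (Space n)) (u : L2R n) :
    fourierOnCLM K u = fourierOn K u := rfl

theorem norm_toComplexCLM (u : L2R n) : ‖toComplexCLM u‖ = ‖u‖ := by
  have h : eLpNorm (toComplex u) 2 volume = eLpNorm u 2 volume := by
    refine eLpNorm_congr_norm_ae ?_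
    filter_upwards [toComplex_coe u] with x hx
    rw [hx, Complex.norm_real]
  change ‖toComplex u‖ = ‖u‖
  rw [Lp.norm_def, Lp.norm_def, h]

theorem isClosed_image_toComplexCLM {U : Set (L2R n)} (hU : IsClosed U) :
    IsClosed (toComplexCLM '' U) :=
  (AddMonoidHomClass.isometry_of_norm toComplexCLM norm_toComplexCLM).isClosedEmbedding.isClosedMap
    U hU

/-- The support condition as the kernel of a continuous linear map, hence visibly closed and convex.
-/
theorem fourierSuppIn_iff (hK : IsCompact K) (u : L2R n) :
    FourierSuppIn K u ↔ fourierOnCLM Kᶜ u = 0 := by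
  have e : FourierSuppIn K u ↔ ∀ᵐ η ∂(volume.restrict Kᶜ), fourierHat u η = 0 :=
    (ae_restrict_iff' hK.measurableSet.compl).symm
  rw [fourierOnCLM_apply, Lp.eq_zero_iff_ae_eq_zero, e]
  constructor
  · intro h
    filter_upwards [h, fourierOn_coe Kᶜ u] with η h1 h2
    rw [h2, h1]; rfl
  · intro h
    filter_upwards [h, fourierOn_coe Kᶜ u] with η h1 h2
    rw [← h2, h1]; rfl

/-- Transfers the coercivity of the `κ` term from `L²(K; ℂ)` to the controls, so that the
minimization can run in the real space `L²(ℝⁿ)`. -/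
theorem norm_fourierOn {u : L2R n} (hu : FourierSuppIn K u) :
    ‖fourierOn K u‖ = ‖u‖ := by
  have h1 : ‖fourierOn K u‖ ^ 2 = ‖fourierHat u‖ ^ 2 := by
    have e : ∫ η in K, ‖fourierHat u η‖ ^ 2 = ∫ η, ‖fourierHat u η‖ ^ 2 := by
      refine setIntegral_eq_integral_of_ae_compl_eq_zero ?_
      filter_upwards [hu] with η h h'
      simp [h h']
    rw [norm_sq_eq_integral, norm_sq_eq_integral, ← e]
    refine integral_congr_ae ?_
    filter_upwards [fourierOn_coe K u] with η h
    rw [h]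
  have h2 : ‖fourierHat u‖ = ‖u‖ := (Lp.norm_fourier_eq _).trans (norm_toComplexCLM u)
  rw [h2] at h1
  exact (sq_eq_sq₀ (norm_nonneg _) (norm_nonneg _)).1 h1

variable {A : Space n → Matrix (Fin n) (Fin n) ℝ} {Φ : Space n → Space n → ℂ} {ε : ℝ}

/-- The adaption as a continuous linear map. -/
def adaptionCLM (hΦ : IsFirstBlochWave A Φ) (hε : 0 < ε) : L2R n →L[ℝ] L2C n :=
  ((blochIsometry hΦ hε).toContinuousLinearMap.restrictScalars ℝ) ∘L
    fourierOnCLM (scaledDualCell n ε)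

theorem adaptionCLM_coe (hΦ : IsFirstBlochWave A Φ) (hε : 0 < ε) (u : L2R n) :
    adaptionCLM hΦ hε u =ᵐ[volume] adaption Φ ε u :=
  blochIsometry_fourierDual hΦ hε u

theorem funMem_adaption_iff (hΦ : IsFirstBlochWave A Φ) (hε : 0 < ε) (U : Set (L2R n))
    (u : L2R n) : FunMem (adaption Φ ε u) U ↔ adaptionCLM hΦ hε u ∈ toComplexCLM '' U := by
  refine exists_congr fun v => and_congr_right fun _ => ?_
  change _ ↔ toComplex v = adaptionCLM hΦ hε u
  rw [Lp.ext_iff]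
  constructor
  · intro h
    filter_upwards [h, toComplex_coe v, adaptionCLM_coe hΦ hε u] with x h1 h2 h3
    rw [h2, h1, h3]
  · intro h
    filter_upwards [h, toComplex_coe v, adaptionCLM_coe hΦ hε u] with x h1 h2 h3
    rw [← h2, h1, h3]

theorem effectiveSet_eq (hΦ : IsFirstBlochWave A Φ) (hε : 0 < ε) (hK : IsCompact K)
    (U : Set (L2R n)) : effectiveSet Φ ε K U =
      (fourierOnCLM Kᶜ) ⁻¹' {0} ∩ (adaptionCLM hΦ hε) ⁻¹' (toComplexCLM '' U) := by
  ext u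
  rw [mem_effectiveSet_iff hK, fourierSuppIn_iff hK, funMem_adaption_iff hΦ hε]
  rfl

theorem isClosed_effectiveSet (hΦ : IsFirstBlochWave A Φ) (hε : 0 < ε) (hK : IsCompact K)
    {U : Set (L2R n)} (hU : IsClosed U) : IsClosed (effectiveSet Φ ε K U) := by
  rw [effectiveSet_eq hΦ hε hK]
  exact (isClosed_singleton.preimage (fourierOnCLM Kᶜ).continuous).inter
    ((isClosed_image_toComplexCLM hU).preimage (adaptionCLM hΦ hε).continuous)

theorem convex_effectiveSet (hΦ : IsFirstBlochWave A Φ) (hε : 0 < ε) (hK : IsCompact K)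
    {U : Set (L2R n)} (hU : Convex ℝ U) : Convex ℝ (effectiveSet Φ ε K U) := by
  rw [effectiveSet_eq hΦ hε hK]
  exact ((convex_singleton 0).linear_preimage (fourierOnCLM Kᶜ).toLinearMap).inter
    ((hU.linear_image toComplexCLM.toLinearMap).linear_preimage (adaptionCLM hΦ hε).toLinearMap)

/-- Cut `û₀` off to `K`; symmetry of `K` keeps the function real. Its adaption is the projection of
the adaption of `u₀`, whose lowest Bloch coefficient is `û₀`, so the projection property puts it in
`U`. -/
theorem nonempty_effectiveSet (hΦ : IsFirstBlochWave A Φ) (hε : 0 < ε) (hK : IsCompact K)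
    (hKsymm : ∀ η ∈ K, -η ∈ K) (hKε : K ⊆ scaledDualCell n ε) {U : Set (L2R n)}
    (hU : IsAdmissibleSet Φ ε K U) : (effectiveSet Φ ε K U).Nonempty := by
  obtain ⟨u₀, v, hvU, hv⟩ := hU.adaption_mem
  have hproj := hU.projection_mem v hvU _ (isLowestBlochCoeff_of_adaption hΦ hε hv)
  have hL : MemLp (K.indicator (fourierHat u₀)) 2 (volume : Measure (Space n)) :=
    (Lp.memLp _).indicator hK.measurableSet
  have hmp := Measure.measurePreserving_neg (volume : Measure (Space n))
  obtain ⟨u₁, hu₁⟩ := exists_real_of_conj_symm hL.toLp (by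
    filter_upwards [hL.coeFn_toLp, hmp.quasiMeasurePreserving.ae hL.coeFn_toLp,
      fourierHat_neg_eq_conj u₀] with η h1 h2 h3
    rw [h1, h2]
    by_cases hη : η ∈ K
    · rw [Set.indicator_of_mem hη, Set.indicator_of_mem (hKsymm η hη), h3]
    · have : -η ∉ K := fun h => hη (by simpa using hKsymm _ h)
      rw [Set.indicator_of_notMem hη, Set.indicator_of_notMem this, map_zero])
  have hu₁' : fourierHat u₁ =ᵐ[volume] K.indicator (fourierHat u₀) := hu₁ ▸ hL.coeFn_toLp
  refine ⟨u₁, (mem_effectiveSet_iff hK).2 ⟨?_, ?_⟩⟩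
  · filter_upwards [hu₁'] with η h1 h2
    rw [h1, Set.indicator_of_notMem h2]
  -- Because `K ⊆ Z/ε`, the adaption integral of the truncated transform is exactly the integral
  -- over `K`.
  · have e : adaption Φ ε u₁ = fun x => ∫ η in K, fourierHat u₀ η * blochWave Φ ε x η := by
      funext x
      rw [adaption, ← Set.inter_eq_self_of_subset_right hKε,
        ← setIntegral_indicator hK.measurableSet]
      refine integral_congr_ae ?_
      filter_upwards [ae_restrict_of_ae hu₁'] with η h1
      rw [h1, Set.indicator_mul_left]
    rw [e]
    exact hproj

/-- The Fourier cost has exactly one minimizer over the Fourier transforms of the effective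
controls. -/
theorem existsUnique_effective_minimizer (hΦ : IsFirstBlochWave A Φ) (hε : 0 < ε)
    (hK : IsCompact K) (hKsymm : ∀ η ∈ K, -η ∈ K) (hKε : K ⊆ scaledDualCell n ε)
    {U : Set (L2R n)} (hU : IsAdmissibleSet Φ ε K U) {A2 B2 : Tensor n 2} {B4 : Tensor n 4}
    (hA2 : ∀ ξ, 0 ≤ contract A2 ξ) (hB2 : ∀ ξ, 0 ≤ contract B2 ξ) (hB4 : ∀ ξ, 0 ≤ contract B4 ξ)
    {μ₁ μ₂ κ : ℝ} (hμ₁ : 0 ≤ μ₁) (hμ₂ : 0 ≤ μ₂) (hκ : 0 < κ) (f yd1 yd2 : L2R n) :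
    ∃! u, u ∈ effectiveSet Φ ε K U ∧ IsMinOn
      (fun u => fourierCost ε μ₁ μ₂ κ A2 B2 B4 K f yd1 yd2 (fourierOn K u))
      (effectiveSet Φ ε K U) u := by
  obtain ⟨M₁, M₂, c₁, c₂, hM⟩ :=
    fourierCost_eq_norm_sq hK hA2 hB2 hB4 ε μ₁ μ₂ κ f yd1 yd2
  have hcont : Continuous fun u : L2R n => fourierOn K u := (fourierOnCLM K).continuous
  simp only [hM]
  -- The parallelogram law for `κ/2 ‖·‖²` leaves the defect `κ/2 · ‖a - b‖²/4`; the defects of the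
  -- other two terms only help.
  refine existsUnique_isMinOn_of_midpoint (c := κ / 8) (convex_effectiveSet hΦ hε hK hU.convex)
    (isClosed_effectiveSet hΦ hε hK hU.closed) (nonempty_effectiveSet hΦ hε hK hKsymm hKε hU)
    ?_ (fun u => by positivity) (by positivity) fun a ha b hb => ?_
  · have h1 := M₁.continuous.comp hcont
    have h2 := M₂.continuous.comp hcont
    simp only [Function.comp_def] at h1 h2
    fun_prop
  · have hab : FourierSuppIn K (a - b) :=
      ((mem_effectiveSet_iff hK).1 ha).1.sub ((mem_effectiveSet_iff hK).1 hb).1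
    have hsub : ‖fourierOn K a - fourierOn K b‖ = ‖a - b‖ := by
      rw [← norm_fourierOn hab, ← fourierOnCLM_apply, ← fourierOnCLM_apply,
        ← fourierOnCLM_apply, map_sub]
    have hhalf : fourierOn K ((1 / 2 : ℝ) • (a + b)) =
        (1 / 2 : ℂ) • (fourierOn K a + fourierOn K b) := by
      rw [← fourierOnCLM_apply, ← fourierOnCLM_apply, ← fourierOnCLM_apply, map_smul, map_add,
        ← algebraMap_smul ℂ (1 / 2 : ℝ)]
      norm_num
    have haff : ∀ (M : L2On K →L[ℂ] L2On K) (c x y : L2On K),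
        M ((1 / 2 : ℂ) • (x + y)) + c = (1 / 2 : ℂ) • ((M x + c) + (M y + c)) := by
      intro M c x y
      rw [map_smul, map_add]
      module
    rw [hhalf, haff, haff, norm_half_smul_add_sq, norm_half_smul_add_sq, norm_half_smul_add_sq,
      hsub]
    have h1 : 0 ≤ μ₁ / 2 * (‖(M₁ (fourierOn K a) + c₁) - (M₁ (fourierOn K b) + c₁)‖ ^ 2 / 4) := by
      positivity
    have h2 : 0 ≤ μ₂ / 2 * (‖(M₂ (fourierOn K a) + c₂) - (M₂ (fourierOn K b) + c₂)‖ ^ 2 / 4) := by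
      positivity
    linarith

/-! ### Solvability of the state equation -/

section Solve

variable {A2 B2 : Tensor n 2} {B4 : Tensor n 4}

theorem FourierSuppIn.add {u v : L2R n} (hu : FourierSuppIn K u) (hv : FourierSuppIn K v) :
    FourierSuppIn K (u + v) := by
  filter_upwards [hu, hv, fourierHat_add u v] with η h1 h2 h3 h4
  rw [h3, h1 h4, h2 h4, add_zero]

theorem auxEquation_iff_eq (hB2 : ∀ ξ, 0 ≤ contract B2 ξ) {y w : L2R n} :
    AuxEquation ε B2 y w ↔
      ∀ᵐ η : Space n, fourierHat w η = (((1 + symbolQ ε B2 η)⁻¹ : ℝ) : ℂ) * fourierHat y η := by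
  rw [auxEquation_iff]
  refine eventually_congr (Eventually.of_forall fun η => ?_)
  have h : ((1 + symbolQ ε B2 η : ℝ) : ℂ) ≠ 0 := by
    exact_mod_cast (one_add_symbolQ_pos (ε := ε) hB2 η).ne'
  rw [Complex.ofReal_inv, eq_inv_mul_iff_mul_eq₀ h]

theorem stateEquation_iff_eq (hA2 : ∀ ξ, 0 ≤ contract A2 ξ) (hB2 : ∀ ξ, 0 ≤ contract B2 ξ)
    (hB4 : ∀ ξ, 0 ≤ contract B4 ξ) {f u y : L2R n} :
    StateEquation ε A2 B2 B4 f u y ↔ ∀ᵐ η : Space n,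
      fourierHat y η = (symbolRatio ε A2 B2 B4 η : ℂ) * fourierHat (f + u) η := by
  rw [stateEquation_iff]
  refine eventually_congr ?_
  filter_upwards [fourierHat_add f u] with η hη
  have h : ((1 + symbolR ε A2 B2 B4 η : ℝ) : ℂ) ≠ 0 := by
    exact_mod_cast (one_add_symbolR_pos (ε := ε) hA2 hB2 hB4 η).ne'
  rw [hη, symbolRatio, Complex.ofReal_div, div_mul_eq_mul_div, eq_div_iff h, mul_comm]

theorem AuxEquation.unique (hB2 : ∀ ξ, 0 ≤ contract B2 ξ) {y w w' : L2R n}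
    (h : AuxEquation ε B2 y w) (h' : AuxEquation ε B2 y w') : w = w' := by
  rw [auxEquation_iff_eq hB2] at h h'
  exact fourierHat_ae_injective (EventuallyEq.trans h (EventuallyEq.symm h'))

theorem StateEquation.unique (hA2 : ∀ ξ, 0 ≤ contract A2 ξ) (hB2 : ∀ ξ, 0 ≤ contract B2 ξ)
    (hB4 : ∀ ξ, 0 ≤ contract B4 ξ) {f u y y' : L2R n} (h : StateEquation ε A2 B2 B4 f u y)
    (h' : StateEquation ε A2 B2 B4 f u y') : y = y' := by
  rw [stateEquation_iff_eq hA2 hB2 hB4] at h h'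
  exact fourierHat_ae_injective (EventuallyEq.trans h (EventuallyEq.symm h'))

theorem AuxEquation.fourierSuppIn (hB2 : ∀ ξ, 0 ≤ contract B2 ξ) {y w : L2R n}
    (h : AuxEquation ε B2 y w) (hy : FourierSuppIn K y) : FourierSuppIn K w :=
  hy.of_mul ((auxEquation_iff_eq hB2).1 h)

theorem StateEquation.fourierSuppIn (hA2 : ∀ ξ, 0 ≤ contract A2 ξ)
    (hB2 : ∀ ξ, 0 ≤ contract B2 ξ) (hB4 : ∀ ξ, 0 ≤ contract B4 ξ) {f u y : L2R n}
    (h : StateEquation ε A2 B2 B4 f u y) (hf : FourierSuppIn K f) (hu : FourierSuppIn K u) :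
    FourierSuppIn K y :=
  (hf.add hu).of_mul ((stateEquation_iff_eq hA2 hB2 hB4).1 h)

theorem exists_auxEquation (hK : IsCompact K) (hB2 : ∀ ξ, 0 ≤ contract B2 ξ) {y : L2R n}
    (hy : FourierSuppIn K y) : ∃ w : L2R n, AuxEquation ε B2 y w := by
  simp only [auxEquation_iff_eq hB2]
  refine exists_multiplier hK hy (Complex.continuous_ofReal.comp
    ((continuous_const.add (continuous_symbolQ ε B2)).inv₀
      fun η => (one_add_symbolQ_pos hB2 η).ne')) fun η => ?_
  rw [symbolQ_neg, Complex.conj_ofReal]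

theorem exists_stateEquation (hK : IsCompact K) (hA2 : ∀ ξ, 0 ≤ contract A2 ξ)
    (hB2 : ∀ ξ, 0 ≤ contract B2 ξ) (hB4 : ∀ ξ, 0 ≤ contract B4 ξ) {f u : L2R n}
    (hf : FourierSuppIn K f) (hu : FourierSuppIn K u) :
    ∃ y : L2R n, StateEquation ε A2 B2 B4 f u y := by
  simp only [stateEquation_iff_eq hA2 hB2 hB4]
  refine exists_multiplier hK (hf.add hu) (Complex.continuous_ofReal.comp
    (continuous_symbolRatio hA2 hB2 hB4)) fun η => ?_
  rw [symbolRatio, symbolRatio, symbolQ_neg, symbolR_neg, Complex.conj_ofReal]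

end Solve

end

end BlochControl

/-! ### Assembly of the equivalence. -/

theorem proposition4p4 {n : ℕ} (hn : 1 ≤ n)
    (A : Space n → Matrix (Fin n) (Fin n) ℝ) (hA : IsPeriodicCoefficient A)
    (Φ : Space n → Space n → ℂ) (hΦ : IsFirstBlochWave A Φ)
    (A2 : Tensor n 2) (A4 : Tensor n 4) (hTaylor : IsTaylorTensors A A2 A4)
    (B2 : Tensor n 2) (B4 : Tensor n 4) (hB : IsDecomposition A2 A4 B2 B4)
    (μ₁ μ₂ κ : ℝ) (hμ₁ : 0 ≤ μ₁) (hμ₂ : 0 ≤ μ₂) (hκ : 0 < κ)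
    (K : Set (Space n)) (hK : IsCompact K) (hKsymm : ∀ η ∈ K, -η ∈ K)
    (f yd1 yd2 : L2R n) (hf : FourierSuppIn K f) (hyd1 : FourierSuppIn K yd1)
    (hyd2 : FourierSuppIn K yd2)
    (ε : ℝ) (hε : 0 < ε) (hKε : K ⊆ scaledDualCell n ε)
    (U : Set (L2R n)) (hU : IsAdmissibleSet Φ ε K U) :
    -- `w_{d,1}` exists, it is unique, and it lies in `H³`
    (∃! wd1 : L2R n, AuxEquation ε B2 yd1 wd1) ∧
    ∀ wd1 : L2R n, AuxEquation ε B2 yd1 wd1 →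
      MemH 3 wd1 ∧
      -- a control in `U*_ad` has exactly one state and one auxiliary function, and the two costs
      -- agree
      (∀ u ∈ effectiveSet Φ ε K U, ∃ y w : L2R n,
        (u, y, w) ∈ feasibleSet ε A2 B2 B4 f (effectiveSet Φ ε K U) ∧
        (∀ y' : L2R n, MemH 1 y' → StateEquation ε A2 B2 B4 f u y' → y' = y) ∧
        (∀ w' : L2R n, AuxEquation ε B2 y w' → w' = w) ∧
        controlCost ε μ₁ μ₂ κ A2 B2 B4 wd1 yd2 u y w =
          fourierCost ε μ₁ μ₂ κ A2 B2 B4 K f yd1 yd2 (fourierOn K u)) ∧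
      -- the Fourier transform is a bijection between the two sets of controls
      (∀ u ∈ effectiveSet Φ ε K U, FourierSuppIn K u) ∧
      Set.BijOn (fourierOn K) (effectiveSet Φ ε K U) (fourierEffectiveSet Φ ε K U) ∧
      -- it maps optimal controls to minimizers, and conversely
      (∀ u y w : L2R n, (u, y, w) ∈ feasibleSet ε A2 B2 B4 f (effectiveSet Φ ε K U) →
        (IsOptimalTriple ε μ₁ μ₂ κ A2 B2 B4 f wd1 yd2 (effectiveSet Φ ε K U) (u, y, w) ↔
          IsFourierMinimizer ε μ₁ μ₂ κ A2 B2 B4 K f yd1 yd2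
            (fourierEffectiveSet Φ ε K U) (fourierOn K u))) ∧
      -- both problems are uniquely solvable
      (∃! uhat : L2On K, IsFourierMinimizer ε μ₁ μ₂ κ A2 B2 B4 K f yd1 yd2
        (fourierEffectiveSet Φ ε K U) uhat) ∧
      (∃! p : L2R n × L2R n × L2R n,
        IsOptimalTriple ε μ₁ μ₂ κ A2 B2 B4 f wd1 yd2 (effectiveSet Φ ε K U) p) ∧
      -- the minimizer is the Fourier transform of the optimal control
      (∀ (uhat : L2On K) (p : L2R n × L2R n × L2R n),
        IsFourierMinimizer ε μ₁ μ₂ κ A2 B2 B4 K f yd1 yd2 (fourierEffectiveSet Φ ε K U) uhat →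
        IsOptimalTriple ε μ₁ μ₂ κ A2 B2 B4 f wd1 yd2 (effectiveSet Φ ε K U) p →
        ∀ᵐ η : Space n, fourierHat p.1 η = K.indicator uhat η) := by
  have hA2 := hTaylor.contract_nonneg hA
  have hB2 := hB.1.2
  have hB4 := hB.2.1.contract_nonneg
  refine ⟨?_, fun wd1 hwd1 => ?_⟩
  · obtain ⟨w, hw⟩ := exists_auxEquation (ε := ε) hK hB2 hyd1
    exact ⟨w, hw, fun w' hw' => hw'.unique hB2 hw⟩
  have hwd1K : FourierSuppIn K wd1 := AuxEquation.fourierSuppIn hB2 hwd1 hyd1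
  set W := effectiveSet Φ ε K U
  set J := fourierCost ε μ₁ μ₂ κ A2 B2 B4 K f yd1 yd2
  have hsupp : ∀ u ∈ W, FourierSuppIn K u := fun u hu => ((mem_effectiveSet_iff hK).1 hu).1
  have hbij : Set.BijOn (fourierOn K) W (fourierEffectiveSet Φ ε K U) :=
    bijOn_fourierOn hK Φ ε U
  have hcost : ∀ u y w : L2R n, (u, y, w) ∈ feasibleSet ε A2 B2 B4 f W →
      controlCost ε μ₁ μ₂ κ A2 B2 B4 wd1 yd2 u y w = J (fourierOn K u) := by
    rintro u y w ⟨hu, ⟨-, hy⟩, -, hw⟩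
    have hyK := StateEquation.fourierSuppIn hA2 hB2 hB4 hy hf (hsupp u hu)
    exact controlCost_eq_fourierCost hK hA2 hB2 hB4 ε μ₁ μ₂ κ hyd2 hwd1K (hsupp u hu) hyK
      (AuxEquation.fourierSuppIn hB2 hw hyK) hy hw hwd1
  have hsolve : ∀ u ∈ W, ∃ y w : L2R n, (u, y, w) ∈ feasibleSet ε A2 B2 B4 f W := by
    intro u hu
    obtain ⟨y, hy⟩ := exists_stateEquation (ε := ε) hK hA2 hB2 hB4 hf (hsupp u hu)
    have hyK := StateEquation.fourierSuppIn hA2 hB2 hB4 hy hf (hsupp u hu)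
    obtain ⟨w, hw⟩ := exists_auxEquation (ε := ε) hK hB2 hyK
    exact ⟨y, w, hu, ⟨memH_of_fourierSuppIn hK 1 hyK, hy⟩,
      memH_of_fourierSuppIn hK 3 (AuxEquation.fourierSuppIn hB2 hw hyK), hw⟩
  have hunique : ∀ u y w y' w' : L2R n, (u, y, w) ∈ feasibleSet ε A2 B2 B4 f W →
      (u, y', w') ∈ feasibleSet ε A2 B2 B4 f W → y' = y ∧ w' = w := by
    rintro u y w y' w' ⟨-, ⟨-, hy⟩, -, hw⟩ ⟨-, ⟨-, hy'⟩, -, hw'⟩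
    obtain rfl : y' = y := StateEquation.unique hA2 hB2 hB4 hy' hy
    exact ⟨rfl, AuxEquation.unique hB2 hw' hw⟩
  -- Every control extends to a feasible triple, and on feasible triples the cost depends on the
  -- control alone, so the state variables drop out of the minimization.
  have hoptimal : ∀ u y w : L2R n,
      IsOptimalTriple ε μ₁ μ₂ κ A2 B2 B4 f wd1 yd2 W (u, y, w) ↔
        (u, y, w) ∈ feasibleSet ε A2 B2 B4 f W ∧ IsMinOn (fun u => J (fourierOn K u)) W u := by
    intro u y w
    refine and_congr_right fun h => ⟨fun hmin u' hu' => ?_, fun hmin p hp => ?_⟩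
    · obtain ⟨y', w', h'⟩ := hsolve u' hu'
      simpa only [Set.mem_ofPred_eq, hcost _ _ _ h, hcost _ _ _ h'] using hmin h'
    · obtain ⟨u', y', w'⟩ := p
      simpa only [Set.mem_ofPred_eq, hcost _ _ _ h, hcost _ _ _ hp] using hmin hp.1
  have hfourier : ∀ u ∈ W, (IsFourierMinimizer ε μ₁ μ₂ κ A2 B2 B4 K f yd1 yd2
      (fourierEffectiveSet Φ ε K U) (fourierOn K u) ↔
        IsMinOn (fun u => J (fourierOn K u)) W u) := by
    refine fun u hu => ⟨fun h u' hu' => h.2 (hbij.mapsTo hu'), fun h =>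
      ⟨hbij.mapsTo hu, fun v hv => ?_⟩⟩
    obtain ⟨u', hu', rfl⟩ := hbij.surjOn hv
    exact h hu'
  -- Both uniqueness claims are inherited from this one minimizer: through the bijection for the
  -- Fourier form, and through unique solvability of the equations for the triples.
  obtain ⟨u₀, ⟨hu₀, hmin₀⟩, huniq⟩ : ∃! u, u ∈ W ∧ IsMinOn (fun u => J (fourierOn K u)) W u :=
    existsUnique_effective_minimizer hΦ hε hK hKsymm hKε hU hA2 hB2 hB4 hμ₁ hμ₂ hκ f yd1 yd2
  have hcontrol : ∀ p, IsOptimalTriple ε μ₁ μ₂ κ A2 B2 B4 f wd1 yd2 W p → p.1 = u₀ := by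
    rintro ⟨u, y, w⟩ hp
    exact huniq u ⟨hp.1.1, ((hoptimal u y w).1 hp).2⟩
  have hminimizer : ∀ uhat, IsFourierMinimizer ε μ₁ μ₂ κ A2 B2 B4 K f yd1 yd2
      (fourierEffectiveSet Φ ε K U) uhat → uhat = fourierOn K u₀ := by
    intro uhat h
    obtain ⟨u, hu, rfl⟩ := hbij.surjOn h.1
    rw [huniq u ⟨hu, (hfourier u hu).1 h⟩]
  refine ⟨memH_of_fourierSuppIn hK 3 hwd1K, fun u hu => ?_, hsupp, hbij, fun u y w h => ?_,
    ⟨fourierOn K u₀, (hfourier u₀ hu₀).2 hmin₀, hminimizer⟩, ?_, fun uhat p h hp => ?_⟩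
  · obtain ⟨y, w, h⟩ := hsolve u hu
    exact ⟨y, w, h, fun y' _ hy' => StateEquation.unique hA2 hB2 hB4 hy' h.2.1.2,
      fun w' hw' => AuxEquation.unique hB2 hw' h.2.2.2, hcost u y w h⟩
  · rw [hoptimal, hfourier u h.1, and_iff_right h]
  · obtain ⟨y, w, h⟩ := hsolve u₀ hu₀
    refine ⟨(u₀, y, w), (hoptimal u₀ y w).2 ⟨h, hmin₀⟩, ?_⟩
    rintro ⟨u', y', w'⟩ hp
    obtain rfl : u' = u₀ := hcontrol _ hp
    obtain ⟨rfl, rfl⟩ := hunique u' y w y' w' h hp.1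
    rfl
  · rw [hminimizer uhat h, hcontrol p hp]
    exact (hsupp u₀ hu₀).ae_eq_indicator hK
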